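/- Let $B$ be a connected (Hausdorff, finite-dimensional) smooth manifold without boundary, $x_0\in B$, and let $G$ be a (finite-dimensional) Lie group. A principal $G$-bundle $P\to B$ is a smooth, locally trivial principal bundle with right $G$-action; a connection $A$ on $P$ is a smooth connection form, and it is flat if its curvature form $dA+\frac12[A\wedge A]$ vanishes. Write $\mathcal A_{flat}(P)$ for the set of flat connections on $P$, and $\mathcal G(P)$ for the gauge group (the bundle automorphisms of $P$ covering $\mathrm{id}_B$, acting by pullback). In $\pi_1(B,x_0)$ the product $[\gamma][\gamma']$ is the class of the loop that runs first along $\gamma'$ and then along $\gamma$. For a flat connection $A$ and a point $p_0\in P$ over $x_0$, a homomorphism $\rho:\pi_1(B,x_0)\to G$ is called the holonomy of $A$ at $p_0$ if for every smooth loop $\gamma$ at $x_0$ the $A$-parallel transport along $\gamma$ sends $p_0$ to $p_0\cdot\rho([\gamma])$. For a universal covering $p:(\tilde B,\tilde x_0)\to(B,x_0)$, let $\pi_1(B,x_0)$ act on $\tilde B$ from the right by covering transformations, $\tilde x_0\cdot[\gamma]$ being the endpoint of the lift of $\gamma$ that starts at $\tilde x_0$. For $\rho\in\mathrm{Hom}(\pi_1(B,x_0),G)$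 let $\tilde B\times_{\rho}G$ be the principal $G$-bundle $(\tilde B\times G)/\big((\tilde x,g)\sim(\tilde x\cdot\alpha,\rho(\alpha)^{-1}g)\big)$, with quotient map $q:\tilde B\times G\to\tilde B\times_\rho G$, and let $\Theta$ be the trivial connection on $\tilde B\times G$ (the pullback of the left-invariant Maurer–Cartan form of $G$). Theorem. Let $P\to B$ be a principal $G$-bundle and $A$ a flat connection on $P$. For every $p_0\in P$ over $x_0$ the holonomy of $A$ at $p_0$ exists and is unique. Moreover, there is a representation $\rho:\pi_1(B,x_0)\to G$, which is the holonomy of $A$ at some point over $x_0$, such that for every universal covering $\tilde B$ of $B$ as above: (a) $P$ is isomorphic to $\tilde B\times_\rho G$; (b) there is an isomorphism of principal bundles $\Phi:\tilde B\times_\rho G\to P$ with $q^*\Phi^*A=\Theta$. This $\rho$ is unique up to conjugation: every $\rho'$ that is the holonomy of $A$ at some point over $x_0$, or that satisfies (b) for some universal covering, is conjugate to $\rho$ by an element of $G$. (c) Sending a flat connection to the conjugacy class of its holonomy gives, for every $P$, a well-defined injective map $$hol:\mathcal A_{flat}(P)/\mathcal G(P)\to \mathrm{Hom}(\pi_1(B,x_0),G)/\text{conjugation},$$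 and these maps together give a bijection $$hol:\bigsqcup_{\text{isomorphism classes of }P}\mathcal A_{flat}(P)/\mathcal G(P)\to \mathrm{Hom}(\pi_1(B,x_0),G)/\text{conjugation},$$ where the disjoint union contains one representative $P$ of every isomorphism class of principal $G$-bundles over $B$. -/

import Mathlib

open scoped Manifold ContDiff
open Set

universe u v w

noncomputable section

namespace FlatBundle

section Bundles

variable (E F : Type*) [NormedAddCommGroup E] [NormedSpace ℝ E]
  [NormedAddCommGroup F] [NormedSpace ℝ F]
  (B : Type*) [TopologicalSpace B] [ChartedSpace E B]
  (G : Type*) [TopologicalSpace G] [ChartedSpace F G] [Group G]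

/-- The model with corners of a manifold that is locally a product of a manifold modelled on `E`
and a manifold modelled on `F`. -/
abbrev prodModel : ModelWithCorners ℝ (E × F) (ModelProd E F) := 𝓘(ℝ, E).prod 𝓘(ℝ, F)

/-- A smooth principal `G`-bundle over `B`: a smooth manifold `Total` with a smooth right action
`act` of `G` and a smooth projection to `B` that is, locally over `B`, equivariantly diffeomorphic
to the product `U × G`. -/
structure PrincipalBundle where
  /-- The total space. -/
  Total : Type w
  [topology : TopologicalSpace Total]
  [charts : ChartedSpace (ModelProd E F) Total]
  [manifold : IsManifold (prodModel E F) ∞ Total]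
  /-- The bundle projection. -/
  proj : Total → B
  /-- The right action of the structure group. -/
  act : Total → G → Total
  act_one : ∀ p, act p 1 = p
  act_mul : ∀ p g h, act p (g * h) = act (act p g) h
  proj_act : ∀ p g, proj (act p g) = proj p
  contMDiff_proj : ContMDiff (prodModel E F) 𝓘(ℝ, E) ∞ proj
  contMDiff_act : ContMDiff ((prodModel E F).prod 𝓘(ℝ, F)) (prodModel E F) ∞
    (fun z : Total × G => act z.1 z.2)
  locallyTrivial : ∀ b : B, ∃ (U : Set B) (φ : OpenPartialHomeomorph Total (B × G)),
    IsOpen U ∧ b ∈ U ∧ φ.source = proj ⁻¹' U ∧ φ.target = U ×ˢ univ ∧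
    ContMDiffOn (prodModel E F) (prodModel E F) ∞ φ φ.source ∧
    ContMDiffOn (prodModel E F) (prodModel E F) ∞ φ.symm φ.target ∧
    ∀ p ∈ φ.source, (φ p).1 = proj p ∧ ∀ g, φ (act p g) = ((φ p).1, (φ p).2 * g)

attribute [instance] PrincipalBundle.topology PrincipalBundle.charts PrincipalBundle.manifold

end Bundles

section Geometry

variable {E F : Type*} [NormedAddCommGroup E] [NormedSpace ℝ E]
  [NormedAddCommGroup F] [NormedSpace ℝ F]
  {B : Type*} [TopologicalSpace B] [ChartedSpace E B]
  {G : Type*} [TopologicalSpace G] [ChartedSpace F G] [Group G]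

/-- An isomorphism of principal `G`-bundles over `B`: a `G`-equivariant diffeomorphism of total
spaces that covers the identity of `B`. -/
structure BundleIso (P Q : PrincipalBundle E F B G) where
  /-- The underlying diffeomorphism. -/
  toDiffeo : P.Total ≃ₘ^∞⟮prodModel E F, prodModel E F⟯ Q.Total
  proj_apply : ∀ p, Q.proj (toDiffeo p) = P.proj p
  map_act : ∀ p g, toDiffeo (P.act p g) = Q.act (toDiffeo p) g

variable (F G) in
/-- The adjoint action `Ad g : 𝔤 → 𝔤`, the derivative at `1` of `h ↦ g * h * g⁻¹`. -/
def Ad (g : G) (ξ : GroupLieAlgebra 𝓘(ℝ, F) G) : GroupLieAlgebra 𝓘(ℝ, F) G :=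
  mfderiv 𝓘(ℝ, F) 𝓘(ℝ, F) (fun h : G => g * h * g⁻¹) 1 ξ

/-- A (smooth) connection on a principal `G`-bundle, given by its connection form: a smooth
`𝔤`-valued one-form that sends the fundamental vector field of `ξ : 𝔤` to `ξ` and satisfies
`R_g^* ω = Ad(g⁻¹) ω`. -/
structure Connection (P : PrincipalBundle E F B G) where
  /-- The connection form. -/
  form : ∀ p : P.Total, TangentSpace (prodModel E F) p →L[ℝ] GroupLieAlgebra 𝓘(ℝ, F) G
  smooth : ContMDiff (M' := F) (prodModel E F).tangent 𝓘(ℝ, F) ∞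
    (fun v : TangentBundle (prodModel E F) P.Total => form v.1 v.2)
  vertical : ∀ (p : P.Total) (ξ : GroupLieAlgebra 𝓘(ℝ, F) G),
    form (P.act p 1) (mfderiv 𝓘(ℝ, F) (prodModel E F) (fun g : G => P.act p g) 1 ξ) = ξ
  equivariant : ∀ (p : P.Total) (g : G) (v : TangentSpace (prodModel E F) p),
    form (P.act p g) (mfderiv (prodModel E F) (prodModel E F) (fun q => P.act q g) p v) =
      Ad F G g⁻¹ (form p v)

namespace Connection

variable {P : PrincipalBundle E F B G}

/-- The connection form written in the chart of the total space that is centred at `p`. -/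
def formInChart (A : Connection P) (p : P.Total) (y : E × F) : E × F →L[ℝ] F :=
  (A.form ((extChartAt (prodModel E F) p).symm y)).comp
    (mfderiv 𝓘(ℝ, E × F) (prodModel E F) (extChartAt (prodModel E F) p).symm y)

/-- The exterior derivative of the connection form. The chart centred at `p` identifies the
tangent space at `p` with the model space by definition of `TangentSpace`. -/
def dform (A : Connection P) (p : P.Total) (v w : TangentSpace (prodModel E F) p) :
    GroupLieAlgebra 𝓘(ℝ, F) G :=
  fderiv ℝ (A.formInChart p) (extChartAt (prodModel E F) p p) v w -
    fderiv ℝ (A.formInChart p) (extChartAt (prodModel E F) p p) w v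

/-- The curvature form `dω + ½[ω ∧ ω]`, whose value on `(v, w)` is `dω(v, w) + [ω(v), ω(w)]`. -/
def curvature (A : Connection P) (p : P.Total) (v w : TangentSpace (prodModel E F) p) :
    GroupLieAlgebra 𝓘(ℝ, F) G :=
  A.dform p v w + ⁅A.form p v, A.form p w⁆

/-- A connection is flat if its curvature vanishes. -/
def IsFlat (A : Connection P) : Prop :=
  ∀ p v w, A.curvature p v w = 0

/-- The path `γ` in the base is smooth and its parallel transport for the connection `A` sends `p`
to `q`: there is a smooth path from `p` to `q` over `γ` that is horizontal, that is, on whose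
velocity the connection form vanishes. -/
def IsParallelTransport (A : Connection P) {x y : B} (γ : Path x y) (p q : P.Total) : Prop :=
  ∃ c : Path p q, (∀ t, P.proj (c t) = γ t) ∧
    ContMDiffOn 𝓘(ℝ, ℝ) (prodModel E F) ∞ c.extend (Icc 0 1) ∧
    ∀ t ∈ Icc (0 : ℝ) 1,
      A.form (c.extend t) (mfderivWithin 𝓘(ℝ, ℝ) (prodModel E F) c.extend (Icc 0 1) t (1 : ℝ)) = 0

/-- The representation `ρ` of the fundamental group is the holonomy of `A` with respect to the
point `p₀` over the base point `x₀`: parallel transport along every smooth loop `γ` at `x₀` sends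
`p₀` to `p₀ · ρ([γ])`. -/
def IsHolonomy (A : Connection P) {x₀ : B} (p₀ : P.Total) (ρ : FundamentalGroup B x₀ →* G) :
    Prop :=
  ∀ γ : Path x₀ x₀, ContMDiffOn 𝓘(ℝ, ℝ) 𝓘(ℝ, E) ∞ γ.extend (Icc 0 1) →
    A.IsParallelTransport γ p₀ (P.act p₀ (ρ (FundamentalGroup.fromPath (.mk γ))))

end Connection

end Geometry
section Quotients

set_option linter.unusedSectionVars false

variable {V H : Type*} [NormedAddCommGroup V] [NormedSpace ℝ V] [TopologicalSpace H]
  {I : ModelWithCorners ℝ V H}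
  {M N : Type*} [TopologicalSpace M] [ChartedSpace H M] [TopologicalSpace N]
  {f : M → N}

/-- The fibres of `f` are permuted transitively by smooth self-maps of `M` over `N`. -/
def HasSmoothDeck (I : ModelWithCorners ℝ V H) (f : M → N) : Prop :=
  ∀ x y, f x = f y → ∃ τ : M → M, ContMDiff I I ∞ τ ∧ τ x = y ∧ ∀ z, f (τ z) = f z

theorem HasSmoothDeck.contMDiffAt_localInverse (h : HasSmoothDeck I f) {s : N → M} {x : M}
    {U : Set M} (hU : U ∈ nhds (s (f x))) (hs : ∀ y ∈ U, s (f y) = y)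
    (hx : f (s (f x)) = f x) :
    ContMDiffAt I I ∞ (fun y => s (f y)) x := by
  obtain ⟨τ, hτ, hτx, hfτ⟩ := h x (s (f x)) hx.symm
  refine hτ.contMDiffAt.congr_of_eventuallyEq ?_
  have : τ ⁻¹' U ∈ nhds x := hτ.continuous.continuousAt.preimage_mem_nhds (by rwa [hτx])
  filter_upwards [this] with y hy
  rw [← hfτ y, hs _ hy]

theorem isManifold_of_deck [IsManifold I ∞ M] (hf : IsLocalHomeomorph f)
    (hsurj : Function.Surjective f) (h : HasSmoothDeck I f) :
    @IsManifold ℝ _ V _ _ H _ I ∞ N _ (hf.chartedSpace (H := H) hsurj) := by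
  let _ := hf.chartedSpace (H := H) hsurj
  apply isManifold_of_contDiffOn
  rintro e e' ⟨q, rfl⟩ ⟨q', rfl⟩
  set g := hsurj.hasRightInverse.choose
  set S := hf.localInverseAt (g q)
  set S' := hf.localInverseAt (g q')
  have key : ContMDiffOn I I ∞ ((S.trans (chartAt H (g q))).symm.trans
      (S'.trans (chartAt H (g q')))) ((S.trans (chartAt H (g q))).symm.trans
      (S'.trans (chartAt H (g q')))).source := by
    intro z hz
    simp only [OpenPartialHomeomorph.trans_symm_eq_symm_trans_symm,
      OpenPartialHomeomorph.trans_source, OpenPartialHomeomorph.symm_source, mem_inter_iff,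
      mem_preimage, OpenPartialHomeomorph.coe_trans, Function.comp_apply] at hz
    obtain ⟨⟨hz1, hz2⟩, hz3, hz4⟩ := hz
    have hS : (S.symm : M → N) = f := hf.localInverseAt_symm _
    have hS' : (S'.symm : M → N) = f := hf.localInverseAt_symm _
    rw [hS] at hz3 hz4
    apply ContMDiffAt.contMDiffWithinAt
    have h1 : ContMDiffAt I I ∞ (chartAt H (g q)).symm z :=
      (contMDiffOn_chart_symm (I := I)).contMDiffAt ((chartAt H (g q)).open_target.mem_nhds hz1)
    have h2 : ContMDiffAt I I ∞ (fun y => S' (f y)) ((chartAt H (g q)).symm z) := by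
      refine h.contMDiffAt_localInverse (s := S') (U := S'.target)
        (S'.open_target.mem_nhds (S'.map_source hz3)) ?_ ?_
      · intro y hy
        rw [← hS', S'.right_inv hy]
      · rw [← congrFun hS' (S' _), S'.left_inv hz3]
    have h3 : ContMDiffAt I I ∞ (chartAt H (g q')) (S' (f ((chartAt H (g q)).symm z))) :=
      (contMDiffOn_chart (I := I)).contMDiffAt ((chartAt H (g q')).open_source.mem_nhds hz4)
    have h4 := ContMDiffAt.comp z h3 (ContMDiffAt.comp z h2 h1)
    refine h4.congr_of_eventuallyEq (Filter.Eventually.of_forall fun y => ?_)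
    simp only [OpenPartialHomeomorph.trans_symm_eq_symm_trans_symm,
      OpenPartialHomeomorph.coe_trans, Function.comp_apply]
    rw [hS]
  have hk := (contMDiffOn_iff.1 key).2 (chartAt H (g q) (g q)) (chartAt H (g q) (g q))
  refine (hk.mono ?_).congr ?_
  · rintro z ⟨hz, hz'⟩
    refine ⟨by simpa [chartAt_self_eq] using hz', by simpa [chartAt_self_eq] using hz,
      by simp [chartAt_self_eq]⟩
  · intro z _
    simp [chartAt_self_eq]

theorem isLocalDiffeomorph_of_deck [IsManifold I ∞ M] (hf : IsLocalHomeomorph f)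
    (hsurj : Function.Surjective f) (h : HasSmoothDeck I f) :
    @IsLocalDiffeomorph ℝ _ V _ _ V _ _ H _ H _ I I M _ _ N _
      (hf.chartedSpace (H := H) hsurj) ∞ f := by
  let _ := hf.chartedSpace (H := H) hsurj
  have _ := isManifold_of_deck hf hsurj h
  set g := hsurj.hasRightInverse.choose with hg_def
  have hg : ∀ y, f (g y) = y := hsurj.hasRightInverse.choose_spec
  have hat : ∀ y, (hf.localInverseAt (g y)).trans (chartAt H (g y)) ∈
      IsManifold.maximalAtlas I ∞ N := fun y =>
    IsManifold.subset_maximalAtlas ⟨y, rfl⟩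
  have hS : ∀ y, ((hf.localInverseAt (g y)).symm : M → N) = f := fun y =>
    hf.localInverseAt_symm _
  -- the chosen local sections of `f` are smooth
  have hsec : ∀ y, ContMDiffAt I I ∞ (hf.localInverseAt (g y)) y := by
    intro y
    set S := hf.localInverseAt (g y)
    have hyS : y ∈ S.source := by
      have := hf.apply_self_mem_localInverseAt_source (x := g y)
      rwa [hg] at this
    have hSy : S y = g y := by
      have := hf.localInverseAt_apply_self (x := g y)
      rwa [hg] at this
    have hsrc : y ∈ (S.trans (chartAt H (g y))).source := by
      simp [hyS, hSy]
    have h1 : ContMDiffAt I I ∞ (S.trans (chartAt H (g y))) y :=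
      contMDiffAt_of_mem_maximalAtlas (hat y) hsrc
    have h2 : ContMDiffAt I I ∞ (chartAt H (g y)).symm (S.trans (chartAt H (g y)) y) :=
      (contMDiffOn_chart_symm (I := I)).contMDiffAt
        ((chartAt H (g y)).open_target.mem_nhds (by simp [hSy]))
    refine (ContMDiffAt.comp y h2 h1).congr_of_eventuallyEq ?_
    filter_upwards [(S.trans (chartAt H (g y))).open_source.mem_nhds hsrc] with z hz
    rw [OpenPartialHomeomorph.trans_source] at hz
    simp [(chartAt H (g y)).left_inv hz.2]
  have hfsm : ContMDiff I I ∞ f := by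
    intro x
    set S := hf.localInverseAt (g (f x))
    set c := chartAt H (g (f x))
    have hyS : f x ∈ S.source := by
      have := hf.apply_self_mem_localInverseAt_source (x := g (f x))
      rwa [hg] at this
    have hSy : S (f x) = g (f x) := by
      have := hf.localInverseAt_apply_self (x := g (f x))
      rwa [hg] at this
    have hcs : S (f x) ∈ c.source := by rw [hSy]; exact mem_chart_source H _
    have h1 : ContMDiffAt I I ∞ (fun y => S (f y)) x := by
      refine h.contMDiffAt_localInverse (s := S) (U := S.target)
        (S.open_target.mem_nhds (S.map_source hyS)) ?_ ?_
      · intro y hy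
        rw [← hS (f x), S.right_inv hy]
      · rw [hSy, hg]
    have h2 : ContMDiffAt I I ∞ c (S (f x)) :=
      (contMDiffOn_chart (I := I)).contMDiffAt (c.open_source.mem_nhds hcs)
    have htgt : c (S (f x)) ∈ (S.trans c).target := by
      simp [c.left_inv hcs, S.map_source hyS, c.map_source hcs]
    have h3 : ContMDiffAt I I ∞ (S.trans c).symm (c (S (f x))) :=
      (contMDiffOn_symm_of_mem_maximalAtlas (hat (f x))).contMDiffAt
        ((S.trans c).open_target.mem_nhds htgt)
    refine (ContMDiffAt.comp x h3 (ContMDiffAt.comp x h2 h1)).congr_of_eventuallyEq ?_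
    have hsrc : (S.trans c).source ∈ nhds (f x) :=
      (S.trans c).open_source.mem_nhds (by simp [hyS, hcs])
    filter_upwards [hf.continuous.continuousAt.preimage_mem_nhds hsrc] with z hz
    exact ((S.trans c).left_inv hz).symm
  intro x
  obtain ⟨e, hxe, hfe⟩ := hf x
  refine ⟨⟨e.toPartialEquiv, e.open_source, e.open_target, ?_, ?_⟩, hxe, fun z _ => congrFun hfe z⟩
  · exact hfsm.contMDiffOn.congr fun z _ => (congrFun hfe z).symm
  · intro z hz
    change ContMDiffWithinAt I I ∞ e.symm e.target z
    apply ContMDiffAt.contMDiffWithinAt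
    have hfz : f (e.symm z) = z := by rw [hfe]; exact e.right_inv hz
    obtain ⟨τ, hτ, hτz, hfτ⟩ := h (g z) (e.symm z) (by rw [hg, hfz])
    have hSz : hf.localInverseAt (g z) z = g z := by
      have := hf.localInverseAt_apply_self (x := g z)
      rwa [hg] at this
    have hzS : z ∈ (hf.localInverseAt (g z)).source := by
      have := hf.apply_self_mem_localInverseAt_source (x := g z)
      rwa [hg] at this
    have hcomp : ContMDiffAt I I ∞ (τ ∘ hf.localInverseAt (g z)) z :=
      hτ.contMDiffAt.comp z (hsec z)
    refine hcomp.congr_of_eventuallyEq ?_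
    have hmem : e.source ∈ nhds ((τ ∘ hf.localInverseAt (g z)) z) := by
      rw [Function.comp_apply, hSz, hτz]
      exact e.open_source.mem_nhds (e.map_target hz)
    filter_upwards [hcomp.continuousAt.preimage_mem_nhds hmem,
      (hf.localInverseAt (g z)).open_source.mem_nhds hzS] with w hw hw'
    have h5 : e (τ (hf.localInverseAt (g z) w)) = w := by
      rw [← hfe, hfτ, hf.apply_localInverseAt_of_mem hw']
    have h6 := e.left_inv hw
    rw [Function.comp_apply, h5] at h6
    exact h6

variable {H' V' : Type*} [NormedAddCommGroup V'] [NormedSpace ℝ V'] [TopologicalSpace H']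
  {I' : ModelWithCorners ℝ V' H'} {N' : Type*} [TopologicalSpace N'] [ChartedSpace H' N']
  [ChartedSpace H N]

theorem contMDiff_of_comp_localDiffeo (hf : IsLocalDiffeomorph I I ∞ f)
    (hsurj : Function.Surjective f) {k : N → N'} (hk : ContMDiff I I' ∞ (k ∘ f)) :
    ContMDiff I I' ∞ k := by
  intro y
  obtain ⟨x, rfl⟩ := hsurj y
  have h1 := (hf x).localInverse_contMDiffAt
  have h2 : ContMDiffAt I I' ∞ ((k ∘ f) ∘ (hf x).localInverse) (f x) :=
    hk.contMDiffAt.comp _ h1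
  refine h2.congr_of_eventuallyEq ?_
  filter_upwards [(hf x).localInverse_eventuallyEq_right] with z hz
  simp only [Function.comp_apply, id] at hz ⊢
  rw [hz]

theorem contMDiff_of_localDiffeo_comp (hf : IsLocalDiffeomorph I I ∞ f)
    {k : N' → M} (hkc : Continuous k) (hk : ContMDiff I' I ∞ (f ∘ k)) :
    ContMDiff I' I ∞ k := by
  intro y
  have h1 := (hf (k y)).localInverse_contMDiffAt
  have h2 : ContMDiffAt I' I ∞ ((hf (k y)).localInverse ∘ (f ∘ k)) y :=
    ContMDiffAt.comp y h1 hk.contMDiffAt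
  refine h2.congr_of_eventuallyEq ?_
  filter_upwards [hkc.continuousAt.eventually (hf (k y)).localInverse_eventuallyEq_left] with z hz
  simp only [Function.comp_apply, id] at hz ⊢
  rw [hz]

end Quotients
section Covering

/-- A universal covering of the smooth manifold `B` with base point over `x₀`: a simply connected
smooth manifold with a covering map to `B` that is a local diffeomorphism. -/
structure UniversalCover (E : Type*) [NormedAddCommGroup E] [NormedSpace ℝ E]
    {B : Type*} [TopologicalSpace B] [ChartedSpace E B] (x₀ : B) where
  /-- The total space of the covering. -/
  Total : Type w
  [topology : TopologicalSpace Total]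
  [charts : ChartedSpace E Total]
  [manifold : IsManifold 𝓘(ℝ, E) ∞ Total]
  [simplyConnected : SimplyConnectedSpace Total]
  /-- The covering map. -/
  proj : Total → B
  isCoveringMap : IsCoveringMap proj
  isLocalDiffeomorph : IsLocalDiffeomorph 𝓘(ℝ, E) 𝓘(ℝ, E) ∞ proj
  /-- The base point of the covering. -/
  base : Total
  proj_base : proj base = x₀

attribute [instance] UniversalCover.topology UniversalCover.charts UniversalCover.manifold
  UniversalCover.simplyConnected

namespace UniversalCover

variable {E : Type*} [NormedAddCommGroup E] [NormedSpace ℝ E]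
  {B : Type*} [TopologicalSpace B] [ChartedSpace E B] {x₀ : B} (C : UniversalCover E x₀)

/-- The base point of the covering as a point of the fibre over `x₀`. -/
def basePt : C.proj ⁻¹' {x₀} := ⟨C.base, C.proj_base⟩

instance : LocallyPathConnectedSpace C.Total := ChartedSpace.locallyPathConnectedSpace E C.Total

theorem existsUnique_deck (α : FundamentalGroup B x₀) :
    ∃! D : C(C.Total, C.Total),
      D C.base = (C.isCoveringMap.monodromy α.toPath C.basePt : C.Total) ∧
      C.proj ∘ D = C.proj :=
  C.isCoveringMap.existsUnique_continuousMap_lifts ⟨C.proj, C.isCoveringMap.continuous⟩ C.base _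
    ((C.isCoveringMap.monodromy α.toPath C.basePt).2.trans C.proj_base.symm)

/-- The covering transformation of `[γ] ∈ π₁(B, x₀)`: the unique continuous map over `B` that sends
the base point to the endpoint of the lift of `γ` that starts at the base point. In Mathlib the
product `[γ] * [γ']` is the class of the loop that runs first through `γ'` and then through `γ`, so
this is a right action of `π₁(B, x₀)`. -/
def deck (α : FundamentalGroup B x₀) : C(C.Total, C.Total) := (C.existsUnique_deck α).choose

theorem deck_base (α : FundamentalGroup B x₀) :
    C.deck α C.base = C.isCoveringMap.monodromy α.toPath C.basePt :=
  (C.existsUnique_deck α).choose_spec.1.1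

theorem proj_deck (α : FundamentalGroup B x₀) (x : C.Total) : C.proj (C.deck α x) = C.proj x :=
  congrFun (C.existsUnique_deck α).choose_spec.1.2 x

theorem eq_deck {α : FundamentalGroup B x₀} (D : C(C.Total, C.Total))
    (h : D C.base = C.isCoveringMap.monodromy α.toPath C.basePt) (hD : C.proj ∘ D = C.proj) :
    D = C.deck α :=
  (C.existsUnique_deck α).choose_spec.2 D ⟨h, hD⟩

theorem eq_of_apply_eq {D D' : C(C.Total, C.Total)} (hD : C.proj ∘ D = C.proj)
    (hD' : C.proj ∘ D' = C.proj) (x : C.Total) (h : D x = D' x) : D = D' :=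
  DFunLike.coe_injective <| C.isCoveringMap.eq_of_comp_eq D.continuous D'.continuous
    (hD.trans hD'.symm) x h

theorem deck_monodromy (α β : FundamentalGroup B x₀) (e : C.proj ⁻¹' {x₀}) :
    C.deck α (C.isCoveringMap.monodromy β.toPath e) =
      C.isCoveringMap.monodromy β.toPath ⟨C.deck α e, (C.proj_deck α e).trans e.2⟩ := by
  obtain ⟨γ⟩ := β
  have := (C.isCoveringMap.eq_liftPath_iff' (γ := (γ : C(unitInterval, B))) (e := C.deck α e)
    (γ.source.trans ((C.proj_deck α e).trans e.2).symm)
    (Γ := (C.deck α).comp (C.isCoveringMap.liftPath γ e (γ.source.trans e.2.symm)))).2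
    ⟨by
      ext t
      simpa [proj_deck] using congrFun (C.isCoveringMap.liftPath_lifts γ e.1
        (γ.source.trans e.2.symm)) t, by
      simp [C.isCoveringMap.liftPath_zero]⟩
  exact congrArg (fun c : C(unitInterval, C.Total) => c 1) this

theorem deck_one : C.deck 1 = ContinuousMap.id _ := by
  refine (C.eq_deck _ ?_ rfl).symm
  exact (congrArg Subtype.val (congrFun C.isCoveringMap.monodromy_refl C.basePt)).symm

theorem deck_mul (α β : FundamentalGroup B x₀) :
    C.deck (α * β) = (C.deck β).comp (C.deck α) := by
  refine (C.eq_deck _ ?_ ?_).symm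
  · rw [ContinuousMap.comp_apply, deck_base]
    rw [C.deck_monodromy β α C.basePt]
    have h : (⟨C.deck β C.basePt, (C.proj_deck β C.basePt).trans C.basePt.2⟩ : C.proj ⁻¹' {x₀}) =
        C.isCoveringMap.monodromy β.toPath C.basePt := Subtype.ext (C.deck_base β)
    rw [h]
    exact congrArg Subtype.val (C.isCoveringMap.monodromy_trans_apply β.toPath α.toPath _).symm
  · ext x
    simp [proj_deck]

theorem contMDiff_deck (α : FundamentalGroup B x₀) :
    ContMDiff 𝓘(ℝ, E) 𝓘(ℝ, E) ∞ (C.deck α) := by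
  refine contMDiff_of_localDiffeo_comp C.isLocalDiffeomorph (C.deck α).continuous ?_
  have : C.proj ∘ C.deck α = C.proj := funext (C.proj_deck α)
  rw [this]
  exact C.isLocalDiffeomorph.contMDiff

/-- The action of the fundamental group by covering transformations, as a left action of the
opposite group. -/
@[reducible] def deckAction : MulAction (FundamentalGroup B x₀)ᵐᵒᵖ C.Total where
  smul a x := C.deck a.unop x
  one_smul x := by
    change C.deck 1 x = x
    rw [deck_one]; rfl
  mul_smul a b x := by
    change C.deck (b.unop * a.unop) x = C.deck a.unop (C.deck b.unop x)
    rw [deck_mul]; rfl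

theorem exists_deck_eq {x y : C.Total} (h : C.proj x = C.proj y) : ∃ α, C.deck α x = y := by
  -- a loop at `x₀` whose covering transformation sends `x` to `y`
  obtain ⟨D, ⟨hD1, hD2⟩, -⟩ := C.isCoveringMap.existsUnique_continuousMap_lifts
    ⟨C.proj, C.isCoveringMap.continuous⟩ x y h.symm
  have hDb : C.proj (D C.base) = x₀ := (congrFun hD2 C.base).trans C.proj_base
  let Γ : Path C.base (D C.base) := PathConnectedSpace.somePath _ _
  let γ : Path x₀ x₀ := (Γ.map C.isCoveringMap.continuous).cast C.proj_base.symm hDb.symm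
  let α : FundamentalGroup B x₀ := FundamentalGroup.fromPath (.mk γ)
  refine ⟨α, ?_⟩
  have hmon : (C.isCoveringMap.monodromy α.toPath C.basePt : C.Total) = D C.base := by
    have := (C.isCoveringMap.eq_liftPath_iff' (γ := (γ : C(unitInterval, B))) (e := C.base)
      (γ.source.trans C.proj_base.symm) (Γ := (Γ : C(unitInterval, C.Total)))).2
      ⟨by ext t; simp [γ], by simp⟩
    exact (congrArg (fun c : C(unitInterval, C.Total) => c 1) this).symm.trans Γ.target
  rw [← C.eq_deck D hmon.symm hD2, hD1]

theorem eq_of_monodromy_eq {α β : FundamentalGroup B x₀}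
    (h : C.isCoveringMap.monodromy α.toPath C.basePt =
      C.isCoveringMap.monodromy β.toPath C.basePt) : α = β := by
  obtain ⟨γ⟩ := α
  obtain ⟨γ'⟩ := β
  have h0 := γ.source.trans C.basePt.2.symm
  have h0' := γ'.source.trans C.basePt.2.symm
  let Γ : Path C.base (C.isCoveringMap.liftPath γ C.basePt h0 1) :=
    ⟨C.isCoveringMap.liftPath γ C.basePt h0, C.isCoveringMap.liftPath_zero _ _ h0, rfl⟩
  let Γ' : Path C.base (C.isCoveringMap.liftPath γ C.basePt h0 1) :=
    ⟨C.isCoveringMap.liftPath γ' C.basePt h0', C.isCoveringMap.liftPath_zero _ _ h0',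
      (congrArg Subtype.val h).symm⟩
  have hom := ContinuousMap.HomotopicRel.comp_continuousMap
    (SimplyConnectedSpace.paths_homotopic Γ Γ') ⟨C.proj, C.isCoveringMap.continuous⟩
  refine Quotient.sound (s := Path.Homotopic.setoid x₀ x₀) ?_
  change ContinuousMap.HomotopicRel _ _ _
  convert hom using 1
  · ext t
    exact (congrFun (C.isCoveringMap.liftPath_lifts γ C.basePt.1 h0) t).symm
  · ext t
    exact (congrFun (C.isCoveringMap.liftPath_lifts γ' C.basePt.1 h0') t).symm

theorem proj_surjective [ConnectedSpace B] : Function.Surjective C.proj := by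
  have : LocallyPathConnectedSpace B := ChartedSpace.locallyPathConnectedSpace E B
  have : PathConnectedSpace B := pathConnectedSpace_iff_connectedSpace.2 inferInstance
  intro b
  exact ⟨_, (C.isCoveringMap.monodromy (.mk (PathConnectedSpace.somePath x₀ b)) C.basePt).2⟩

theorem isQuotientCoveringMap [ConnectedSpace B] :
    letI := C.deckAction
    IsQuotientCoveringMap C.proj (FundamentalGroup B x₀)ᵐᵒᵖ := by
  let _ := C.deckAction
  refine (isQuotientCoveringMap_iff_isCoveringMap_and _ _).2
    ⟨C.isCoveringMap, C.proj_surjective, ⟨fun a => (C.deck a.unop).continuous⟩, ⟨?_⟩, ?_⟩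
  · intro a b x hab
    have h1 : C.deck a.unop = C.deck b.unop :=
      C.eq_of_apply_eq (funext (C.proj_deck _)) (funext (C.proj_deck _)) x hab
    have h2 : C.isCoveringMap.monodromy a.unop.toPath C.basePt =
        C.isCoveringMap.monodromy b.unop.toPath C.basePt :=
      Subtype.ext (by rw [← deck_base, ← deck_base, h1])
    exact MulOpposite.unop_injective (C.eq_of_monodromy_eq h2)
  · intro x y
    constructor
    · intro h
      obtain ⟨α, hα⟩ := C.exists_deck_eq h.symm
      exact ⟨.op α, hα⟩
    · rintro ⟨a, rfl⟩
      exact C.proj_deck _ _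

end UniversalCover

end Covering
section Associated

set_option linter.unusedSectionVars false

variable {E F : Type*} [NormedAddCommGroup E] [NormedSpace ℝ E]
  [NormedAddCommGroup F] [NormedSpace ℝ F]
  {B : Type u} [TopologicalSpace B] [ChartedSpace E B]
  {G : Type v} [TopologicalSpace G] [ChartedSpace F G] [Group G]
  {x₀ : B} (C : UniversalCover.{w} E x₀) (ρ : FundamentalGroup B x₀ →* G)

namespace UniversalCover

/-- The equivalence relation on `C.Total × G` for the balanced product with respect to `ρ`, with
classes `(x, g) ∼ (x · α, ρ(α)⁻¹ * g)`. -/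
def assocSetoid : Setoid (C.Total × G) where
  r z w := ∃ α : FundamentalGroup B x₀, w = (C.deck α z.1, (ρ α)⁻¹ * z.2)
  iseqv := by
    refine ⟨fun z => ⟨1, by rw [deck_one, map_one, inv_one, one_mul]; rfl⟩, ?_, ?_⟩
    · rintro z _ ⟨α, rfl⟩
      refine ⟨α⁻¹, ?_⟩
      have : C.deck α⁻¹ (C.deck α z.1) = z.1 := by
        rw [← ContinuousMap.comp_apply, ← deck_mul, mul_inv_cancel, deck_one]; rfl
      simp [this]
    · rintro z _ _ ⟨α, rfl⟩ ⟨β, rfl⟩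
      exact ⟨α * β, by rw [deck_mul, map_mul, mul_inv_rev, mul_assoc]; rfl⟩

/-- The balanced product `C.Total ×_ρ G`, with the quotient topology. -/
def AssocSpace : Type (max w v) := Quotient (C.assocSetoid ρ)

instance : TopologicalSpace (C.AssocSpace ρ) :=
  inferInstanceAs (TopologicalSpace (Quotient (C.assocSetoid ρ)))

/-- The quotient map `C.Total × G → C.Total ×_ρ G`. -/
def quotMap (z : C.Total × G) : C.AssocSpace ρ := Quotient.mk (C.assocSetoid ρ) z

theorem quotMap_surjective : Function.Surjective (C.quotMap ρ) := Quotient.mk_surjective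

theorem quotMap_eq {z w : C.Total × G} :
    C.quotMap ρ z = C.quotMap ρ w ↔
      ∃ α : FundamentalGroup B x₀, w = (C.deck α z.1, (ρ α)⁻¹ * z.2) :=
  Quotient.eq (r := C.assocSetoid ρ)

/-- The self-map of `C.Total × G` defined by an element of the fundamental group. -/
def twist (α : FundamentalGroup B x₀) (z : C.Total × G) : C.Total × G :=
  (C.deck α z.1, (ρ α)⁻¹ * z.2)

theorem contMDiff_twist [LieGroup 𝓘(ℝ, F) ∞ G] (α : FundamentalGroup B x₀) :
    ContMDiff (prodModel E F) (prodModel E F) ∞ (C.twist ρ α) := by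
  refine ((C.contMDiff_deck α).comp contMDiff_fst).prodMk ?_
  exact (contMDiff_mul_left (I := 𝓘(ℝ, F)) (n := ∞) (a := (ρ α)⁻¹)).comp contMDiff_snd

/-- The action on `C.Total × G` whose orbits are the classes of the balanced product. -/
@[reducible] def twistAction : MulAction (FundamentalGroup B x₀)ᵐᵒᵖ (C.Total × G) where
  smul a z := C.twist ρ a.unop z
  one_smul z := by
    change C.twist ρ 1 z = z
    rw [twist, deck_one, map_one, inv_one, one_mul]; rfl
  mul_smul a b z := by
    change C.twist ρ (b.unop * a.unop) z = C.twist ρ a.unop (C.twist ρ b.unop z)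
    rw [twist, deck_mul, map_mul, mul_inv_rev, mul_assoc]; rfl

theorem hasSmoothDeck_quotMap [LieGroup 𝓘(ℝ, F) ∞ G] : HasSmoothDeck (prodModel E F) (C.quotMap ρ) := by
  intro z w h
  obtain ⟨α, rfl⟩ := (C.quotMap_eq ρ).1 h
  exact ⟨C.twist ρ α, C.contMDiff_twist ρ α, rfl, fun y =>
    ((C.quotMap_eq ρ).2 ⟨α, rfl⟩).symm⟩

variable [ConnectedSpace B]

theorem isLocalHomeomorph_quotMap [IsTopologicalGroup G] : IsLocalHomeomorph (C.quotMap ρ) := by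
  let _ := C.deckAction
  have hp := C.isQuotientCoveringMap
  let act := C.twistAction ρ
  have : @IsQuotientCoveringMap _ _ _ _ (C.quotMap ρ) (FundamentalGroup B x₀)ᵐᵒᵖ _ act :=
    { toIsQuotientMap := isQuotientMap_quotient_mk'
      continuous_const_smul := fun a =>
        ((C.deck a.unop).continuous.comp continuous_fst).prodMk
          (continuous_const.mul continuous_snd)
      apply_eq_iff_mem_orbit := by
        intro z w
        constructor
        · intro h
          obtain ⟨α, hα⟩ := (C.quotMap_eq ρ).1 h.symm
          exact ⟨.op α, hα.symm⟩
        · rintro ⟨a, rfl⟩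
          exact ((C.quotMap_eq ρ).2 ⟨a.unop, rfl⟩).symm
      disjoint := by
        intro z
        obtain ⟨U, hU, hdisj⟩ := hp.disjoint z.1
        refine ⟨Prod.fst ⁻¹' U, continuous_fst.continuousAt.preimage_mem_nhds hU, ?_⟩
        rintro a ⟨_, ⟨y, hy, rfl⟩, hy'⟩
        exact hdisj a ⟨_, ⟨y.1, hy, rfl⟩, hy'⟩ }
  exact this.isCoveringMap.isLocalHomeomorph

variable [LieGroup 𝓘(ℝ, F) ∞ G]

/-- The smooth structure of the balanced product: the charts are those of `C.Total × G` precomposed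
with local inverses of the quotient map. -/
instance : ChartedSpace (ModelProd E F) (C.AssocSpace ρ) :=
  have := topologicalGroup_of_lieGroup 𝓘(ℝ, F) ∞ (G := G)
  (C.isLocalHomeomorph_quotMap ρ).chartedSpace (C.quotMap_surjective ρ)

instance : IsManifold (prodModel E F) ∞ (C.AssocSpace ρ) :=
  have := topologicalGroup_of_lieGroup 𝓘(ℝ, F) ∞ (G := G)
  isManifold_of_deck (C.isLocalHomeomorph_quotMap ρ) (C.quotMap_surjective ρ)
    (C.hasSmoothDeck_quotMap ρ)

theorem isLocalDiffeomorph_quotMap :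
    IsLocalDiffeomorph (prodModel E F) (prodModel E F) ∞ (C.quotMap ρ) :=
  have := topologicalGroup_of_lieGroup 𝓘(ℝ, F) ∞ (G := G)
  isLocalDiffeomorph_of_deck (C.isLocalHomeomorph_quotMap ρ) (C.quotMap_surjective ρ)
    (C.hasSmoothDeck_quotMap ρ)

/-- The projection `[x, g] ↦ p(x)` of the balanced product to `B`. -/
def assocProj : C.AssocSpace ρ → B :=
  Quotient.lift (fun z : C.Total × G => C.proj z.1) (by
    rintro z _ ⟨α, rfl⟩
    exact (C.proj_deck α z.1).symm)

/-- The right action `[x, g] · h = [x, g * h]` of `G` on the balanced product. -/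
def assocAct (y : C.AssocSpace ρ) (h : G) : C.AssocSpace ρ :=
  Quotient.lift (fun z : C.Total × G => C.quotMap ρ (z.1, z.2 * h)) (by
    rintro z _ ⟨α, rfl⟩
    exact (C.quotMap_eq ρ).2 ⟨α, by simp [mul_assoc]⟩) y

theorem contMDiff_assocProj : ContMDiff (prodModel E F) 𝓘(ℝ, E) ∞ (C.assocProj ρ) :=
  contMDiff_of_comp_localDiffeo (C.isLocalDiffeomorph_quotMap (F := F) ρ) (C.quotMap_surjective ρ)
    (C.isLocalDiffeomorph.contMDiff.comp contMDiff_fst)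

theorem contMDiff_assocAct : ContMDiff ((prodModel E F).prod 𝓘(ℝ, F)) (prodModel E F) ∞
    (fun z : C.AssocSpace ρ × G => C.assocAct ρ z.1 z.2) := by
  rintro ⟨y, h⟩
  obtain ⟨z, rfl⟩ := C.quotMap_surjective ρ y
  have hq := C.isLocalDiffeomorph_quotMap (F := F) ρ z
  have h1 : ContMDiffAt ((prodModel E F).prod 𝓘(ℝ, F)) (prodModel E F) ∞
      (fun a : C.AssocSpace ρ × G => hq.localInverse a.1) (C.quotMap ρ z, h) :=
    ContMDiffAt.comp (C.quotMap ρ z, h) hq.localInverse_contMDiffAt contMDiffAt_fst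
  have h2 : ContMDiffAt ((prodModel E F).prod 𝓘(ℝ, F)) (prodModel E F) ∞
      (fun a : C.AssocSpace ρ × G =>
        ((hq.localInverse a.1).1, (hq.localInverse a.1).2 * a.2)) (C.quotMap ρ z, h) :=
    (contMDiffAt_fst.comp _ h1).prodMk ((contMDiffAt_snd.comp _ h1).mul contMDiffAt_snd)
  have h3 := (C.isLocalDiffeomorph_quotMap (F := F) ρ).contMDiff.contMDiffAt.comp
    (C.quotMap ρ z, h) h2
  refine h3.congr_of_eventuallyEq ?_
  filter_upwards [continuous_fst.continuousAt.eventually hq.localInverse_eventuallyEq_right]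
    with a ha
  simp only [Function.comp_apply, id] at ha
  conv_lhs => rw [← ha]
  rfl

theorem assoc_locallyTrivial (b : B) :
    ∃ (U : Set B) (φ : OpenPartialHomeomorph (C.AssocSpace ρ) (B × G)),
    IsOpen U ∧ b ∈ U ∧ φ.source = C.assocProj ρ ⁻¹' U ∧ φ.target = U ×ˢ univ ∧
    ContMDiffOn (prodModel E F) (prodModel E F) ∞ φ φ.source ∧
    ContMDiffOn (prodModel E F) (prodModel E F) ∞ φ.symm φ.target ∧
    ∀ p ∈ φ.source, (φ p).1 = C.assocProj ρ p ∧
      ∀ g, φ (C.assocAct ρ p g) = ((φ p).1, (φ p).2 * g) := by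
  obtain ⟨x, rfl⟩ := C.proj_surjective b
  set σ := (C.isLocalDiffeomorph x).localInverse with hσ
  have hpσ : ∀ u ∈ σ.source, C.proj (σ u) = u := fun u hu =>
    (C.isLocalDiffeomorph x).localInverse_right_inv hu
  have hσp : ∀ y ∈ σ.target, σ (C.proj y) = y := fun y hy =>
    (C.isLocalDiffeomorph x).localInverse_left_inv hy
  have hpt : ∀ y ∈ σ.target, C.proj y ∈ σ.source := by
    intro y hy
    have h1 : σ.toPartialEquiv (σ.toPartialEquiv.symm y) = y := σ.right_inv hy
    have h2 : σ.toPartialEquiv.symm y ∈ σ.source := σ.map_target hy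
    have h3 : C.proj y = σ.toPartialEquiv.symm y := by
      conv_lhs => rw [← h1]
      exact hpσ _ h2
    rw [h3]; exact h2
  have hU : IsOpen σ.source := σ.open_source
  -- the inverse of the trivialization
  let Ψ : B × G → C.AssocSpace ρ := fun a => C.quotMap ρ (σ a.1, a.2)
  have hproj : ∀ a, a.1 ∈ σ.source → C.assocProj ρ (Ψ a) = a.1 := fun a ha => hpσ _ ha
  have hact : ∀ a g, C.assocAct ρ (Ψ a) g = Ψ (a.1, a.2 * g) := fun a g => rfl
  have hinj : ∀ a a', a.1 ∈ σ.source → a'.1 ∈ σ.source → Ψ a = Ψ a' → a = a' := by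
    intro a a' ha ha' h
    have h1 : a.1 = a'.1 := by rw [← hproj a ha, ← hproj a' ha', h]
    obtain ⟨α, hα⟩ := (C.quotMap_eq ρ).1 h
    have hα1 : σ a'.1 = C.deck α (σ a.1) := congrArg Prod.fst hα
    have hα2 : a'.2 = (ρ α)⁻¹ * a.2 := congrArg Prod.snd hα
    have hD : C.deck α = C.deck 1 := by
      refine C.eq_of_apply_eq (funext (C.proj_deck _)) (funext (C.proj_deck _)) (σ a.1) ?_
      rw [← hα1, ← h1, deck_one]; rfl
    have : α = 1 := C.eq_of_monodromy_eq (Subtype.ext (by rw [← deck_base, ← deck_base, hD]))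
    rw [this, map_one, inv_one, one_mul] at hα2
    exact Prod.ext h1 hα2.symm
  have hsurj : ∀ y, C.assocProj ρ y ∈ σ.source → ∃ g, Ψ (C.assocProj ρ y, g) = y := by
    intro y hy
    obtain ⟨z, rfl⟩ := C.quotMap_surjective ρ y
    have hz : C.assocProj ρ (C.quotMap ρ z) = C.proj z.1 := rfl
    rw [hz] at hy ⊢
    obtain ⟨α, hα⟩ := C.exists_deck_eq (x := z.1) (y := σ (C.proj z.1)) (hpσ _ hy).symm
    exact ⟨(ρ α)⁻¹ * z.2, ((C.quotMap_eq ρ).2 ⟨α, by rw [hα]⟩).symm⟩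
  choose! s hs using hsurj
  have hΨsm : ContMDiffOn (prodModel E F) (prodModel E F) ∞ Ψ (σ.source ×ˢ univ) := by
    refine (C.isLocalDiffeomorph_quotMap (F := F) ρ).contMDiff.comp_contMDiffOn ?_
    exact ContMDiffOn.prodMk (σ.contMDiffOn.comp contMDiffOn_fst fun a ha => ha.1) contMDiffOn_snd
  have hφsm : ContMDiffOn (prodModel E F) (prodModel E F) ∞
      (fun y => (C.assocProj ρ y, s y)) (C.assocProj ρ ⁻¹' σ.source) := by
    intro y hy
    apply ContMDiffAt.contMDiffWithinAt
    set z : C.Total × G := (σ (C.assocProj ρ y), s y) with hz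
    have hzy : C.quotMap ρ z = y := hs y hy
    have hq := C.isLocalDiffeomorph_quotMap (F := F) ρ z
    have h1 : ContMDiffAt (prodModel E F) (prodModel E F) ∞ hq.localInverse y := by
      rw [← hzy]; exact hq.localInverse_contMDiffAt
    have h1z : hq.localInverse y = z := by
      rw [← hzy]; exact hq.localInverse_left_inv hq.localInverse_mem_target
    have h2 : ContMDiffAt (prodModel E F) (prodModel E F) ∞
        (fun w => (C.proj (hq.localInverse w).1, (hq.localInverse w).2)) y :=
      (C.isLocalDiffeomorph.contMDiff.contMDiffAt.comp _ (contMDiffAt_fst.comp _ h1)).prodMk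
        (contMDiffAt_snd.comp _ h1)
    refine h2.congr_of_eventuallyEq ?_
    have hev : hq.localInverse.source ∈ nhds y := by
      rw [← hzy]
      exact hq.localInverse.open_source.mem_nhds hq.localInverse_mem_source
    have hnear : ∀ᶠ w in nhds y, (hq.localInverse w).1 ∈ σ.target := by
      refine (continuous_fst.continuousAt.comp h1.continuousAt).eventually_mem
        (σ.open_target.mem_nhds ?_)
      rw [Function.comp_apply, h1z]
      exact σ.map_source hy
    filter_upwards [hev, hnear] with w hw hw'
    have h3 : C.quotMap ρ (hq.localInverse w) = w := hq.localInverse_right_inv hw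
    have h4 : C.assocProj ρ w = C.proj (hq.localInverse w).1 := by
      conv_lhs => rw [← h3]
      rfl
    have h5 : C.assocProj ρ w ∈ σ.source := by rw [h4]; exact hpt _ hw'
    refine hinj _ _ h5 (hpt _ hw') ?_
    rw [hs w h5]
    change w = C.quotMap ρ (σ (C.proj (hq.localInverse w).1), (hq.localInverse w).2)
    rw [hσp _ hw', Prod.mk.eta, h3]
  let φ : OpenPartialHomeomorph (C.AssocSpace ρ) (B × G) :=
    { toFun := fun y => (C.assocProj ρ y, s y)
      invFun := Ψ
      source := C.assocProj ρ ⁻¹' σ.source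
      target := σ.source ×ˢ univ
      map_source' := fun y hy => ⟨hy, trivial⟩
      map_target' := fun a ha => by
        change C.assocProj ρ (Ψ a) ∈ σ.source
        rw [hproj a ha.1]; exact ha.1
      left_inv' := fun y hy => hs y hy
      right_inv' := fun a ha => by
        have h1 : C.assocProj ρ (Ψ a) ∈ σ.source := by rw [hproj a ha.1]; exact ha.1
        exact hinj _ _ h1 ha.1 (hs _ h1)
      open_source := (C.contMDiff_assocProj (F := F) ρ).continuous.isOpen_preimage _ hU
      open_target := hU.prod isOpen_univ
      continuousOn_toFun := hφsm.continuousOn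
      continuousOn_invFun := hΨsm.continuousOn }
  refine ⟨σ.source, φ, hU, (C.isLocalDiffeomorph x).localInverse_mem_source, rfl, rfl,
    hφsm, hΨsm, ?_⟩
  · intro y hy
    refine ⟨rfl, fun g => ?_⟩
    have hy' : C.assocProj ρ y ∈ σ.source := hy
    have h1 : C.assocAct ρ y g = Ψ (C.assocProj ρ y, s y * g) := by
      conv_lhs => rw [← hs y hy']
      rfl
    have h2 : C.assocProj ρ (C.assocAct ρ y g) = C.assocProj ρ y := by
      rw [h1]; exact hproj _ hy'
    have h3 : C.assocProj ρ (C.assocAct ρ y g) ∈ σ.source := by rw [h2]; exact hy'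
    refine hinj _ _ h3 hy' ?_
    exact (hs _ h3).trans h1

/-- The principal `G`-bundle `C.Total ×_ρ G` over `B`. -/
def assocBundle : PrincipalBundle.{max w v} E F B G where
  Total := C.AssocSpace ρ
  proj := C.assocProj ρ
  act := C.assocAct ρ
  act_one y := by
    obtain ⟨z, rfl⟩ := C.quotMap_surjective ρ y
    change C.quotMap ρ (z.1, z.2 * 1) = _
    rw [mul_one]
  act_mul y g h := by
    obtain ⟨z, rfl⟩ := C.quotMap_surjective ρ y
    change C.quotMap ρ (z.1, z.2 * (g * h)) = C.quotMap ρ (z.1, z.2 * g * h)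
    rw [mul_assoc]
  proj_act y g := by
    obtain ⟨z, rfl⟩ := C.quotMap_surjective ρ y
    rfl
  contMDiff_proj := C.contMDiff_assocProj ρ
  contMDiff_act := C.contMDiff_assocAct ρ
  locallyTrivial := C.assoc_locallyTrivial ρ

variable (F G) in
/-- The connection form of the trivial connection on the product bundle `C.Total × G`: the
left-invariant Maurer-Cartan form of `G` pulled back along the projection to `G`. -/
def trivialForm (z : C.Total × G) (v : TangentSpace (prodModel E F) z) :
    GroupLieAlgebra 𝓘(ℝ, F) G :=
  mfderiv 𝓘(ℝ, F) 𝓘(ℝ, F) (fun g : G => z.2⁻¹ * g) z.2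
    (mfderiv (prodModel E F) 𝓘(ℝ, F) Prod.snd z v)

/-- The bundle isomorphism `Φ : C.Total ×_ρ G → P` satisfies `q^* Φ^* A = Θ`, where `q` is the
quotient map of the balanced product and `Θ` is the trivial connection on `C.Total × G`. -/
def PullsBackToTrivial {P : PrincipalBundle E F B G} (A : Connection P)
    (Φ : BundleIso (C.assocBundle ρ) P) : Prop :=
  ∀ (z : C.Total × G) (v : TangentSpace (prodModel E F) z),
    A.form (Φ.toDiffeo (C.quotMap ρ z)) (mfderiv (prodModel E F) (prodModel E F)
      (fun z' : C.Total × G => Φ.toDiffeo (C.quotMap ρ z')) z v) = C.trivialForm F G z v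

end UniversalCover

end Associated
section Moduli

variable {E F : Type*} [NormedAddCommGroup E] [NormedSpace ℝ E]
  [NormedAddCommGroup F] [NormedSpace ℝ F]
  {B : Type*} [TopologicalSpace B] [ChartedSpace E B]
  {G : Type*} [TopologicalSpace G] [ChartedSpace F G] [Group G]

namespace BundleIso

/-- The identity isomorphism. -/
def refl (P : PrincipalBundle E F B G) : BundleIso P P where
  toDiffeo := Diffeomorph.refl _ _ _
  proj_apply _ := rfl
  map_act _ _ := rfl

/-- The inverse isomorphism. -/
def symm {P Q : PrincipalBundle E F B G} (f : BundleIso P Q) : BundleIso Q P where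
  toDiffeo := f.toDiffeo.symm
  proj_apply q := by
    rw [← f.proj_apply, f.toDiffeo.apply_symm_apply]
  map_act q g := by
    apply f.toDiffeo.injective
    change f.toDiffeo _ = f.toDiffeo _
    rw [f.map_act, f.toDiffeo.apply_symm_apply, f.toDiffeo.apply_symm_apply]

/-- The composition of isomorphisms. -/
def trans {P Q R : PrincipalBundle E F B G} (f : BundleIso P Q) (g : BundleIso Q R) :
    BundleIso P R where
  toDiffeo := f.toDiffeo.trans g.toDiffeo
  proj_apply p := (g.proj_apply _).trans (f.proj_apply p)
  map_act p h := by
    change g.toDiffeo (f.toDiffeo (P.act p h)) = R.act (g.toDiffeo (f.toDiffeo p)) h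
    rw [f.map_act, g.map_act]

end BundleIso

/-- Isomorphism of principal bundles as an equivalence relation. -/
def isoSetoid (E F : Type*) [NormedAddCommGroup E] [NormedSpace ℝ E]
    [NormedAddCommGroup F] [NormedSpace ℝ F]
    (B : Type*) [TopologicalSpace B] [ChartedSpace E B]
    (G : Type*) [TopologicalSpace G] [ChartedSpace F G] [Group G] :
    Setoid (PrincipalBundle.{w} E F B G) where
  r P Q := Nonempty (BundleIso P Q)
  iseqv := ⟨fun P => ⟨.refl P⟩, fun ⟨f⟩ => ⟨f.symm⟩, fun ⟨f⟩ ⟨g⟩ => ⟨f.trans g⟩⟩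

/-- The set of flat connections on a principal bundle. -/
def FlatConnection (P : PrincipalBundle E F B G) := {A : Connection P // A.IsFlat}

/-- Gauge equivalence: `A ∼ f^* A` for gauge transformations `f`, that is, for automorphisms `f`
of `P` that cover the identity of `B`. -/
def gaugeSetoid (P : PrincipalBundle E F B G) : Setoid (FlatConnection P) where
  r A A' := ∃ f : BundleIso P P, ∀ (p : P.Total) (v : TangentSpace (prodModel E F) p),
    A'.1.form p v =
      A.1.form (f.toDiffeo p) (mfderiv (prodModel E F) (prodModel E F) f.toDiffeo p v)
  iseqv := by
    refine ⟨fun A => ⟨.refl P, fun p v => ?_⟩, ?_, ?_⟩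
    · have : mfderiv (prodModel E F) (prodModel E F) (BundleIso.refl P).toDiffeo p =
        ContinuousLinearMap.id ℝ _ := mfderiv_id
      rw [this]; rfl
    · rintro A A' ⟨f, hf⟩
      refine ⟨f.symm, fun p v => ?_⟩
      have hc := mfderiv_comp (I := prodModel E F) (I' := prodModel E F) (I'' := prodModel E F)
        (g := f.toDiffeo) (f := f.symm.toDiffeo) p
        ((f.toDiffeo.mdifferentiable (by simp)) _)
        ((f.symm.toDiffeo.mdifferentiable (by simp)) p)
      have key : ∀ h : P.Total → P.Total, h = id →
          A.1.form p v = A.1.form (h p) (mfderiv (prodModel E F) (prodModel E F) h p v) := by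
        rintro _ rfl
        rw [mfderiv_id]; rfl
      rw [hf, key _ (funext fun q => f.toDiffeo.apply_symm_apply q :
        f.toDiffeo ∘ f.symm.toDiffeo = id), hc]
      rfl
    · rintro A A' A'' ⟨f, hf⟩ ⟨g, hg⟩
      refine ⟨g.trans f, fun p v => ?_⟩
      have hc : mfderiv (prodModel E F) (prodModel E F) (g.trans f).toDiffeo p = _ :=
        mfderiv_comp (I := prodModel E F) (I' := prodModel E F) (I'' := prodModel E F)
        (g := f.toDiffeo) (f := g.toDiffeo) p
        ((f.toDiffeo.mdifferentiable (by simp)) (g.toDiffeo p))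
        ((g.toDiffeo.mdifferentiable (by simp)) p)
      rw [hg, hf, hc]
      rfl

/-- The moduli space `A_flat(P) / G(P)` of flat connections modulo gauge transformations. -/
def FlatModuli (P : PrincipalBundle E F B G) := Quotient (gaugeSetoid P)

/-- The representations `ρ` and `ρ'` are conjugate. -/
def IsConjRep {Γ G : Type*} [Group Γ] [Group G] (ρ ρ' : Γ →* G) : Prop :=
  ∃ h : G, ∀ α, ρ' α = h⁻¹ * ρ α * h

/-- Conjugation of representations as an equivalence relation. -/
def conjSetoid (Γ G : Type*) [Group Γ] [Group G] : Setoid (Γ →* G) where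
  r := IsConjRep
  iseqv := by
    refine ⟨fun ρ => ⟨1, by simp⟩, ?_, ?_⟩
    · rintro ρ ρ' ⟨h, hh⟩
      exact ⟨h⁻¹, fun α => by rw [hh]; group⟩
    · rintro ρ ρ' ρ'' ⟨h, hh⟩ ⟨k, hk⟩
      exact ⟨h * k, fun α => by rw [hk, hh]; group⟩

/-- The set `Hom(Γ, G) / conjugation`. -/
def RepClass (Γ G : Type*) [Group Γ] [Group G] := Quotient (conjSetoid Γ G)

end Moduli
end FlatBundle

end

open FlatBundle

/-! A flat connection is an integrable horizontal distribution. When the curvature vanishes, dω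
vanishes on pairs of horizontal vectors, so the Frobenius theorem (`exists_integral_graph`) gives a
horizontal section through every point (`exists_horizontalSection`). Relative to such a section, ω
is the Maurer–Cartan form of the fibre coordinate (`HorizontalSection.form_eq`). Hence horizontal
maps have locally constant coordinate, and two horizontal sections differ by a locally constant
element of G. So P, retopologized by declaring the translates of horizontal sections open, is a
covering space of B (`leafAtlas`, `SheetAtlas.isCoveringMap`), and parallel transport is path
lifting in it.

The universal covering map lifts to this covering space. The lift D : B̃ → P is horizontal, and
uniqueness of lifts gives D(x·α) = D(x)·ρ(α) for a homomorphism ρ (`exists_developingMap`), which is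
the holonomy at the image of the base point. The map (x, g) ↦ D(x)·g descends to an isomorphism B̃
×_ρ G → P that pulls ω back to Θ; conversely, restricting such an isomorphism to g = 1 returns a
developing map. Thus the holonomy determines (P, A) up to isomorphism. Moving the point in the fibre
conjugates ρ. This gives (a), (b), uniqueness up to conjugation, and injectivity in (c).

For surjectivity, Θ is invariant under the action of π₁ on B̃ × G, since the Maurer–Cartan form is
left invariant, so it descends to B̃ ×_ρ G (`exists_flat_pullsBackToTrivial`). It is flat by the
Maurer–Cartan equation (`extd_pullForm_mcForm`), and its holonomy is ρ.

Two facts about manifolds support this: a universal covering exists (`UniversalCover.nonempty`),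
built from path classes by the same sheet construction as the leaves, and every class in π₁ contains
a smooth loop (`exists_smooth_loop`), so that transport along smooth loops determines ρ. -/

/-! ### Total differential equations Dy = Φ(x, y) -/

section TotalDifferentialEquation

open Metric Filter
open scoped Topology NNReal

/-- The Picard-Lindelöf theorem, together with the fact that the solution stays in the ball. -/
theorem IsPicardLindelof.exists_mem_closedBall_hasDerivWithinAt
    {E : Type*} [NormedAddCommGroup E] [NormedSpace ℝ E] [CompleteSpace E]
    {f : ℝ → E → E} {tmin tmax : ℝ} {t₀ : Icc tmin tmax} {x₀ : E} {a L K : ℝ≥0}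
    (hf : IsPicardLindelof f t₀ x₀ a 0 L K) :
    ∃ α : ℝ → E, α t₀ = x₀ ∧ (∀ t, α t ∈ closedBall x₀ a) ∧
      ∀ t ∈ Icc tmin tmax, HasDerivWithinAt α (f t (α t)) (Icc tmin tmax) t := by
  have hx : x₀ ∈ closedBall x₀ ((0 : ℝ≥0) : ℝ) := mem_closedBall_self le_rfl
  obtain ⟨α, hα⟩ := ODE.FunSpace.exists_isFixedPt_next hf hx
  refine ⟨α.compProj, by rw [ODE.FunSpace.compProj_val, ← hα, ODE.FunSpace.next_apply₀],
    fun t => α.compProj_mem_closedBall hf.mul_max_le, fun t ht ↦ ?_⟩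
  apply ODE.hasDerivWithinAt_picard_Icc t₀.2 hf.continuousOn_uncurry
    α.continuous_compProj.continuousOn (fun _ ht' ↦ α.compProj_mem_closedBall hf.mul_max_le)
    x₀ ht |>.congr_of_mem _ ht
  intro t' ht'
  nth_rw 1 [← hα]
  rw [ODE.FunSpace.compProj_of_mem ht', ODE.FunSpace.next_apply]

/-- On the part of `s` within distance ‖y - x‖ of `x`, the derivative differs from its value at `x`
by at most K‖y - x‖; the mean value inequality then gives the quadratic remainder. The sharp factor
1/2 is not needed. -/
theorem norm_image_sub_sub_fderiv_le_of_lipschitzOnWith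
    {E F : Type*} [NormedAddCommGroup E] [NormedSpace ℝ E]
    [NormedAddCommGroup F] [NormedSpace ℝ F] {f : E → F} {s : Set E} {K : ℝ≥0}
    (hf : ∀ x ∈ s, DifferentiableAt ℝ f x) (hs : Convex ℝ s)
    (hK : LipschitzOnWith K (fderiv ℝ f) s) {x y : E} (hx : x ∈ s) (hy : y ∈ s) :
    ‖f y - f x - fderiv ℝ f x (y - x)‖ ≤ K * ‖y - x‖ ^ 2 := by
  have hs' : Convex ℝ (s ∩ closedBall x ‖y - x‖) := hs.inter (convex_closedBall _ _)
  have := hs'.norm_image_sub_le_of_norm_fderiv_le' (f := f) (𝕜 := ℝ) (φ := fderiv ℝ f x)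
    (C := K * ‖y - x‖) (x := x) (y := y) (fun z hz => hf z hz.1) ?_ ⟨hx, by simp⟩
    ⟨hy, by simp [dist_eq_norm]⟩
  · rwa [mul_assoc, ← sq] at this
  · intro z hz
    refine (hK.norm_sub_le hz.1 hx).trans ?_
    gcongr
    simpa [dist_eq_norm] using hz.2

theorem ContinuousAt.eventually_norm_lt_add_one {X V : Type*} [TopologicalSpace X]
    [NormedAddCommGroup V] {f : X → V} {x : X} (hf : ContinuousAt f x) :
    ∀ᶠ z in 𝓝 x, ‖f z‖ < ‖f x‖ + 1 :=
  hf.norm.eventually_lt_const (lt_add_one _)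

variable {E F : Type*} [NormedAddCommGroup E] [NormedSpace ℝ E]
  [NormedAddCommGroup F] [NormedSpace ℝ F]

/-- The Frobenius theorem for total differential equations: the equation `Dy(x) = Φ(x, y(x))` has
local solutions if its integrability condition holds. -/
theorem exists_hasFDerivAt_of_integrable [CompleteSpace F] {Φ : E × F → E →L[ℝ] F}
    {Ω : Set (E × F)} (hΩ : IsOpen Ω) (hΦ : ContDiffOn ℝ 2 Φ Ω)
    (hint : ∀ z ∈ Ω, ∀ h k, fderiv ℝ Φ z (k, Φ z k) h = fderiv ℝ Φ z (h, Φ z h) k)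
    {z₀ : E × F} (hz₀ : z₀ ∈ Ω) :
    ∃ δ > 0, ∃ y : E → F, y z₀.1 = z₀.2 ∧
      ∀ x ∈ ball z₀.1 δ, (x, y x) ∈ Ω ∧ HasFDerivAt y (Φ (x, y x)) x := by
  obtain ⟨x₀, y₀⟩ := z₀
  have hΦat : ContDiffAt ℝ 2 Φ (x₀, y₀) := hΦ.contDiffAt (hΩ.mem_nhds hz₀)
  have hDΦ : ContDiffAt ℝ 1 (fderiv ℝ Φ) (x₀, y₀) := hΦat.fderiv_right (by norm_num)
  obtain ⟨K₁, t₁, ht₁, hK₁⟩ := (hΦat.of_le (by norm_num : (1 : WithTop ℕ∞) ≤ 2)).exists_lipschitzOnWith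
  obtain ⟨K₂, t₂, ht₂, hK₂⟩ := hDΦ.exists_lipschitzOnWith
  set M : ℝ := ‖Φ (x₀, y₀)‖ + 1 with hM
  set N : ℝ := ‖fderiv ℝ Φ (x₀, y₀)‖ + 1 with hN
  have hM0 : 0 < M := by positivity
  have hN0 : 0 < N := by positivity
  have h1 : ∀ᶠ z in 𝓝 (x₀, y₀), ‖Φ z‖ < M :=
    hΦat.continuousAt.eventually_norm_lt_add_one
  have h2 : ∀ᶠ z in 𝓝 (x₀, y₀), ‖fderiv ℝ Φ z‖ < N :=
    ContinuousAt.eventually_norm_lt_add_one (V := E × F →L[ℝ] E →L[ℝ] F) hDΦ.continuousAt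
  obtain ⟨R, hR, hRsub⟩ := Metric.nhds_basis_closedBall.mem_iff.1
    (inter_mem (inter_mem (hΩ.mem_nhds hz₀) (inter_mem ht₁ ht₂)) (inter_mem h1 h2))
  set D := closedBall (x₀, y₀) R with hD
  have hDΩ : D ⊆ Ω := fun z hz => (hRsub hz).1.1
  have hL1 : LipschitzOnWith K₁ Φ D := hK₁.mono fun z hz => (hRsub hz).1.2.1
  have hL2 : LipschitzOnWith K₂ (fderiv ℝ Φ) D := hK₂.mono fun z hz => (hRsub hz).1.2.2
  have hMD : ∀ z ∈ D, ‖Φ z‖ ≤ M := fun z hz => (hRsub hz).2.1.le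
  have hND : ∀ z ∈ D, ‖fderiv ℝ Φ z‖ ≤ N := fun z hz => (hRsub hz).2.2.le
  have hdiff : ∀ z ∈ D, DifferentiableAt ℝ Φ z := fun z hz =>
    (hΦ.contDiffAt (hΩ.mem_nhds (hDΩ hz))).differentiableAt (by norm_num)
  have hmemD : ∀ x y, ‖x - x₀‖ ≤ R → ‖y - y₀‖ ≤ R → (x, y) ∈ D := by
    intro x y hx hy
    rw [hD, mem_closedBall, Prod.dist_eq, dist_eq_norm, dist_eq_norm]
    exact max_le hx hy
  -- With M‖η‖ < R/2 the solution along the ray of η moves at most R/2. The other half of R is kept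
  -- for the correction t • Φ(p t) h in the comparison curve `z` below.
  set δ : ℝ := min (R / 2) (R / 2 / M) with hδ
  have hδ0 : 0 < δ := by positivity
  have hδR : δ ≤ R / 2 := min_le_left _ _
  have hδM : M * δ ≤ R / 2 := by
    have : δ ≤ R / 2 / M := min_le_right _ _
    rw [le_div_iff₀ hM0] at this
    linarith
  have hseg : ∀ t ∈ Icc (0 : ℝ) 1, ∀ η : E, ‖t • η‖ ≤ ‖η‖ := by
    intro t ht η
    rw [norm_smul, Real.norm_of_nonneg ht.1]
    exact mul_le_of_le_one_left (norm_nonneg _) ht.2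
  -- solutions of the equation along rays
  have hlip : ∀ η : E, ‖η‖ < δ → ∀ t ∈ Icc (0 : ℝ) 1, LipschitzOnWith (K₁ * ‖η‖₊)
      (fun y => Φ (x₀ + t • η, y) η) (closedBall y₀ R) := by
    intro η hη t ht
    apply LipschitzOnWith.of_dist_le_mul
    intro y hy y' hy'
    have hx : ‖x₀ + t • η - x₀‖ ≤ R := by
      rw [add_sub_cancel_left]
      have := hseg t ht η
      linarith
    have hm := hmemD _ _ hx (mem_closedBall_iff_norm.1 hy)
    have hm' := hmemD _ _ hx (mem_closedBall_iff_norm.1 hy')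
    rw [dist_eq_norm, ← sub_apply]
    refine (ContinuousLinearMap.le_opNorm _ _).trans ?_
    have := hL1.norm_sub_le hm hm'
    rw [Prod.mk_sub_mk, sub_self, Prod.norm_mk, norm_zero, max_eq_right (norm_nonneg _)] at this
    rw [dist_eq_norm]
    push_cast
    calc _ ≤ (K₁ * ‖y - y'‖) * ‖η‖ := by gcongr
      _ = _ := by ring
  -- Restricted to a ray x₀ + tη, the equation is an ordinary one. The candidate solution is y(x) =
  -- α_η(1) with η = x - x₀; that its derivative is Φ in every direction, not only radially, is
  -- where integrability is needed.
  have hsol : ∀ η : E, ‖η‖ < δ → ∃ α : ℝ → F, α 0 = y₀ ∧ (∀ t, ‖α t - y₀‖ ≤ R / 2) ∧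
      ∀ t ∈ Icc (0 : ℝ) 1, HasDerivWithinAt α (Φ (x₀ + t • η, α t) η) (Icc 0 1) t := by
    intro η hη
    have hpl : IsPicardLindelof (fun t y => Φ (x₀ + t • η, y) η)
        (⟨0, by simp⟩ : Icc (0 : ℝ) 1) y₀ ⟨R / 2, by positivity⟩ 0 ⟨R / 2, by positivity⟩
        (K₁ * ‖η‖₊) := by
      refine ⟨fun t ht => (hlip η hη t ht).mono (closedBall_subset_closedBall ?_), ?_, ?_, ?_⟩
      · change R / 2 ≤ R
        linarith
      · intro y hy
        have hy : ‖y - y₀‖ ≤ R := (mem_closedBall_iff_norm.1 hy).trans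
          (show R / 2 ≤ R by linarith)
        have : ContinuousOn (fun t : ℝ => Φ (x₀ + t • η, y)) (Icc 0 1) := by
          refine hL1.continuousOn.comp (Continuous.continuousOn (by fun_prop)) ?_
          intro t ht
          refine hmemD _ _ ?_ hy
          rw [add_sub_cancel_left]
          have := hseg t ht η
          linarith
        exact this.clm_apply continuousOn_const
      · intro t ht y hy
        have hy : ‖y - y₀‖ ≤ R := (mem_closedBall_iff_norm.1 hy).trans
          (show R / 2 ≤ R by linarith)
        have hm : (x₀ + t • η, y) ∈ D := by
          refine hmemD _ _ ?_ hy
          rw [add_sub_cancel_left]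
          have := hseg t ht η
          linarith
        refine (ContinuousLinearMap.le_opNorm _ _).trans ?_
        change _ ≤ R / 2
        calc _ ≤ M * δ := mul_le_mul (hMD _ hm) hη.le (norm_nonneg _) hM0.le
          _ ≤ _ := hδM
      · change R / 2 * _ ≤ R / 2 - 0
        simp
    obtain ⟨α, h0, hmem, hα⟩ := hpl.exists_mem_closedBall_hasDerivWithinAt
    exact ⟨α, h0, fun t => mem_closedBall_iff_norm.1 (hmem t), hα⟩
  choose! α hα0 hαR hα using hsol
  refine ⟨δ, hδ0, fun x => α (x - x₀) 1, ?_, ?_⟩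
  -- For η = 0 the ray is a point and its equation reads α' = 0.
  · have h0 : ‖(0 : E)‖ < δ := by simpa using hδ0
    have := constant_of_has_deriv_right_zero (f := α 0) (a := 0) (b := 1)
      (fun t ht => (hα 0 h0 t ht).continuousWithinAt) (fun t ht => by
        have := hα 0 h0 t (Ico_subset_Icc_self ht)
        rw [map_zero] at this
        exact this.mono_of_mem_nhdsWithin (Icc_mem_nhdsGE_of_mem ht)) 1 (by simp)
    simp only [sub_self]
    rw [this, hα0 0 h0]
  intro x hx
  rw [mem_ball_iff_norm] at hx
  set η := x - x₀ with hη
  have hxη : x = x₀ + (1 : ℝ) • η := by simp [hη]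
  have hmemα : ∀ t ∈ Icc (0 : ℝ) 1, (x₀ + t • η, α η t) ∈ D := by
    intro t ht
    refine hmemD _ _ ?_ ((hαR η hx t).trans (by linarith))
    rw [add_sub_cancel_left]
    have := hseg t ht η
    linarith
  have hend : (x, α η 1) ∈ D := by
    have := hmemα 1 (by simp)
    rwa [← hxη] at this
  refine ⟨hDΩ hend, ?_⟩
  -- The first term of C bounds the second-order term DΦ(h, Φh)h, the second the Taylor remainder of
  -- Φ applied to η + h. The summand 1 in κ keeps the Grönwall exponent nonzero.
  set C : ℝ := N * (1 + M) + K₂ * (1 + M) ^ 2 * δ with hC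
  set κ : ℝ := K₁ * δ + 1 with hκ
  have hκ0 : 0 < κ := by positivity
  -- The curve z(t) = α_η(t) + t Φ(p t) h solves the equation of the ray of η + h up to an error
  -- C‖h‖². Grönwall compares it with α_{η+h}, and at t = 1 it equals y(x) + Φ(x, y(x)) h, the
  -- wanted linear approximation.
  have key : ∀ h : E, ‖h‖ < δ - ‖η‖ →
      ‖α (η + h) 1 - α η 1 - Φ (x, α η 1) h‖ ≤ (C / κ * (Real.exp κ - 1)) * ‖h‖ ^ 2 := by
    intro h hh
    have hηh : ‖η + h‖ < δ := (norm_add_le _ _).trans_lt (by linarith)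
    have hhδ : ‖h‖ ≤ δ := by linarith [norm_nonneg η]
    set p : ℝ → E × F := fun t => (x₀ + t • η, α η t) with hp
    set z : ℝ → F := fun t => α η t + t • Φ (p t) h with hz
    have hp' : ∀ t ∈ Icc (0 : ℝ) 1, HasDerivWithinAt p (η, Φ (p t) η) (Icc 0 1) t := by
      intro t ht
      refine HasDerivWithinAt.prodMk ?_ (hα η hx t ht)
      simpa using ((hasDerivWithinAt_id t (Icc 0 1)).smul_const η).const_add x₀
    have hz' : ∀ t ∈ Icc (0 : ℝ) 1, HasDerivWithinAt z
        (Φ (p t) η + (t • fderiv ℝ Φ (p t) (η, Φ (p t) η) h + Φ (p t) h)) (Icc 0 1) t := by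
      intro t ht
      have h3 : HasDerivWithinAt (fun s => Φ (p s) h)
          (fderiv ℝ Φ (p t) (η, Φ (p t) η) h) (Icc 0 1) t := by
        have := (hdiff _ (hmemα t ht)).hasFDerivAt.comp_hasDerivWithinAt t (hp' t ht)
        simpa using this.clm_apply (hasDerivWithinAt_const t _ h)
      have h4 := (hasDerivWithinAt_id t (Icc (0 : ℝ) 1)).smul h3
      rw [one_smul] at h4
      exact (hα η hx t ht).add h4
    have hzR : ∀ t ∈ Icc (0 : ℝ) 1, ‖z t - y₀‖ ≤ R := by
      intro t ht
      have h3 : ‖Φ (p t) h‖ ≤ R / 2 := by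
        refine (ContinuousLinearMap.le_opNorm _ _).trans ?_
        calc _ ≤ M * δ := mul_le_mul (hMD _ (hmemα t ht)) hhδ (norm_nonneg _) hM0.le
          _ ≤ _ := hδM
      have h4 : ‖t • Φ (p t) h‖ ≤ ‖Φ (p t) h‖ := by
        rw [norm_smul, Real.norm_of_nonneg ht.1]
        exact mul_le_of_le_one_left (norm_nonneg _) ht.2
      calc ‖z t - y₀‖ = ‖(α η t - y₀) + t • Φ (p t) h‖ := by
            rw [hz]; congr 1; exact add_sub_right_comm _ _ _
        _ ≤ R / 2 + R / 2 := (norm_add_le _ _).trans (add_le_add (hαR η hx t) (h4.trans h3))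
        _ = R := by ring
    have hbound : ∀ t ∈ Icc (0 : ℝ) 1,
        ‖Φ (p t) η + (t • fderiv ℝ Φ (p t) (η, Φ (p t) η) h + Φ (p t) h) -
          Φ (x₀ + t • (η + h), z t) (η + h)‖ ≤ C * ‖h‖ ^ 2 := by
      intro t ht
      have hpD := hmemα t ht
      have hqD : (x₀ + t • (η + h), z t) ∈ D := by
        refine hmemD _ _ ?_ (hzR t ht)
        rw [add_sub_cancel_left]
        have := hseg t ht (η + h)
        linarith
      have hdq : (x₀ + t • (η + h), z t) - p t = t • (h, Φ (p t) h) := by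
        ext <;> simp [hp, hz]
      have htay := norm_image_sub_sub_fderiv_le_of_lipschitzOnWith hdiff (convex_closedBall _ _)
        hL2 hpD hqD
      change ‖Φ (x₀ + t • (η + h), z t) - Φ (p t) - _‖ ≤ _ at htay
      rw [show (x₀ + t • (η + h), z t) - (x₀ + t • η, α η t) = t • (h, Φ (p t) h) from hdq] at htay
      rw [show (x₀ + t • η, α η t) = p t from rfl] at htay
      set r := Φ (x₀ + t • (η + h), z t) - Φ (p t) - fderiv ℝ Φ (p t) (t • (h, Φ (p t) h)) with hr
      have hw : ‖((h, Φ (p t) h) : E × F)‖ ≤ (1 + M) * ‖h‖ := by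
        refine (max_le_add_of_nonneg (norm_nonneg _) (norm_nonneg _)).trans ?_
        have : ‖Φ (p t) h‖ ≤ M * ‖h‖ :=
          (ContinuousLinearMap.le_opNorm _ _).trans (by gcongr; exact hMD _ hpD)
        change ‖h‖ + ‖Φ (p t) h‖ ≤ _
        linarith
      have hr1 : ‖r‖ ≤ K₂ * ((1 + M) * ‖h‖) ^ 2 := by
        refine htay.trans ?_
        gcongr
        rw [norm_smul, Real.norm_of_nonneg ht.1]
        exact (mul_le_of_le_one_left (norm_nonneg _) ht.2).trans hw
      have hΦq : Φ (x₀ + t • (η + h), z t) =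
          Φ (p t) + t • fderiv ℝ Φ (p t) (h, Φ (p t) h) + r := by
        rw [hr, map_smul]; abel
      -- Integrability turns DΦ(η, Φη)h into DΦ(h, Φh)η, which cancels the linear term of the Taylor
      -- expansion of Φ along `z`. Only terms quadratic in h remain.
      have hid : Φ (p t) η + (t • fderiv ℝ Φ (p t) (η, Φ (p t) η) h + Φ (p t) h) -
          Φ (x₀ + t • (η + h), z t) (η + h) =
          -(t • fderiv ℝ Φ (p t) (h, Φ (p t) h) h) - r (η + h) := by
        rw [hΦq, hint _ (hDΩ hpD) h η]
        simp only [add_apply, smul_apply, map_add]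
        abel
      rw [hid]
      have hb1 : ‖t • fderiv ℝ Φ (p t) (h, Φ (p t) h) h‖ ≤ N * ((1 + M) * ‖h‖) * ‖h‖ := by
        rw [norm_smul, Real.norm_of_nonneg ht.1]
        refine (mul_le_of_le_one_left (norm_nonneg _) ht.2).trans ?_
        refine (ContinuousLinearMap.le_opNorm _ _).trans ?_
        gcongr
        refine (ContinuousLinearMap.le_opNorm _ _).trans ?_
        gcongr
        exact hND _ hpD
      have hb2 : ‖r (η + h)‖ ≤ K₂ * ((1 + M) * ‖h‖) ^ 2 * δ :=
        (ContinuousLinearMap.le_opNorm _ _).trans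
          (mul_le_mul hr1 hηh.le (norm_nonneg _) (by positivity))
      calc _ ≤ ‖-(t • fderiv ℝ Φ (p t) (h, Φ (p t) h) h)‖ + ‖r (η + h)‖ := norm_sub_le _ _
        _ ≤ N * ((1 + M) * ‖h‖) * ‖h‖ + K₂ * ((1 + M) * ‖h‖) ^ 2 * δ := by
          rw [norm_neg]; exact add_le_add hb1 hb2
        _ = C * ‖h‖ ^ 2 := by rw [hC]; ring
    have hg := dist_le_of_approx_trajectories_ODE_of_mem (a := 0) (b := 1) (δ := 0)
      (K := K₁ * ⟨δ, hδ0.le⟩ + 1) (s := fun _ => closedBall y₀ R)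
      (v := fun t y => Φ (x₀ + t • (η + h), y) (η + h)) (f := z) (g := α (η + h))
      (εf := C * ‖h‖ ^ 2) (εg := 0)
      (fun t ht => (hlip _ hηh t (Ico_subset_Icc_self ht)).weaken ?_)
      (fun t ht => (hz' t ht).continuousWithinAt)
      (fun t ht => (hz' t (Ico_subset_Icc_self ht)).mono_of_mem_nhdsWithin
        (Icc_mem_nhdsGE_of_mem ht))
      (fun t ht => by rw [dist_eq_norm]; exact hbound t (Ico_subset_Icc_self ht))
      (fun t ht => mem_closedBall_iff_norm.2 (hzR t (Ico_subset_Icc_self ht)))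
      (fun t ht => (hα _ hηh t ht).continuousWithinAt)
      (fun t ht => (hα _ hηh t (Ico_subset_Icc_self ht)).mono_of_mem_nhdsWithin
        (Icc_mem_nhdsGE_of_mem ht))
      (fun t ht => by rw [dist_self])
      (fun t ht => mem_closedBall_iff_norm.2 ((hαR _ hηh t).trans (by linarith)))
      (by simp [hz, hα0 _ hηh, hα0 _ hx]) 1 (by simp)
    · have hK : ((K₁ * ⟨δ, hδ0.le⟩ + 1 : ℝ≥0) : ℝ) = κ := rfl
      rw [hK, gronwallBound_of_K_ne_0 hκ0.ne', dist_comm, dist_eq_norm] at hg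
      have hz1 : z 1 = α η 1 + Φ (x, α η 1) h := by
        have : p 1 = (x, α η 1) := Prod.ext hxη.symm rfl
        rw [hz]; simp only [this, one_smul]
      rw [hz1, ← sub_sub] at hg
      refine hg.trans (le_of_eq ?_)
      simp only [sub_zero, mul_one, zero_mul, zero_add, add_zero]
      ring
    · refine le_trans ?_ (le_add_of_nonneg_right zero_le_one)
      exact mul_le_mul_right (show ‖η + h‖₊ ≤ ⟨δ, hδ0.le⟩ from hηh.le) K₁
  rw [hasFDerivAt_iff_isLittleO_nhds_zero]
  refine Asymptotics.IsBigO.trans_isLittleO (g := fun h : E => ‖h‖ ^ 2) ?_ ?_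
  · refine Asymptotics.IsBigO.of_bound (C / κ * (Real.exp κ - 1)) ?_
    filter_upwards [ball_mem_nhds (0 : E) (show 0 < δ - ‖η‖ by linarith)] with h hh
    have := key h (by simpa using hh)
    rw [Real.norm_of_nonneg (by positivity), show x + h - x₀ = η + h by rw [hη]; abel]
    exact this
  · have : (fun h : E => ‖h‖ ^ 2) =o[𝓝 0] fun h : E => ‖h‖ := by
      exact (Asymptotics.isLittleO_pow_id (𝕜 := ℝ) (by norm_num : 1 < 2)).comp_tendsto
        (tendsto_norm_zero (E := E))
    exact this.of_norm_right

/-- Bootstrapping: if y is C^n, then so is its derivative x ↦ Φ(x, y(x)), hence y is C^(n+1). -/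
theorem contDiffOn_of_hasFDerivAt {Φ : E × F → E →L[ℝ] F} {Ω : Set (E × F)}
    (hΦ : ContDiffOn ℝ ∞ Φ Ω) {U : Set E} (hU : IsOpen U) {y : E → F}
    (hy : ∀ x ∈ U, (x, y x) ∈ Ω ∧ HasFDerivAt y (Φ (x, y x)) x) : ContDiffOn ℝ ∞ y U := by
  have key : ∀ n : ℕ, ContDiffOn ℝ n y U := by
    intro n
    induction n with
    | zero =>
      exact contDiffOn_zero.2 fun x hx => (hy x hx).2.continuousAt.continuousWithinAt
    | succ n ih =>
      push_cast
      rw [contDiffOn_succ_iff_fderiv_of_isOpen hU]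
      refine ⟨fun x hx => (hy x hx).2.differentiableAt.differentiableWithinAt, by simp, ?_⟩
      have h1 : ContDiffOn ℝ n (fun x => Φ (x, y x)) U :=
        (hΦ.of_le (mod_cast le_top)).comp (contDiffOn_id.prodMk ih) fun x hx => (hy x hx).1
      exact h1.congr fun x hx => (hy x hx).2.fderiv
  exact contDiffOn_infty.2 key

end TotalDifferentialEquation

/-! ### Pullback and exterior derivative of one-forms in coordinates -/

section FormsInCoordinates

open Filter
open scoped Topology

variable {V V' W : Type*} [NormedAddCommGroup V] [NormedSpace ℝ V]
  [NormedAddCommGroup V'] [NormedSpace ℝ V'] [NormedAddCommGroup W] [NormedSpace ℝ W]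
  {V₁ H : Type*} [NormedAddCommGroup V₁] [NormedSpace ℝ V₁] [TopologicalSpace H]
  {I : ModelWithCorners ℝ V₁ H} {M : Type*} [TopologicalSpace M] [ChartedSpace H M]

/-- The pullback of a one-form on a manifold along a map defined on a normed space. -/
noncomputable def pullForm (θ : ∀ p : M, TangentSpace I p →L[ℝ] W) (σ : V → M) (z : V) :
    V →L[ℝ] W :=
  (θ (σ z)).comp (mfderiv 𝓘(ℝ, V) I σ z)

/-- The exterior derivative of a one-form on a normed space. -/
noncomputable def extd (a : V → V →L[ℝ] W) (z v w : V) : W :=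
  fderiv ℝ a z v w - fderiv ℝ a z w v

theorem pullForm_comp (θ : ∀ p : M, TangentSpace I p →L[ℝ] W) {σ : V' → M} {τ : V → V'} {z : V}
    (hσ : MDifferentiableAt 𝓘(ℝ, V') I σ (τ z)) (hτ : DifferentiableAt ℝ τ z) :
    pullForm θ (σ ∘ τ) z = (pullForm θ σ (τ z)).comp (fderiv ℝ τ z) := by
  ext v
  unfold pullForm
  rw [mfderiv_comp (I' := 𝓘(ℝ, V')) z hσ hτ.mdifferentiableAt, mfderiv_eq_fderiv]
  rfl

theorem Filter.EventuallyEq.pullForm_eq (θ : ∀ p : M, TangentSpace I p →L[ℝ] W) {σ σ' : V → M}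
    {z : V} (h : σ =ᶠ[𝓝 z] σ') : pullForm θ σ z = pullForm θ σ' z := by
  -- The tangent spaces at q and q' are different types that both unfold to the model space.
  -- Quantifying over vectors of the model space makes the substitution type-correct; the same
  -- device recurs throughout.
  have key : ∀ q q' : M, q = q' → ∀ u : V₁, θ q u = θ q' u := by
    rintro q _ rfl u
    rfl
  ext v
  exact (key _ _ h.eq_of_nhds _).trans
    (congrArg (fun u : V₁ => θ (σ' z) u) (DFunLike.congr_fun h.mfderiv_eq v))

/-- The terms containing the second derivative of τ cancel, because that derivative is symmetric. -/
theorem extd_pullback {a : V' → V' →L[ℝ] W} {τ : V → V'} {z : V}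
    (ha : DifferentiableAt ℝ a (τ z)) (hτ : ContDiffAt ℝ 2 τ z) (v w : V) :
    extd (fun y => (a (τ y)).comp (fderiv ℝ τ y)) z v w =
      extd a (τ z) (fderiv ℝ τ z v) (fderiv ℝ τ z w) := by
  have hτ1 : DifferentiableAt ℝ τ z := hτ.differentiableAt (by norm_num)
  have hτ2 : DifferentiableAt ℝ (fderiv ℝ τ) z :=
    (hτ.fderiv_right (m := 1) (by norm_num)).differentiableAt (by norm_num)
  have h := (ha.hasFDerivAt.comp z hτ1.hasFDerivAt).clm_comp hτ2.hasFDerivAt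
  have hsymm := (hτ.isSymmSndFDerivAt (by simp)).eq v w
  unfold extd
  have h' : fderiv ℝ (fun y => (a (τ y)).comp (fderiv ℝ τ y)) z = _ := h.fderiv
  rw [h']
  simp [hsymm]

theorem Filter.EventuallyEq.extd_eq {a b : V → V →L[ℝ] W} {z : V} (h : a =ᶠ[𝓝 z] b) (v w : V) :
    extd a z v w = extd b z v w := by
  unfold extd
  rw [h.fderiv_eq]

/-- The exterior derivative is compatible with changes of coordinates. -/
theorem extd_pullForm_comp (θ : ∀ p : M, TangentSpace I p →L[ℝ] W) {σ : V → M} {σ' : V' → M}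
    {τ : V → V'} {z : V} (hσ : σ =ᶠ[𝓝 z] σ' ∘ τ)
    (hσ' : ∀ᶠ y in 𝓝 (τ z), MDifferentiableAt 𝓘(ℝ, V') I σ' y) (hτ : ContDiffAt ℝ 2 τ z)
    (hθ : DifferentiableAt ℝ (pullForm θ σ') (τ z)) (v w : V) :
    extd (pullForm θ σ) z v w =
      extd (pullForm θ σ') (τ z) (fderiv ℝ τ z v) (fderiv ℝ τ z w) := by
  rw [← extd_pullback hθ hτ]
  apply Filter.EventuallyEq.extd_eq
  have h1 : ∀ᶠ y in 𝓝 z, DifferentiableAt ℝ τ y :=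
    (hτ.eventually (by simp)).mono fun y hy => hy.differentiableAt (by norm_num)
  filter_upwards [hσ.eventuallyEq_nhds, hτ.continuousAt.eventually hσ', h1] with y h2 h3 h4
  rw [h2.pullForm_eq θ, pullForm_comp θ h3 h4]

/-- Smoothness of θ is given on the tangent bundle, so it is composed with the tangent map of σ on a
constant vector field. Since V is finite-dimensional, testing on fixed vectors suffices. -/
theorem contDiffOn_pullForm [FiniteDimensional ℝ V] [IsManifold I ∞ M]
    {θ : ∀ p : M, TangentSpace I p →L[ℝ] W}
    (hθ : ContMDiff I.tangent 𝓘(ℝ, W) ∞ (fun v : TangentBundle I M => θ v.1 v.2))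
    {σ : V → M} {U : Set V} (hU : IsOpen U) (hσ : ContMDiffOn 𝓘(ℝ, V) I ∞ σ U) :
    ContDiffOn ℝ ∞ (pullForm θ σ) U := by
  rw [contDiffOn_clm_apply]
  intro v
  have h1 : ContMDiffOn 𝓘(ℝ, V) 𝓘(ℝ, V).tangent ∞
      (fun z => (⟨z, v⟩ : TangentBundle 𝓘(ℝ, V) V)) U :=
    contMDiffOn_vectorSpace_iff_contDiffOn.2 contDiffOn_const
  have h2 := hσ.contMDiffOn_tangentMapWithin (m := ∞) (by simp) hU.uniqueMDiffOn
  have h3 := hθ.comp_contMDiffOn (h2.comp h1 fun z hz => hz)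
  rw [← contMDiffOn_iff_contDiffOn]
  refine h3.congr fun z hz => ?_
  change θ (σ z) (mfderiv 𝓘(ℝ, V) I σ z v) = θ (σ z) (mfderivWithin 𝓘(ℝ, V) I σ U z v)
  rw [mfderivWithin_of_isOpen hU hz]

end FormsInCoordinates

/-! ### Coordinate independence of the exterior derivative of a connection form -/

section Curvature

open Filter
open scoped Topology

variable {E F : Type*} [NormedAddCommGroup E] [NormedSpace ℝ E]
  [NormedAddCommGroup F] [NormedSpace ℝ F]
  {B : Type*} [TopologicalSpace B] [ChartedSpace E B]
  {G : Type*} [TopologicalSpace G] [ChartedSpace F G] [Group G]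
  {P : PrincipalBundle E F B G}

namespace FlatBundle.Connection

/-- The form of a connection with values in the model space of the group. -/
noncomputable def modelForm (A : Connection P) (p : P.Total) :
    TangentSpace (prodModel E F) p →L[ℝ] F := A.form p

theorem contDiffOn_pullForm [FiniteDimensional ℝ E] [FiniteDimensional ℝ F] (A : Connection P)
    {V : Type*} [NormedAddCommGroup V] [NormedSpace ℝ V] [FiniteDimensional ℝ V]
    {σ : V → P.Total} {U : Set V} (hU : IsOpen U)
    (hσ : ContMDiffOn 𝓘(ℝ, V) (prodModel E F) ∞ σ U) :
    ContDiffOn ℝ ∞ (pullForm A.modelForm σ) U :=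
  _root_.contDiffOn_pullForm (θ := A.modelForm) A.smooth hU hσ

/-- `dform` is computed in the chart centred at the point. Writing σ as the inverse of that chart
after a map of normed spaces reduces the claim to naturality of `extd`, so the curvature may be
computed in any parametrization. -/
theorem extd_pullForm [FiniteDimensional ℝ E] [FiniteDimensional ℝ F] (A : Connection P)
    {V : Type*} [NormedAddCommGroup V] [NormedSpace ℝ V]
    {σ : V → P.Total} {z : V} (hσ : ContMDiffAt 𝓘(ℝ, V) (prodModel E F) ∞ σ z) (v w : V) :
    extd (pullForm A.modelForm σ) z v w =
      A.dform (σ z) (mfderiv 𝓘(ℝ, V) (prodModel E F) σ z v)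
        (mfderiv 𝓘(ℝ, V) (prodModel E F) σ z w) := by
  set p := σ z with hp
  set χ := extChartAt (prodModel E F) p with hχ
  set τ : V → E × F := χ ∘ σ with hτ
  have hsrc : ∀ᶠ y in 𝓝 z, σ y ∈ χ.source :=
    hσ.continuousAt.eventually_mem (extChartAt_source_mem_nhds (I := prodModel E F) p)
  have hτs : ContDiffAt ℝ 2 τ z := by
    rw [← contMDiffAt_iff_contDiffAt]
    exact ((contMDiffAt_extChartAt (I := prodModel E F) (n := ∞)).comp z hσ).of_le
      (by norm_cast)
  have htgt : IsOpen χ.target := isOpen_extChartAt_target p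
  have hsymm : ContMDiffOn 𝓘(ℝ, E × F) (prodModel E F) ∞ χ.symm χ.target :=
    contMDiffOn_extChartAt_symm p
  have hmem : χ.target ∈ 𝓝 (τ z) := extChartAt_target_mem_nhds p
  -- The tangent space at p is identified with the model space by the chart at p itself, so the
  -- manifold derivative is the derivative of σ read in this chart.
  have hder : mfderiv 𝓘(ℝ, V) (prodModel E F) σ z = fderiv ℝ τ z := by
    refine (hσ.mdifferentiableAt (by simp)).mfderiv.trans ?_
    rw [modelWithCornersSelf_coe, range_id, fderivWithin_univ]
    rfl
  rw [extd_pullForm_comp A.modelForm (σ' := χ.symm) (τ := τ) ?_ ?_ hτs ?_]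
  · rw [hder]
    rfl
  · filter_upwards [hsrc] with y hy
    exact (χ.left_inv hy).symm
  · filter_upwards [htgt.mem_nhds (mem_of_mem_nhds hmem)] with y hy
    exact (hsymm.contMDiffAt (htgt.mem_nhds hy)).mdifferentiableAt (by simp)
  · exact ((A.contDiffOn_pullForm htgt hsymm).contDiffAt hmem).differentiableAt (by simp)

end FlatBundle.Connection

end Curvature

/-! ### The Frobenius theorem for a form complementary to the fibres -/

section Frobenius

open Filter Metric
open scoped Topology

variable {E F : Type*} [NormedAddCommGroup E] [NormedSpace ℝ E]
  [NormedAddCommGroup F] [NormedSpace ℝ F]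

/-- The Frobenius theorem for an `F`-valued one-form on `E × F` whose kernel is a complement of
`F`. -/
theorem exists_integral_graph [FiniteDimensional ℝ F] {a : E × F → E × F →L[ℝ] F}
    {Ω : Set (E × F)} (hΩ : IsOpen Ω) (ha : ContDiffOn ℝ ∞ a Ω)
    (hinj : ∀ z ∈ Ω, ∀ η : F, a z (0, η) = 0 → η = 0)
    (hflat : ∀ z ∈ Ω, ∀ v w, a z v = 0 → a z w = 0 → extd a z v w = 0)
    {z₀ : E × F} (hz₀ : z₀ ∈ Ω) :
    ∃ δ > 0, ∃ y : E → F, y z₀.1 = z₀.2 ∧ ContDiffOn ℝ ∞ y (ball z₀.1 δ) ∧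
      ∀ x ∈ ball z₀.1 δ, (x, y x) ∈ Ω ∧ ∀ h, a (x, y x) (h, fderiv ℝ y x h) = 0 := by
  have := FiniteDimensional.complete ℝ F
  let inr : F →L[ℝ] E × F := ContinuousLinearMap.inr ℝ E F
  let inl : E →L[ℝ] E × F := ContinuousLinearMap.inl ℝ E F
  have hinv : ∀ z ∈ Ω, ∃ e : F ≃L[ℝ] F, (e : F →L[ℝ] F) = (a z).comp inr := by
    intro z hz
    have hi : Function.Injective ((a z).comp inr).toLinearMap := by
      rw [injective_iff_map_eq_zero]
      exact fun η hη => hinj z hz η hη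
    exact ⟨(LinearEquiv.ofInjectiveEndo _ hi).toContinuousLinearEquiv, by ext; rfl⟩
  -- The kernel of `a z` is the graph of Φ z: this solves a(h, Φh) = 0 for Φh by inverting `a` on
  -- the second factor.
  let Φ : E × F → E →L[ℝ] F := fun z => -(((a z).comp inr).inverse.comp ((a z).comp inl))
  have hΦ : ContDiffOn ℝ ∞ Φ Ω := by
    have h1 : ContDiffOn ℝ ∞ (fun z => (a z).comp inr) Ω := ha.clm_comp contDiffOn_const
    have h2 : ContDiffOn ℝ ∞ (fun z => (a z).comp inl) Ω := ha.clm_comp contDiffOn_const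
    have h3 : ContDiffOn ℝ ∞ (fun z => ((a z).comp inr).inverse) Ω := by
      intro z hz
      obtain ⟨e, he⟩ := hinv z hz
      have h4 : ContDiffAt ℝ ∞ ContinuousLinearMap.inverse ((a z).comp inr) := by
        rw [← he]; exact contDiffAt_map_inverse e
      exact h4.comp_contDiffWithinAt z (h1 z hz)
    exact (h3.clm_comp h2).neg
  have hker : ∀ z ∈ Ω, ∀ h, a z (h, Φ z h) = 0 := by
    intro z hz h
    obtain ⟨e, he⟩ := hinv z hz
    have h1 : Φ z h = -(e.symm (a z (h, 0))) := by
      change -(((a z).comp inr).inverse (a z (h, 0))) = _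
      rw [← he, ContinuousLinearMap.inverse_equiv]
      rfl
    have h2 : ∀ η, a z (0, η) = e η := fun η => (DFunLike.congr_fun he η).symm
    have h3 : ((h, Φ z h) : E × F) = (h, 0) + (0, Φ z h) := by simp
    rw [h3, map_add, h2, h1, map_neg, e.apply_symm_apply, add_neg_cancel]
  -- Differentiating a(h, Φh) = 0 along v gives Da(v)(h, Φh) = -a(0, DΦ(v)h). So da on the kernel
  -- vectors of h and k is, up to sign, `a` of the integrability defect in the second factor, on
  -- which `a` is injective.
  have hint : ∀ z ∈ Ω, ∀ h k, fderiv ℝ Φ z (k, Φ z k) h = fderiv ℝ Φ z (h, Φ z h) k := by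
    intro z hz h k
    have haz : DifferentiableAt ℝ a z :=
      (ha.contDiffAt (hΩ.mem_nhds hz)).differentiableAt (by simp)
    have hΦz : DifferentiableAt ℝ Φ z :=
      (hΦ.contDiffAt (hΩ.mem_nhds hz)).differentiableAt (by simp)
    have hd : ∀ h v, fderiv ℝ a z v (h, Φ z h) + a z (0, fderiv ℝ Φ z v h) = 0 := by
      intro h v
      have h1 : HasFDerivAt (fun y => a y (h, Φ y h)) (0 : E × F →L[ℝ] F) z := by
        refine (hasFDerivAt_const (0 : F) z).congr_of_eventuallyEq ?_
        filter_upwards [hΩ.mem_nhds hz] with y hy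
        exact hker y hy h
      have h2 := haz.hasFDerivAt.clm_apply ((hasFDerivAt_const h z).prodMk
        (hΦz.hasFDerivAt.clm_apply (hasFDerivAt_const h z)))
      have h3 := DFunLike.congr_fun (h2.unique h1) v
      simpa [add_comm] using h3
    have h5 := hflat z hz _ _ (hker z hz k) (hker z hz h)
    have h6 : a z (0, fderiv ℝ Φ z (k, Φ z k) h - fderiv ℝ Φ z (h, Φ z h) k) = 0 := by
      have h7 : ((0, fderiv ℝ Φ z (k, Φ z k) h - fderiv ℝ Φ z (h, Φ z h) k) : E × F) =
        (0, fderiv ℝ Φ z (k, Φ z k) h) - (0, fderiv ℝ Φ z (h, Φ z h) k) := by simp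
      rw [h7, map_sub, ← neg_eq_of_add_eq_zero_right (hd h (k, Φ z k)),
        ← neg_eq_of_add_eq_zero_right (hd k (h, Φ z h))]
      unfold extd at h5
      rw [neg_sub_neg, ← neg_sub, h5, neg_zero]
    exact sub_eq_zero.1 (hinj z hz _ h6)
  obtain ⟨δ, hδ, y, hy0, hy⟩ := exists_hasFDerivAt_of_integrable hΩ
    (hΦ.of_le (by norm_cast)) hint hz₀
  refine ⟨δ, hδ, y, hy0, contDiffOn_of_hasFDerivAt hΦ isOpen_ball hy, fun x hx => ?_⟩
  obtain ⟨h1, h2⟩ := hy x hx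
  refine ⟨h1, fun h => ?_⟩
  rw [h2.fderiv]
  exact hker _ h1 h

end Frobenius

/-! ### Connection forms, the Maurer–Cartan form and local horizontal sections -/

section ConnectionForm

open Filter
open scoped Topology

variable {E F : Type*} [NormedAddCommGroup E] [NormedSpace ℝ E]
  [NormedAddCommGroup F] [NormedSpace ℝ F]
  {B : Type*} [TopologicalSpace B] [ChartedSpace E B]
  {G : Type*} [TopologicalSpace G] [ChartedSpace F G] [Group G]
  {P : PrincipalBundle E F B G}
  {V H : Type*} [NormedAddCommGroup V] [NormedSpace ℝ V] [TopologicalSpace H]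
  {I : ModelWithCorners ℝ V H} {M : Type*} [TopologicalSpace M] [ChartedSpace H M]

namespace FlatBundle

variable (F) in
/-- The left-invariant Maurer-Cartan form. -/
noncomputable def mcForm (g : G) : TangentSpace 𝓘(ℝ, F) g →L[ℝ] F :=
  mfderiv 𝓘(ℝ, F) 𝓘(ℝ, F) (fun h : G => g⁻¹ * h) g

theorem mdifferentiable_mul_left [LieGroup 𝓘(ℝ, F) ∞ G] (g : G) :
    MDifferentiable 𝓘(ℝ, F) 𝓘(ℝ, F) (fun h : G => g * h) :=
  (contMDiff_mul_left (I := 𝓘(ℝ, F)) (n := ∞)).mdifferentiable (by simp)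

theorem mcForm_mfderiv [LieGroup 𝓘(ℝ, F) ∞ G] {c : M → G} {x : M}
    (hc : MDifferentiableAt I 𝓘(ℝ, F) c x) (v : TangentSpace I x) :
    mcForm F (c x) (mfderiv I 𝓘(ℝ, F) c x v) =
      mfderiv I 𝓘(ℝ, F) (fun y => (c x)⁻¹ * c y) x v := by
  have h := mfderiv_comp x (mdifferentiable_mul_left (F := F) (c x)⁻¹ (c x)) hc
  exact (DFunLike.congr_fun h v).symm

/-- Translation by g undoes translation by g⁻¹. This is how vanishing of a connection form becomes
vanishing of a derivative. -/
theorem mcForm_injective [LieGroup 𝓘(ℝ, F) ∞ G] (g : G) (v : TangentSpace 𝓘(ℝ, F) g)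
    (hv : mcForm F g v = 0) : v = 0 := by
  have h := mfderiv_comp g (mdifferentiable_mul_left (F := F) g (g⁻¹ * g))
    (mdifferentiable_mul_left (F := F) g⁻¹ g)
  have hid : (fun h : G => g * h) ∘ (fun h => g⁻¹ * h) = id := by ext; simp
  rw [hid, mfderiv_id] at h
  have h1 := DFunLike.congr_fun h v
  refine Eq.trans h1 ?_
  exact (congrArg (mfderiv 𝓘(ℝ, F) 𝓘(ℝ, F) (fun h : G => g * h) (g⁻¹ * g)) hv).trans
    (map_zero _)

/-- The Maurer-Cartan form is left invariant. -/
theorem mcForm_mul_left [LieGroup 𝓘(ℝ, F) ∞ G] (k : G) {c : M → G} {x : M}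
    (hc : MDifferentiableAt I 𝓘(ℝ, F) c x) (v : TangentSpace I x) :
    mcForm F (k * c x) (mfderiv I 𝓘(ℝ, F) (fun y => k * c y) x v) =
      mcForm F (c x) (mfderiv I 𝓘(ℝ, F) c x v) := by
  have h : MDifferentiableAt I 𝓘(ℝ, F) (fun y => k * c y) x :=
    (mdifferentiable_mul_left (F := F) k (c x)).comp x hc
  have h1 : ∀ f f' : M → G, f = f' →
      (mfderiv I 𝓘(ℝ, F) f x v : F) = mfderiv I 𝓘(ℝ, F) f' x v := by
    rintro f _ rfl
    rfl
  rw [mcForm_mfderiv h, mcForm_mfderiv hc]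
  refine h1 _ _ (funext fun y => ?_)
  rw [mul_inv_rev, mul_assoc, inv_mul_cancel_left]

namespace PrincipalBundle

theorem mdifferentiable_act (p : P.Total) :
    MDifferentiable 𝓘(ℝ, F) (prodModel E F) (fun g => P.act p g) :=
  (P.contMDiff_act.comp (contMDiff_const.prodMk contMDiff_id)).mdifferentiable (by simp)

theorem contMDiff_act_right (g : G) :
    ContMDiff (prodModel E F) (prodModel E F) ∞ (fun q => P.act q g) :=
  P.contMDiff_act.comp (contMDiff_id.prodMk contMDiff_const)

/-- An equivariant local trivialization of a principal bundle. -/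
structure LocalTriv (P : PrincipalBundle E F B G) where
  /-- The domain in the base. -/
  dom : Set B
  /-- The trivialization. -/
  map : OpenPartialHomeomorph P.Total (B × G)
  isOpen_dom : IsOpen dom
  source_eq : map.source = P.proj ⁻¹' dom
  target_eq : map.target = dom ×ˢ univ
  contMDiffOn : ContMDiffOn (prodModel E F) (prodModel E F) ∞ map map.source
  contMDiffOn_symm : ContMDiffOn (prodModel E F) (prodModel E F) ∞ map.symm map.target
  map_fst : ∀ p ∈ map.source, (map p).1 = P.proj p
  map_act : ∀ p ∈ map.source, ∀ g, map (P.act p g) = ((map p).1, (map p).2 * g)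

theorem exists_localTriv (P : PrincipalBundle E F B G) (b : B) :
    ∃ T : LocalTriv P, b ∈ T.dom := by
  obtain ⟨U, φ, hU, hbU, hsrc, htgt, hφ, hφs, hact⟩ := P.locallyTrivial b
  exact ⟨⟨U, φ, hU, hsrc, htgt, hφ, hφs, fun p hp => (hact p hp).1, fun p hp => (hact p hp).2⟩, hbU⟩

namespace LocalTriv

variable (T : LocalTriv P)

theorem mem_source {p : P.Total} : p ∈ T.map.source ↔ P.proj p ∈ T.dom := by
  rw [T.source_eq]; rfl

theorem mem_target {z : B × G} : z ∈ T.map.target ↔ z.1 ∈ T.dom := by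
  rw [T.target_eq]; simp

theorem proj_symm {b : B} (hb : b ∈ T.dom) (g : G) : P.proj (T.map.symm (b, g)) = b := by
  have h : (b, g) ∈ T.map.target := T.mem_target.2 hb
  rw [← T.map_fst _ (T.map.map_target h), T.map.right_inv h]

theorem act_symm {b : B} (hb : b ∈ T.dom) (g h : G) :
    P.act (T.map.symm (b, g)) h = T.map.symm (b, g * h) := by
  have h1 : (b, g) ∈ T.map.target := T.mem_target.2 hb
  have h2 : T.map.symm (b, g) ∈ T.map.source := T.map.map_target h1
  have h3 : P.act (T.map.symm (b, g)) h ∈ T.map.source := by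
    rw [T.mem_source, P.proj_act, ← T.mem_source]; exact h2
  rw [← T.map.left_inv h3, T.map_act _ h2, T.map.right_inv h1]

/-- The element of the group that sends `p` to `q`. -/
def div (p q : P.Total) : G := (T.map p).2⁻¹ * (T.map q).2

theorem div_act {p : P.Total} (hp : P.proj p ∈ T.dom) (g : G) : T.div p (P.act p g) = g := by
  unfold div
  rw [T.map_act _ (T.mem_source.2 hp), inv_mul_cancel_left]

theorem act_div {p q : P.Total} (hp : P.proj p ∈ T.dom) (hpq : P.proj p = P.proj q) :
    P.act p (T.div p q) = q := by
  have h1 := T.mem_source.2 hp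
  have h2 := T.mem_source.2 (hpq ▸ hp)
  have h3 : P.act p (T.div p q) ∈ T.map.source := by
    rw [T.mem_source, P.proj_act]; exact hp
  refine T.map.injOn h3 h2 ?_
  rw [T.map_act _ h1, div, mul_inv_cancel_left, T.map_fst _ h1, hpq, ← T.map_fst _ h2]

end LocalTriv

theorem act_injective (p : P.Total) : Function.Injective (P.act p) := by
  obtain ⟨T, hT⟩ := P.exists_localTriv (P.proj p)
  intro g h hgh
  rw [← T.div_act hT g, ← T.div_act hT h, hgh]

theorem exists_act_eq {p q : P.Total} (h : P.proj p = P.proj q) : ∃ g, P.act p g = q := by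
  obtain ⟨T, hT⟩ := P.exists_localTriv (P.proj p)
  exact ⟨_, T.act_div hT h⟩

theorem proj_surjective : Function.Surjective P.proj := by
  intro b
  obtain ⟨T, hT⟩ := P.exists_localTriv b
  exact ⟨_, T.proj_symm hT 1⟩

end PrincipalBundle

namespace Connection

theorem vertical' (A : Connection P) (p : P.Total) (v : F) :
    A.modelForm (P.act p 1) (mfderiv 𝓘(ℝ, F) (prodModel E F) (fun g : G => P.act p g) 1 v) = v :=
  A.vertical p v

/-- The connection form along the fibre is the Maurer-Cartan form. -/
theorem form_act_left [LieGroup 𝓘(ℝ, F) ∞ G] (A : Connection P) (p : P.Total) {c : M → G} {x : M}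
    (hc : MDifferentiableAt I 𝓘(ℝ, F) c x) (v : TangentSpace I x) :
    A.modelForm (P.act p (c x)) (mfderiv I (prodModel E F) (fun y => P.act p (c y)) x v) =
      mcForm F (c x) (mfderiv I 𝓘(ℝ, F) c x v) := by
  have hd : MDifferentiableAt I 𝓘(ℝ, F) (fun y => (c x)⁻¹ * c y) x :=
    (mdifferentiable_mul_left (F := F) (c x)⁻¹ (c x)).comp x hc
  -- For maps through the identity this is the normalization on fundamental vector fields. The
  -- general case follows by moving the base point to p·c(x) and replacing c(y) by c(x)⁻¹c(y).
  have key : ∀ (q : P.Total) (d : M → G), MDifferentiableAt I 𝓘(ℝ, F) d x → d x = 1 →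
      A.modelForm (P.act q (d x)) (mfderiv I (prodModel E F) (fun y => P.act q (d y)) x v) =
        mfderiv I 𝓘(ℝ, F) d x v := by
    intro q d hd h1
    have h2 := mfderiv_comp x (g := fun g : G => P.act q g)
      (P.mdifferentiable_act q (d x)) hd
    have h3 := DFunLike.congr_fun h2 v
    have h4 : ∀ g : G, g = 1 → ∀ u : F, A.modelForm (P.act q g)
        (mfderiv 𝓘(ℝ, F) (prodModel E F) (fun g : G => P.act q g) g u) = u := by
      rintro _ rfl u
      exact A.vertical' q u
    exact (congrArg (fun u : E × F => A.modelForm (P.act q (d x)) u) h3).trans (h4 _ h1 _)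
  rw [mcForm_mfderiv hc, ← key (P.act p (c x)) _ hd (by simp)]
  have h5 : (fun y => P.act (P.act p (c x)) ((c x)⁻¹ * c y)) = fun y => P.act p (c y) := by
    funext y
    rw [← P.act_mul, mul_inv_cancel_left]
  have h6 : ∀ f f' : M → P.Total, f = f' →
      A.modelForm (f x) (mfderiv I (prodModel E F) f x v) =
        A.modelForm (f' x) (mfderiv I (prodModel E F) f' x v) := by
    rintro f _ rfl
    rfl
  exact (h6 _ _ h5).symm

/-- The connection form of a translate of a horizontal map. -/
theorem form_act [LieGroup 𝓘(ℝ, F) ∞ G] (A : Connection P) {s : M → P.Total} {c : M → G} {x : M}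
    (hs : MDifferentiableAt I (prodModel E F) s x)
    (hs0 : ∀ v, A.modelForm (s x) (mfderiv I (prodModel E F) s x v) = 0)
    (hc : MDifferentiableAt I 𝓘(ℝ, F) c x) (v : TangentSpace I x) :
    A.modelForm (P.act (s x) (c x)) (mfderiv I (prodModel E F) (fun y => P.act (s y) (c y)) x v) =
      mcForm F (c x) (mfderiv I 𝓘(ℝ, F) c x v) := by
  have hact : MDifferentiableAt ((prodModel E F).prod 𝓘(ℝ, F)) (prodModel E F)
      (fun z : P.Total × G => P.act z.1 z.2) (s x, c x) :=
    P.contMDiff_act.mdifferentiable (by simp) _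
  have h1 := mfderiv_comp x (g := fun z : P.Total × G => P.act z.1 z.2) hact (hs.prodMk hc)
  have h2 := DFunLike.congr_fun h1 v
  have h3 := mfderiv_prod_eq_add_apply hact
    (v := mfderiv I ((prodModel E F).prod 𝓘(ℝ, F)) (fun y => (s y, c y)) x v)
  have h4 : mfderiv I ((prodModel E F).prod 𝓘(ℝ, F)) (fun y => (s y, c y)) x v =
      (mfderiv I (prodModel E F) s x v, mfderiv I 𝓘(ℝ, F) c x v) :=
    DFunLike.congr_fun (hs.mfderiv_prod hc) v
  -- Leibniz rule for the action. The first summand is a right translate of a horizontal vector,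
  -- which ω kills by equivariance; the second lies along the fibre.
  have h5 : mfderiv I (prodModel E F) (fun y => P.act (s y) (c y)) x v =
      mfderiv (prodModel E F) (prodModel E F) (fun q => P.act q (c x)) (s x)
        (mfderiv I (prodModel E F) s x v) +
      mfderiv 𝓘(ℝ, F) (prodModel E F) (fun g => P.act (s x) g) (c x)
        (mfderiv I 𝓘(ℝ, F) c x v) := by
    refine (h2.trans h3).trans ?_
    rw [h4]
  have h6 : A.modelForm (P.act (s x) (c x)) (mfderiv (prodModel E F) (prodModel E F)
      (fun q => P.act q (c x)) (s x) (mfderiv I (prodModel E F) s x v)) = 0 := by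
    refine (A.equivariant (s x) (c x) _).trans ?_
    exact (congrArg (Ad F G (c x)⁻¹) (hs0 v)).trans (map_zero _)
  have h7 := mfderiv_comp x (g := fun g : G => P.act (s x) g)
    (P.mdifferentiable_act (s x) (c x)) hc
  have h8 := A.form_act_left (s x) hc v
  refine (congrArg (fun u : E × F => A.modelForm (P.act (s x) (c x)) u) h5).trans ?_
  refine (map_add (A.modelForm (P.act (s x) (c x))) _ _).trans ?_
  rw [h6, zero_add, ← h8]
  exact (congrArg (fun u : E × F => A.modelForm (P.act (s x) (c x)) u)
    (DFunLike.congr_fun h7 v)).symm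

/-- A local horizontal section of a principal bundle with connection. -/
structure HorizontalSection (A : Connection P) where
  /-- The domain. -/
  dom : Set B
  /-- The section. -/
  sec : B → P.Total
  isOpen_dom : IsOpen dom
  proj_sec : ∀ b ∈ dom, P.proj (sec b) = b
  contMDiffOn : ContMDiffOn 𝓘(ℝ, E) (prodModel E F) ∞ sec dom
  horizontal : ∀ b ∈ dom, ∀ v, A.modelForm (sec b) (mfderiv 𝓘(ℝ, E) (prodModel E F) sec b v) = 0

/-- The Frobenius theorem: a flat connection has a local horizontal section through each point. -/
theorem exists_horizontalSection [FiniteDimensional ℝ E] [FiniteDimensional ℝ F]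
    [IsManifold 𝓘(ℝ, E) ∞ B] [LieGroup 𝓘(ℝ, F) ∞ G] (A : Connection P) (hA : A.IsFlat)
    (p₀ : P.Total) : ∃ S : HorizontalSection A, P.proj p₀ ∈ S.dom ∧ S.sec (P.proj p₀) = p₀ := by
  obtain ⟨T, hbU⟩ := P.exists_localTriv (P.proj p₀)
  set b₀ := P.proj p₀ with hb₀
  have hp₀ : p₀ ∈ T.map.source := T.mem_source.2 hbU
  set g₀ := (T.map p₀).2 with hg₀
  set χ := extChartAt 𝓘(ℝ, E) b₀ with hχ
  set ξ := extChartAt 𝓘(ℝ, F) g₀ with hξ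
  -- Coordinates are taken through a local trivialization, not from a chart of the total space, so
  -- that the second factor is exactly the fibre direction.
  let σ : E × F → P.Total := fun z => T.map.symm (χ.symm z.1, ξ.symm z.2)
  let Ω : Set (E × F) := (χ.target ∩ χ.symm ⁻¹' T.dom) ×ˢ ξ.target
  have hχs : ContMDiffOn 𝓘(ℝ, E) 𝓘(ℝ, E) ∞ χ.symm χ.target := contMDiffOn_extChartAt_symm b₀
  have hξs : ContMDiffOn 𝓘(ℝ, F) 𝓘(ℝ, F) ∞ ξ.symm ξ.target := contMDiffOn_extChartAt_symm g₀
  have hξt : IsOpen ξ.target := isOpen_extChartAt_target g₀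
  have hΩ₁ : IsOpen (χ.target ∩ χ.symm ⁻¹' T.dom) :=
    hχs.continuousOn.isOpen_inter_preimage (isOpen_extChartAt_target b₀) T.isOpen_dom
  have hΩ : IsOpen Ω := hΩ₁.prod hξt
  have hσ : ContMDiffOn 𝓘(ℝ, E × F) (prodModel E F) ∞ σ Ω := by
    refine T.contMDiffOn_symm.comp (ContMDiffOn.prodMk ?_ ?_) fun z hz => T.mem_target.2 hz.1.2
    · exact hχs.comp contDiff_fst.contMDiff.contMDiffOn fun z hz => hz.1.1
    · exact hξs.comp contDiff_snd.contMDiff.contMDiffOn fun z hz => hz.2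
  have hσat : ∀ z ∈ Ω, ContMDiffAt 𝓘(ℝ, E × F) (prodModel E F) ∞ σ z := fun z hz =>
    hσ.contMDiffAt (hΩ.mem_nhds hz)
  -- On horizontal vectors the bracket term of the curvature is [0, 0], so flatness says dω = 0
  -- there.
  have hflat : ∀ z ∈ Ω, ∀ v w, pullForm A.modelForm σ z v = 0 → pullForm A.modelForm σ z w = 0 →
      extd (pullForm A.modelForm σ) z v w = 0 := by
    intro z hz v w hv hw
    have : LieGroup 𝓘(ℝ, F) (minSmoothness ℝ 3) G := LieGroup.of_le (n := ∞) (by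
      rw [minSmoothness_of_isRCLikeNormedField]; norm_cast)
    have := FiniteDimensional.complete ℝ F
    rw [A.extd_pullForm (hσat z hz)]
    have h := hA (σ z) (mfderiv 𝓘(ℝ, E × F) (prodModel E F) σ z v)
      (mfderiv 𝓘(ℝ, E × F) (prodModel E F) σ z w)
    unfold curvature at h
    have hv' : A.form (σ z) (mfderiv 𝓘(ℝ, E × F) (prodModel E F) σ z v) = 0 := hv
    have hw' : A.form (σ z) (mfderiv 𝓘(ℝ, E × F) (prodModel E F) σ z w) = 0 := hw
    rw [hv', hw'] at h
    have h0 : ⁅(0 : GroupLieAlgebra 𝓘(ℝ, F) G), (0 : GroupLieAlgebra 𝓘(ℝ, F) G)⁆ = 0 :=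
      lie_self (0 : GroupLieAlgebra 𝓘(ℝ, F) G)
    rw [h0, add_zero] at h
    exact h
  -- The line y ↦ σ(x, y) is the orbit of a single point, so the pulled-back form on it is the
  -- Maurer–Cartan form in a chart of G, which is injective.
  have hinj : ∀ z ∈ Ω, ∀ η : F, pullForm A.modelForm σ z (0, η) = 0 → η = 0 := by
    intro z hz η hη
    have h1 : MDifferentiableAt 𝓘(ℝ, F) 𝓘(ℝ, F) ξ.symm z.2 :=
      (hξs.contMDiffAt (hξt.mem_nhds hz.2)).mdifferentiableAt (by simp)
    have hτ : HasFDerivAt (fun y : F => (z.1, y)) (ContinuousLinearMap.inr ℝ E F) z.2 :=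
      hasFDerivAt_prodMk_right z.1 z.2
    have h2 := pullForm_comp A.modelForm (σ := σ) (τ := fun y : F => (z.1, y)) (z := z.2)
      ((hσat z hz).mdifferentiableAt (by simp)) hτ.differentiableAt
    have h3 := DFunLike.congr_fun h2 η
    rw [hτ.fderiv] at h3
    have h4 : pullForm A.modelForm (σ ∘ fun y : F => (z.1, y)) z.2 η = 0 := h3.trans hη
    have h5 : (σ ∘ fun y : F => (z.1, y)) =
        fun y => P.act (T.map.symm (χ.symm z.1, 1)) (ξ.symm y) := by
      funext y
      rw [T.act_symm hz.1.2, one_mul]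
      rfl
    rw [h5] at h4
    have h6 := A.form_act_left (T.map.symm (χ.symm z.1, 1)) h1 η
    have h7 := mcForm_injective _ _ (h6.symm.trans h4)
    have h8 : MDifferentiableAt 𝓘(ℝ, F) 𝓘(ℝ, F) ξ (ξ.symm z.2) :=
      mdifferentiableAt_extChartAt ((extChartAt_source 𝓘(ℝ, F) g₀) ▸ ξ.map_target hz.2)
    have h9 : ξ ∘ ξ.symm =ᶠ[𝓝 z.2] id := by
      filter_upwards [hξt.mem_nhds hz.2] with y hy
      exact ξ.right_inv hy
    have h10 := h9.mfderiv_eq (I := 𝓘(ℝ, F)) (I' := 𝓘(ℝ, F))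
    rw [mfderiv_comp z.2 h8 h1, mfderiv_id] at h10
    have h11 := DFunLike.congr_fun h10 η
    refine h11.symm.trans ?_
    exact (congrArg (mfderiv 𝓘(ℝ, F) 𝓘(ℝ, F) ξ (ξ.symm z.2)) h7).trans (map_zero _)
  have hz₀ : ((χ b₀, ξ g₀) : E × F) ∈ Ω := by
    refine ⟨⟨mem_extChartAt_target b₀, ?_⟩, mem_extChartAt_target g₀⟩
    rw [mem_preimage, extChartAt_to_inv]
    exact hbU
  obtain ⟨δ, hδ, y, hy0, hysm, hy⟩ := exists_integral_graph hΩ (A.contDiffOn_pullForm hΩ hσ)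
    hinj hflat hz₀
  have hχ' : ContMDiffOn 𝓘(ℝ, E) 𝓘(ℝ, E) ∞ χ χ.source := by
    rw [hχ, extChartAt_source]
    exact contMDiffOn_extChartAt
  have hdom : IsOpen (χ.source ∩ χ ⁻¹' Metric.ball (χ b₀) δ) :=
    hχ'.continuousOn.isOpen_inter_preimage (isOpen_extChartAt_source b₀) Metric.isOpen_ball
  let τ : E → E × F := fun x => (x, y x)
  have hτsm : ContDiffOn ℝ ∞ τ (Metric.ball (χ b₀) δ) := contDiffOn_id.prodMk hysm
  refine ⟨⟨χ.source ∩ χ ⁻¹' Metric.ball (χ b₀) δ, fun b => σ (τ (χ b)), hdom, ?_, ?_, ?_⟩, ?_, ?_⟩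
  · intro b hb
    have := (hy _ hb.2).1
    change P.proj (T.map.symm (χ.symm (χ b), _)) = b
    rw [T.proj_symm this.1.2, χ.left_inv hb.1]
  · exact hσ.comp (hτsm.contMDiffOn.comp (hχ'.mono inter_subset_left) inter_subset_right)
      fun b hb => (hy _ hb.2).1
  · intro b hb v
    have hσm := (hσat _ (hy _ hb.2).1).mdifferentiableAt (n := ∞) (by simp)
    have hτd : DifferentiableAt ℝ τ (χ b) :=
      (hτsm.contDiffAt (Metric.isOpen_ball.mem_nhds hb.2)).differentiableAt (by simp)
    have hyd : DifferentiableAt ℝ y (χ b) :=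
      (hysm.contDiffAt (Metric.isOpen_ball.mem_nhds hb.2)).differentiableAt (by simp)
    have hχm : MDifferentiableAt 𝓘(ℝ, E) 𝓘(ℝ, E) χ b :=
      mdifferentiableAt_extChartAt ((extChartAt_source 𝓘(ℝ, E) b₀) ▸ hb.1)
    have h1 := mfderiv_comp b (g := σ ∘ τ) (f := χ) (I' := 𝓘(ℝ, E)) (I'' := prodModel E F)
      (MDifferentiableAt.comp (χ b) (g := σ) (f := τ) hσm hτd.mdifferentiableAt) hχm
    have h2 := pullForm_comp A.modelForm (σ := σ) (τ := τ) (z := χ b) hσm hτd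
    have h3 : ∀ h : E, pullForm A.modelForm (σ ∘ τ) (χ b) h = 0 := by
      intro h
      rw [h2]
      have : fderiv ℝ τ (χ b) h = (h, fderiv ℝ y (χ b) h) := by
        have := (hasFDerivAt_id (χ b)).prodMk hyd.hasFDerivAt
        rw [show fderiv ℝ τ (χ b) = _ from this.fderiv]
        rfl
      rw [ContinuousLinearMap.comp_apply, this]
      exact (hy _ hb.2).2 h
    refine (congrArg (fun u : E × F => A.modelForm (σ (τ (χ b))) u)
      (DFunLike.congr_fun h1 v)).trans ?_
    exact h3 _
  · exact ⟨mem_extChartAt_source b₀, by simpa using hδ⟩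
  · change T.map.symm (χ.symm (χ b₀), ξ.symm (y (χ b₀))) = p₀
    have : y (χ b₀) = ξ g₀ := hy0
    rw [this, extChartAt_to_inv, extChartAt_to_inv, hg₀, hb₀, ← T.map_fst p₀ hp₀, Prod.mk.eta,
      T.map.left_inv hp₀]

end Connection
end FlatBundle

end ConnectionForm

/-! ### Manifold-valued maps with vanishing derivative -/

section LocallyConstant

open Filter
open scoped Topology

variable {V F H N E B : Type*} [NormedAddCommGroup V] [NormedSpace ℝ V]
  [NormedAddCommGroup F] [NormedSpace ℝ F] [NormedAddCommGroup E] [NormedSpace ℝ E]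
  [TopologicalSpace N] [ChartedSpace F N] [IsManifold 𝓘(ℝ, F) ∞ N]
  [TopologicalSpace B] [ChartedSpace E B] [IsManifold 𝓘(ℝ, E) ∞ B]

/-- The image lies in one chart, so the mean value inequality with constant 0 applies in
coordinates. -/
theorem Convex.eq_of_hasMFDerivWithinAt_zero {s : Set V} (hs : Convex ℝ s) {f : V → N} {y₀ : N}
    (hsrc : ∀ x ∈ s, f x ∈ (chartAt F y₀).source)
    (hf : ∀ x ∈ s, HasMFDerivWithinAt 𝓘(ℝ, V) 𝓘(ℝ, F) f s x 0) {x y : V}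
    (hx : x ∈ s) (hy : y ∈ s) : f x = f y := by
  set ξ := extChartAt 𝓘(ℝ, F) y₀ with hξ
  have h1 : ∀ x ∈ s, HasFDerivWithinAt (ξ ∘ f) (0 : V →L[ℝ] F) s x := by
    intro x hx
    have h2 : MDifferentiableAt 𝓘(ℝ, F) 𝓘(ℝ, F) ξ (f x) := by
      have := ((contMDiffOn_extChartAt (I := 𝓘(ℝ, F)) (n := ∞) (x := y₀)).contMDiffAt
        ((chartAt F y₀).open_source.mem_nhds (hsrc x hx)))
      exact this.mdifferentiableAt (by simp)
    have h3 := h2.hasMFDerivAt.comp_hasMFDerivWithinAt x (hf x hx)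
    rw [ContinuousLinearMap.comp_zero] at h3
    exact h3.hasFDerivWithinAt
  have h4 := hs.norm_image_sub_le_of_norm_hasFDerivWithin_le (C := 0) h1 (by simp) hx hy
  have h5 : ξ (f y) = ξ (f x) := by
    rw [zero_mul, norm_le_zero_iff, sub_eq_zero] at h4
    exact h4
  have h6 : ∀ x ∈ s, f x ∈ ξ.source := fun x hx => by
    rw [hξ, extChartAt_source]; exact hsrc x hx
  exact (ξ.injOn (h6 _ hy) (h6 _ hx) h5).symm

theorem eventually_eq_of_mfderiv_eq_zero {f : B → N} {b : B}
    (hf : ∀ᶠ x in 𝓝 b, MDifferentiableAt 𝓘(ℝ, E) 𝓘(ℝ, F) f x)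
    (hf' : ∀ᶠ x in 𝓝 b, mfderiv 𝓘(ℝ, E) 𝓘(ℝ, F) f x = 0) : ∀ᶠ x in 𝓝 b, f x = f b := by
  set χ := extChartAt 𝓘(ℝ, E) b with hχ
  have hc : ContinuousAt f b := hf.self_of_nhds.continuousAt
  have h1 : ∀ᶠ x in 𝓝 b, f x ∈ (chartAt F (f b)).source :=
    hc.eventually_mem (chart_source_mem_nhds F (f b))
  have h2 := (hf.and hf').and h1
  have h3 : Tendsto χ.symm (𝓝 (χ b)) (𝓝 b) := by
    have := continuousAt_extChartAt_symm (I := 𝓘(ℝ, E)) b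
    rw [ContinuousAt, extChartAt_to_inv] at this
    exact this
  have h4 := (h3.eventually h2).and (extChartAt_target_mem_nhds (I := 𝓘(ℝ, E)) b)
  obtain ⟨ε, hε, hball⟩ := Metric.eventually_nhds_iff_ball.1 h4
  have hcχ : ContinuousAt χ b := continuousAt_extChartAt b
  filter_upwards [hcχ.eventually_mem (Metric.ball_mem_nhds _ hε),
    extChartAt_source_mem_nhds (I := 𝓘(ℝ, E)) b] with x hx hxs
  have := (convex_ball (χ b) ε).eq_of_hasMFDerivWithinAt_zero (f := f ∘ χ.symm) (y₀ := f b)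
    (fun y hy => (hball y hy).1.2) (fun y hy => ?_) hx (Metric.mem_ball_self hε)
  · simp only [Function.comp_apply] at this
    rwa [χ.left_inv hxs, extChartAt_to_inv] at this
  · obtain ⟨⟨⟨h5, h6⟩, -⟩, h7⟩ := hball y hy
    have h8 : MDifferentiableAt 𝓘(ℝ, E) 𝓘(ℝ, E) χ.symm y :=
      ((contMDiffOn_extChartAt_symm (I := 𝓘(ℝ, E)) (n := ∞) b).contMDiffAt
        ((isOpen_extChartAt_target b).mem_nhds h7)).mdifferentiableAt (by simp)
    have h9 := h5.hasMFDerivAt.comp y h8.hasMFDerivAt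
    rw [h6, ContinuousLinearMap.zero_comp] at h9
    exact h9.hasMFDerivWithinAt

end LocallyConstant

/-! ### Trivializations by horizontal sections -/

section HorizontalSections

set_option linter.unusedSectionVars false

open Filter
open scoped Topology

variable {E F : Type*} [NormedAddCommGroup E] [NormedSpace ℝ E]
  [NormedAddCommGroup F] [NormedSpace ℝ F]
  {B : Type*} [TopologicalSpace B] [ChartedSpace E B]
  {G : Type*} [TopologicalSpace G] [ChartedSpace F G] [Group G] [LieGroup 𝓘(ℝ, F) ∞ G]
  {P : PrincipalBundle E F B G} {A : Connection P}
  {V H : Type*} [NormedAddCommGroup V] [NormedSpace ℝ V] [TopologicalSpace H]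
  {I : ModelWithCorners ℝ V H} {M : Type*} [TopologicalSpace M] [ChartedSpace H M]

namespace FlatBundle.Connection

theorem modelForm_congr (A : Connection P) {f f' : M → P.Total} {s : Set M} {x : M}
    (h : f =ᶠ[𝓝[s] x] f') (hx : f x = f' x) (v : TangentSpace I x) :
    A.modelForm (f x) (mfderivWithin I (prodModel E F) f s x v) =
      A.modelForm (f' x) (mfderivWithin I (prodModel E F) f' s x v) := by
  have h2 : ∀ q q' : P.Total, q = q' → ∀ u : E × F, A.modelForm q u = A.modelForm q' u := by
    rintro q _ rfl u
    rfl
  exact (h2 _ _ hx _).trans (congrArg (fun u : E × F => A.modelForm (f' x) u)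
    (DFunLike.congr_fun (h.mfderivWithin_eq hx) v))

namespace HorizontalSection

variable (S : HorizontalSection A)

theorem exists_coord {p : P.Total} (hp : P.proj p ∈ S.dom) :
    ∃ g, P.act (S.sec (P.proj p)) g = p :=
  P.exists_act_eq (S.proj_sec _ hp)

open Classical in
/-- The coordinate of a point in the trivialization defined by a section. -/
noncomputable def coord (p : P.Total) : G :=
  if hp : P.proj p ∈ S.dom then (S.exists_coord hp).choose else 1

theorem act_coord {p : P.Total} (hp : P.proj p ∈ S.dom) :
    P.act (S.sec (P.proj p)) (S.coord p) = p := by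
  unfold coord
  rw [dif_pos hp]
  exact (S.exists_coord hp).choose_spec

theorem coord_act {b : B} (hb : b ∈ S.dom) (g : G) : S.coord (P.act (S.sec b) g) = g := by
  have h : P.proj (P.act (S.sec b) g) = b := by rw [P.proj_act, S.proj_sec b hb]
  have h1 := S.act_coord (p := P.act (S.sec b) g) (by rw [h]; exact hb)
  rw [h] at h1
  exact P.act_injective _ h1

theorem coord_act_right {p : P.Total} (hp : P.proj p ∈ S.dom) (g : G) :
    S.coord (P.act p g) = S.coord p * g := by
  conv_lhs => rw [← S.act_coord hp, ← P.act_mul]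
  exact S.coord_act hp _

theorem contMDiffAt_sec {b : B} (hb : b ∈ S.dom) :
    ContMDiffAt 𝓘(ℝ, E) (prodModel E F) ∞ S.sec b :=
  S.contMDiffOn.contMDiffAt (S.isOpen_dom.mem_nhds hb)

/-- The coordinate is defined by choice, but the action is free, so it agrees locally with a
quotient of the second components in any smooth local trivialization. -/
theorem contMDiffAt_coord {p : P.Total} (hp : P.proj p ∈ S.dom) :
    ContMDiffAt (prodModel E F) 𝓘(ℝ, F) ∞ S.coord p := by
  obtain ⟨T, hT⟩ := P.exists_localTriv (P.proj p)
  have h1 : ContMDiffAt (prodModel E F) (prodModel E F) ∞ (fun q => S.sec (P.proj q)) p :=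
    (S.contMDiffAt_sec hp).comp p P.contMDiff_proj.contMDiffAt
  have hT1 : ∀ q, P.proj q ∈ T.dom → ContMDiffAt (prodModel E F) (prodModel E F) ∞ T.map q :=
    fun q hq => T.contMDiffOn.contMDiffAt (T.map.open_source.mem_nhds (T.mem_source.2 hq))
  have h2 : ContMDiffAt (prodModel E F) 𝓘(ℝ, F) ∞ (fun q => T.div (S.sec (P.proj q)) q) p := by
    have h3 : ContMDiffAt (prodModel E F) 𝓘(ℝ, F) ∞ (fun q => (T.map (S.sec (P.proj q))).2) p :=
      contMDiffAt_snd.comp p (ContMDiffAt.comp p (hT1 _ (by rwa [S.proj_sec _ hp])) h1)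
    have h4 : ContMDiffAt (prodModel E F) 𝓘(ℝ, F) ∞ (fun q => (T.map q).2) p :=
      contMDiffAt_snd.comp p (hT1 p hT)
    exact h3.inv.mul h4
  refine h2.congr_of_eventuallyEq ?_
  have hc : ContinuousAt P.proj p := P.contMDiff_proj.continuous.continuousAt
  filter_upwards [hc.eventually_mem (S.isOpen_dom.mem_nhds hp),
    hc.eventually_mem (T.isOpen_dom.mem_nhds hT)] with q hq hq'
  apply P.act_injective (S.sec (P.proj q))
  rw [S.act_coord hq, T.act_div (by rwa [S.proj_sec _ hq]) (S.proj_sec _ hq)]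

/-- In the trivialization defined by a horizontal section, the connection form is the
Maurer-Cartan form. -/
theorem form_eq {p : P.Total} (hp : P.proj p ∈ S.dom) (v : TangentSpace (prodModel E F) p) :
    A.modelForm p v = mcForm F (S.coord p) (mfderiv (prodModel E F) 𝓘(ℝ, F) S.coord p v) := by
  have hsec : MDifferentiableAt 𝓘(ℝ, E) (prodModel E F) S.sec (P.proj p) :=
    (S.contMDiffAt_sec hp).mdifferentiableAt (by simp)
  have hproj : MDifferentiableAt (prodModel E F) 𝓘(ℝ, E) P.proj p :=
    P.contMDiff_proj.mdifferentiable (by simp) p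
  -- Near p the identity is q ↦ s(π q)·coord(q), and s ∘ π is horizontal because s is. The formula
  -- for translates of horizontal maps then computes ω.
  have h1 := A.form_act (s := fun q => S.sec (P.proj q)) (hsec.comp p hproj) (fun v => by
    have h2 := DFunLike.congr_fun (mfderiv_comp p hsec hproj) v
    refine (congrArg (fun u : E × F => A.modelForm (S.sec (P.proj p)) u) h2).trans ?_
    exact S.horizontal _ hp _) ((S.contMDiffAt_coord hp).mdifferentiableAt (by simp)) v
  rw [← h1, ← mfderivWithin_univ]
  have hev : (id : P.Total → P.Total) =ᶠ[𝓝[univ] p]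
      fun q => P.act (S.sec (P.proj q)) (S.coord q) := by
    rw [nhdsWithin_univ]
    filter_upwards [P.contMDiff_proj.continuous.continuousAt.eventually_mem
      (S.isOpen_dom.mem_nhds hp)] with q hq
    exact (S.act_coord hq).symm
  rw [← A.modelForm_congr hev (S.act_coord hp).symm, mfderivWithin_univ, mfderiv_id]
  rfl

/-- The form is the Maurer–Cartan form of the coordinate's derivative, and the Maurer–Cartan form is
injective. Every local constancy statement below rests on this. -/
theorem mfderiv_coord_comp_eq_zero {f : M → P.Total} {s : Set M} {x : M} {p : P.Total}
    (hfx : f x = p) (hp : P.proj p ∈ S.dom)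
    {v : TangentSpace I x}
    (hv : A.modelForm (f x) (mfderivWithin I (prodModel E F) f s x v) = 0) :
    mfderiv (prodModel E F) 𝓘(ℝ, F) S.coord (f x)
      (mfderivWithin I (prodModel E F) f s x v) = 0 := by
  subst hfx
  rw [S.form_eq hp] at hv
  exact mcForm_injective _ _ hv

/-- Two horizontal sections differ by a locally constant element of the group. -/
theorem eventually_coord_sec_eq [IsManifold 𝓘(ℝ, E) ∞ B] (S' : HorizontalSection A) {b : B}
    (hb : b ∈ S.dom) (hb' : b ∈ S'.dom) :
    ∀ᶠ x in 𝓝 b, S'.coord (S.sec x) = S'.coord (S.sec b) := by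
  have hev : ∀ᶠ x in 𝓝 b, x ∈ S.dom ∧ x ∈ S'.dom :=
    inter_mem (S.isOpen_dom.mem_nhds hb) (S'.isOpen_dom.mem_nhds hb')
  have hd : ∀ x, x ∈ S.dom ∧ x ∈ S'.dom →
      MDifferentiableAt (prodModel E F) 𝓘(ℝ, F) S'.coord (S.sec x) := fun x hx =>
    (S'.contMDiffAt_coord (by rw [S.proj_sec x hx.1]; exact hx.2)).mdifferentiableAt (by simp)
  have hs : ∀ x, x ∈ S.dom ∧ x ∈ S'.dom → MDifferentiableAt 𝓘(ℝ, E) (prodModel E F) S.sec x :=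
    fun x hx => (S.contMDiffAt_sec hx.1).mdifferentiableAt (by simp)
  refine eventually_eq_of_mfderiv_eq_zero (E := E) (F := F) (f := fun x => S'.coord (S.sec x))
    ?_ ?_
  · filter_upwards [hev] with x hx
    exact (hd x hx).comp x (hs x hx)
  · filter_upwards [hev] with x hx
    have h1 := mfderiv_comp x (hd x hx) (hs x hx)
    refine h1.trans ?_
    ext v
    have h2 := S.horizontal x hx.1 v
    rw [← mfderivWithin_univ] at h2
    have h3 := S'.mfderiv_coord_comp_eq_zero rfl (by rw [S.proj_sec x hx.1]; exact hx.2) h2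
    rw [mfderivWithin_univ] at h3
    exact h3

/-- Maps that are constant in the trivialization defined by a horizontal section are smooth. -/
theorem contMDiffWithinAt_of_eventuallyEq {f : M → P.Total} {s : Set M} {x : M} {g : G}
    (hx : x ∈ s) (hfx : P.proj (f x) ∈ S.dom)
    (hf : ∀ᶠ y in 𝓝[s] x, f y = P.act (S.sec (P.proj (f y))) g)
    (hπ : ContMDiffWithinAt I 𝓘(ℝ, E) ∞ (fun y => P.proj (f y)) s x) :
    ContMDiffWithinAt I (prodModel E F) ∞ f s x := by
  have h1 : ContMDiffWithinAt I (prodModel E F) ∞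
      (fun y => P.act (S.sec (P.proj (f y))) g) s x :=
    (P.contMDiff_act_right g).contMDiffAt.comp_contMDiffWithinAt x
      ((S.contMDiffAt_sec hfx).comp_contMDiffWithinAt x hπ)
  exact h1.congr_of_eventuallyEq hf (hf.self_of_nhdsWithin hx)

/-- Maps that are constant in the trivialization defined by a horizontal section are
horizontal. -/
theorem form_eq_zero_of_eventuallyEq {f : M → P.Total} {s : Set M} {x : M} {g : G}
    (hs : UniqueMDiffWithinAt I s x)
    (hx : x ∈ s) (hfx : P.proj (f x) ∈ S.dom)
    (hf : ∀ᶠ y in 𝓝[s] x, f y = P.act (S.sec (P.proj (f y))) g)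
    (hπ : ContMDiffWithinAt I 𝓘(ℝ, E) ∞ (fun y => P.proj (f y)) s x) (v : TangentSpace I x) :
    A.modelForm (f x) (mfderivWithin I (prodModel E F) f s x v) = 0 := by
  have hsec := (S.contMDiffAt_sec hfx).mdifferentiableAt (n := ∞) (by simp)
  rw [A.modelForm_congr hf (hf.self_of_nhdsWithin hx)]
  have hsg : MDifferentiableAt 𝓘(ℝ, E) (prodModel E F) (fun b => P.act (S.sec b) g)
      (P.proj (f x)) :=
    ((P.contMDiff_act_right g).mdifferentiable (by simp) _).comp _ hsec
  have h1 := DFunLike.congr_fun (mfderivWithin_comp_of_eq (x := x) (s := s)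
    (g := fun b => P.act (S.sec b) g) (f := fun y => P.proj (f y)) (u := univ)
    hsg.mdifferentiableWithinAt (hπ.mdifferentiableWithinAt (by simp)) (fun _ _ => mem_univ _) hs
    rfl) v
  refine (congrArg (fun u : E × F => A.modelForm (P.act (S.sec (P.proj (f x))) g) u) h1).trans ?_
  have h2 := A.form_act hsec (S.horizontal _ hfx)
    (mdifferentiableAt_const (c := g)) (mfderivWithin I 𝓘(ℝ, E) (fun y => P.proj (f y)) s x v)
  rw [mfderiv_const] at h2
  rw [mfderivWithin_univ]
  exact h2.trans (map_zero _)

/-- Smooth horizontal paths are constant in the trivialization defined by a horizontal section. -/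
theorem eventually_coord_eq {c : ℝ → P.Total} {a b : ℝ}
    (hc : ContMDiffOn 𝓘(ℝ, ℝ) (prodModel E F) ∞ c (Icc a b))
    (hc0 : ∀ t ∈ Icc a b, A.modelForm (c t)
      (mfderivWithin 𝓘(ℝ, ℝ) (prodModel E F) c (Icc a b) t (1 : ℝ)) = 0)
    {t₀ : ℝ} (ht₀ : t₀ ∈ Icc a b) (hdom : P.proj (c t₀) ∈ S.dom) :
    ∀ᶠ t in 𝓝[Icc a b] t₀, S.coord (c t) = S.coord (c t₀) := by
  have hcont : ContinuousWithinAt c (Icc a b) t₀ := (hc t₀ ht₀).continuousWithinAt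
  have h1 : ∀ᶠ t in 𝓝[Icc a b] t₀, P.proj (c t) ∈ S.dom :=
    (P.contMDiff_proj.continuous.continuousAt.comp_continuousWithinAt hcont).eventually_mem
      (S.isOpen_dom.mem_nhds hdom)
  have h2 : ∀ᶠ t in 𝓝[Icc a b] t₀, S.coord (c t) ∈ (chartAt F (S.coord (c t₀))).source :=
    ((S.contMDiffAt_coord hdom).continuousAt.comp_continuousWithinAt hcont).eventually_mem
      (chart_source_mem_nhds F _)
  obtain ⟨ε, hε, hball⟩ := Metric.mem_nhdsWithin_iff.1 (h1.and h2)
  have hmem : Metric.ball t₀ ε ∩ Icc a b ∈ 𝓝[Icc a b] t₀ :=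
    inter_mem (mem_nhdsWithin_of_mem_nhds (Metric.ball_mem_nhds _ hε)) self_mem_nhdsWithin
  -- At an endpoint the ball leaves the interval; the intersection is still convex, and derivatives
  -- within the interval restrict to it.
  have hconv : Convex ℝ (Metric.ball t₀ ε ∩ Icc a b) := (convex_ball _ _).inter (convex_Icc _ _)
  filter_upwards [hmem] with t ht
  refine hconv.eq_of_hasMFDerivWithinAt_zero (f := fun t => S.coord (c t))
    (y₀ := S.coord (c t₀)) (fun x hx => (hball hx).2) (fun x hx => ?_) ht
    ⟨Metric.mem_ball_self hε, ht₀⟩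
  have h3 := ((S.contMDiffAt_coord (hball hx).1).mdifferentiableAt (n := ∞) (by simp)).hasMFDerivAt
  have h4 := ((hc x hx.2).mdifferentiableWithinAt (by simp)).hasMFDerivWithinAt
  have h5 := h3.comp_hasMFDerivWithinAt x h4
  have h6 := S.mfderiv_coord_comp_eq_zero rfl (hball hx).1 (hc0 x hx.2)
  have h7 : (mfderiv (prodModel E F) 𝓘(ℝ, F) S.coord (c x)).comp
      (mfderivWithin 𝓘(ℝ, ℝ) (prodModel E F) c (Icc a b) x) = 0 :=
    ContinuousLinearMap.ext_ring h6
  rw [h7] at h5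
  exact h5.mono inter_subset_right

end HorizontalSection

end FlatBundle.Connection

end HorizontalSections

/-! ### Covering spaces from sheets with locally constant transitions -/

section SheetAtlas

set_option linter.checkUnivs false

open Filter
open scoped Topology

/-- A family of bijections from the preimages of the sets of an open cover of `B` under a map
`proj : X → B` to products, with locally constant transition maps. -/
structure SheetAtlas (X B : Type*) [TopologicalSpace B] where
  /-- The projection. -/
  proj : X → B
  /-- The index set of the cover. -/
  Index : Type*
  /-- The fibres. -/
  Fiber : Index → Type*
  /-- The sets of the cover. -/
  dom : Index → Set B
  /-- The fibre coordinates. -/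
  coord : ∀ i, X → Fiber i
  /-- The inverse trivializations. -/
  sec : ∀ i, B → Fiber i → X
  isOpen_dom : ∀ i, IsOpen (dom i)
  exists_mem_dom : ∀ b, ∃ i, b ∈ dom i
  proj_sec : ∀ i, ∀ b ∈ dom i, ∀ a, proj (sec i b a) = b
  coord_sec : ∀ i, ∀ b ∈ dom i, ∀ a, coord i (sec i b a) = a
  sec_coord : ∀ i x, proj x ∈ dom i → sec i (proj x) (coord i x) = x
  eventually_coord_sec : ∀ i j, ∀ b ∈ dom i ∩ dom j, ∀ a,
    ∀ᶠ b' in 𝓝 b, coord j (sec i b' a) = coord j (sec i b a)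

namespace SheetAtlas

variable {X B : Type*} [TopologicalSpace B] (𝒜 : SheetAtlas X B)

/-- The total space with the topology whose sheets are open. -/
def Sheets (_ : SheetAtlas X B) : Type _ := X

/-- The final topology for the sheets: a set is open when every sheet meets it in an open subset of
the base. `Sheets` is a type synonym so that this does not clash with a topology already present on
X, such as that of P. -/
instance : TopologicalSpace 𝒜.Sheets where
  IsOpen s := ∀ i a, IsOpen {b | b ∈ 𝒜.dom i ∧ 𝒜.sec i b a ∈ s}
  isOpen_univ i a := by
    convert 𝒜.isOpen_dom i using 1
    ext b
    exact and_iff_left (mem_univ _)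
  isOpen_inter s t hs ht i a := by
    convert (hs i a).inter (ht i a) using 1
    ext b
    constructor
    · rintro ⟨h1, h2, h3⟩
      exact ⟨⟨h1, h2⟩, h1, h3⟩
    · rintro ⟨⟨h1, h2⟩, -, h3⟩
      exact ⟨h1, h2, h3⟩
  isOpen_sUnion S hS i a := by
    have : {b | b ∈ 𝒜.dom i ∧ 𝒜.sec i b a ∈ ⋃₀ S} =
        ⋃ s ∈ S, {b | b ∈ 𝒜.dom i ∧ 𝒜.sec i b a ∈ s} := by
      ext b
      simp only [mem_iUnion, exists_prop]
      constructor
      · rintro ⟨h1, s, hs, h2⟩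
        exact ⟨s, hs, h1, h2⟩
      · rintro ⟨s, hs, h1, h2⟩
        exact ⟨h1, s, hs, h2⟩
    rw [this]
    exact isOpen_biUnion fun s hs => hS s hs i a

/-- The projection of the total space with the sheet topology. -/
def sheetProj : 𝒜.Sheets → B := 𝒜.proj

/-- A sheet. -/
def sheetSec (i : 𝒜.Index) (a : 𝒜.Fiber i) (b : B) : 𝒜.Sheets := 𝒜.sec i b a

/-- The fibre coordinate on the total space with the sheet topology. -/
def sheetCoord (i : 𝒜.Index) : 𝒜.Sheets → 𝒜.Fiber i := 𝒜.coord i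

theorem continuousOn_sheetSec (i : 𝒜.Index) (a : 𝒜.Fiber i) :
    ContinuousOn (𝒜.sheetSec i a) (𝒜.dom i) := by
  rw [continuousOn_open_iff (𝒜.isOpen_dom i)]
  exact fun s hs => hs i a

theorem continuous_sheetProj : Continuous 𝒜.sheetProj := by
  rw [continuous_def]
  intro V hV i a
  convert (𝒜.isOpen_dom i).inter hV using 1
  ext b
  refine and_congr_right fun hb => ?_
  change 𝒜.proj (𝒜.sec i b a) ∈ V ↔ _
  rw [𝒜.proj_sec i b hb]

/-- Seen from another sheet, membership in this one is a condition on the transition map, which is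
locally constant. Without that hypothesis sheets need not be open. -/
theorem isOpen_sheet (i : 𝒜.Index) (a : 𝒜.Fiber i) {V : Set B} (hV : IsOpen V) :
    IsOpen {x : 𝒜.Sheets | (𝒜.sheetProj x ∈ 𝒜.dom i ∧ 𝒜.sheetProj x ∈ V) ∧
      𝒜.sheetCoord i x = a} := by
  intro j a'
  rw [isOpen_iff_mem_nhds]
  rintro b ⟨hbj, ⟨hbi, hbV⟩, hba⟩
  change 𝒜.proj (𝒜.sec j b a') ∈ _ at hbi
  change 𝒜.proj (𝒜.sec j b a') ∈ _ at hbV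
  change 𝒜.coord i (𝒜.sec j b a') = a at hba
  rw [𝒜.proj_sec j b hbj] at hbi hbV
  filter_upwards [(𝒜.isOpen_dom j).mem_nhds hbj, (𝒜.isOpen_dom i).mem_nhds hbi, hV.mem_nhds hbV,
    𝒜.eventually_coord_sec j i b ⟨hbj, hbi⟩ a'] with b' h1 h2 h3 h4
  refine ⟨h1, ?_, h4.trans hba⟩
  change 𝒜.proj (𝒜.sec j b' a') ∈ _ ∧ 𝒜.proj (𝒜.sec j b' a') ∈ _
  rw [𝒜.proj_sec j b' h1]
  exact ⟨h2, h3⟩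

theorem eventually_sheetCoord_eq {i : 𝒜.Index} {x : 𝒜.Sheets} (hx : 𝒜.sheetProj x ∈ 𝒜.dom i) :
    ∀ᶠ y in 𝓝 x, 𝒜.sheetCoord i y = 𝒜.sheetCoord i x := by
  filter_upwards [(𝒜.isOpen_sheet i (𝒜.sheetCoord i x) isOpen_univ).mem_nhds
    ⟨⟨hx, mem_univ _⟩, rfl⟩] with y hy
  exact hy.2

/-- The projection of the total space with the sheet topology is a covering map. -/
theorem isCoveringMap : IsCoveringMap 𝒜.sheetProj := by
  choose idx hidx using 𝒜.exists_mem_dom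
  -- The fibres are taken discrete, even when, as for the leaves of a flat bundle, they are the Lie
  -- group G.
  let _ : ∀ b, TopologicalSpace (𝒜.Fiber (idx b)) := fun _ => ⊥
  have _ : ∀ b, DiscreteTopology (𝒜.Fiber (idx b)) := fun _ => ⟨rfl⟩
  refine IsCoveringMap.mk 𝒜.sheetProj (fun b => 𝒜.Fiber (idx b)) (fun b =>
    { toFun := fun x => (𝒜.sheetProj x, 𝒜.sheetCoord (idx b) x)
      invFun := fun z => 𝒜.sheetSec (idx b) z.2 z.1
      source := 𝒜.sheetProj ⁻¹' 𝒜.dom (idx b)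
      target := 𝒜.dom (idx b) ×ˢ univ
      map_source' := fun x hx => ⟨hx, mem_univ _⟩
      map_target' := fun z hz => ?_
      left_inv' := fun x hx => 𝒜.sec_coord _ x hx
      right_inv' := fun z hz => Prod.ext (𝒜.proj_sec _ _ hz.1 _) (𝒜.coord_sec _ _ hz.1 _)
      open_source := (𝒜.isOpen_dom _).preimage 𝒜.continuous_sheetProj
      open_target := (𝒜.isOpen_dom _).prod isOpen_univ
      continuousOn_toFun := ?_
      continuousOn_invFun := ?_
      baseSet := 𝒜.dom (idx b)
      open_baseSet := 𝒜.isOpen_dom _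
      source_eq := rfl
      target_eq := rfl
      proj_toFun := fun _ _ => rfl }) hidx
  · change 𝒜.proj (𝒜.sec (idx b) z.1 z.2) ∈ 𝒜.dom (idx b)
    rw [𝒜.proj_sec _ _ hz.1]
    exact hz.1
  · refine 𝒜.continuous_sheetProj.continuousOn.prodMk fun x hx => ?_
    exact (continuousAt_const.congr (EventuallyEq.symm
      (𝒜.eventually_sheetCoord_eq hx))).continuousWithinAt
  · rintro ⟨b', a⟩ hz
    refine ContinuousAt.continuousWithinAt ?_
    have h1 : ∀ᶠ z in 𝓝 (b', a), z.2 = a :=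
      continuous_snd.continuousAt.eventually_mem ((isOpen_discrete {a}).mem_nhds (mem_singleton a))
    have h2 : ContinuousAt (fun z : B × 𝒜.Fiber (idx b) => 𝒜.sheetSec (idx b) a z.1) (b', a) :=
      ContinuousAt.comp (g := 𝒜.sheetSec (idx b) a)
        ((𝒜.continuousOn_sheetSec _ a).continuousAt ((𝒜.isOpen_dom _).mem_nhds hz.1))
        continuous_fst.continuousAt
    refine h2.congr ?_
    filter_upwards [h1] with z hz
    rw [hz]

/-- Near the point, f is its projection to the base followed by one fixed continuous sheet. -/
theorem continuousWithinAt_of_eventually_eq {Y : Type*} [TopologicalSpace Y] {f : Y → 𝒜.Sheets}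
    {s : Set Y} {y : Y} (hy : y ∈ s) {i : 𝒜.Index} (hi : 𝒜.sheetProj (f y) ∈ 𝒜.dom i)
    (hf : ContinuousWithinAt (fun z => 𝒜.sheetProj (f z)) s y)
    (hc : ∀ᶠ z in 𝓝[s] y, 𝒜.sheetCoord i (f z) = 𝒜.sheetCoord i (f y)) :
    ContinuousWithinAt f s y := by
  have h1 : ContinuousWithinAt
      (fun z => 𝒜.sheetSec i (𝒜.sheetCoord i (f y)) (𝒜.sheetProj (f z))) s y :=
    ContinuousAt.comp_continuousWithinAt (g := 𝒜.sheetSec i (𝒜.sheetCoord i (f y)))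
      ((𝒜.continuousOn_sheetSec _ _).continuousAt ((𝒜.isOpen_dom _).mem_nhds hi)) hf
  refine h1.congr_of_eventuallyEq_of_mem ?_ hy
  filter_upwards [hc, hf.eventually_mem ((𝒜.isOpen_dom i).mem_nhds hi)] with z hz hz'
  rw [← hz]
  exact (𝒜.sec_coord i (f z) hz').symm

end SheetAtlas

end SheetAtlas

/-! ### Homotopy classes of paths in simply connected sets -/

section PathClasses

open Filter
open scoped Topology unitInterval

variable {X : Type*} [TopologicalSpace X] {W : Set X} {x y z : X}

theorem IsSimplyConnected.homotopic_of_mem (hW : IsSimplyConnected W) {δ δ' : Path x y}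
    (h : ∀ t, δ t ∈ W) (h' : ∀ t, δ' t ∈ W) : δ.Homotopic δ' := by
  have := hW.simplyConnectedSpace
  have hx : x ∈ W := δ.source ▸ h 0
  have hy : y ∈ W := δ.target ▸ h 1
  let ε : Path (⟨x, hx⟩ : W) ⟨y, hy⟩ :=
    ⟨⟨fun t => ⟨δ t, h t⟩, by fun_prop⟩, Subtype.ext δ.source, Subtype.ext δ.target⟩
  let ε' : Path (⟨x, hx⟩ : W) ⟨y, hy⟩ :=
    ⟨⟨fun t => ⟨δ' t, h' t⟩, by fun_prop⟩, Subtype.ext δ'.source, Subtype.ext δ'.target⟩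
  exact (SimplyConnectedSpace.paths_homotopic ε ε').map ⟨Subtype.val, continuous_subtype_val⟩

open Classical in
/-- The homotopy class of a path from `x` to `y` that stays inside `W` if possible. -/
noncomputable def pathClassIn [PathConnectedSpace X] (W : Set X) (x y : X) :
    Path.Homotopic.Quotient x y :=
  if h : JoinedIn W x y then .mk h.somePath else .mk (PathConnectedSpace.somePath x y)

/-- Both sides are represented by paths inside W with the same endpoints, and such paths are
homotopic. -/
theorem IsSimplyConnected.pathClassIn_trans [PathConnectedSpace X] (hW : IsSimplyConnected W)
    (hx : x ∈ W) (δ : Path y z) (hδ : ∀ t, δ t ∈ W) :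
    (pathClassIn W x y).trans (.mk δ) = pathClassIn W x z := by
  have h1 : JoinedIn W x y := hW.isPathConnected.joinedIn _ hx _ (δ.source ▸ hδ 0)
  have h2 : JoinedIn W x z := hW.isPathConnected.joinedIn _ hx _ (δ.target ▸ hδ 1)
  rw [pathClassIn, pathClassIn, dif_pos h1, dif_pos h2, ← Path.Homotopic.Quotient.mk_trans,
    Path.Homotopic.Quotient.eq]
  refine hW.homotopic_of_mem (fun t => ?_) h2.somePath_mem
  have : (h1.somePath.trans δ) t ∈ range (h1.somePath.trans δ) := mem_range_self t
  rw [Path.trans_range] at this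
  rcases this with ⟨s, hs⟩ | ⟨s, hs⟩
  · exact hs ▸ h1.somePath_mem s
  · exact hs ▸ hδ s

theorem IsSimplyConnected.trans_pathClassIn_symm [PathConnectedSpace X] (hW : IsSimplyConnected W)
    (hx : x ∈ W) (δ : Path y z) (hδ : ∀ t, δ t ∈ W) :
    Path.Homotopic.Quotient.trans (.mk δ) (pathClassIn W x z).symm = (pathClassIn W x y).symm := by
  rw [← hW.pathClassIn_trans hx δ hδ]
  generalize pathClassIn W x y = q
  induction q using Path.Homotopic.Quotient.ind with | mk γ =>
  rw [← Path.Homotopic.Quotient.mk_trans, ← Path.Homotopic.Quotient.mk_symm, Path.trans_symm,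
    Path.Homotopic.Quotient.mk_trans,
    ← Path.Homotopic.Quotient.trans_assoc, Path.Homotopic.Quotient.mk_symm,
    Path.Homotopic.Quotient.trans_symm, Path.Homotopic.Quotient.refl_trans,
    Path.Homotopic.Quotient.mk_symm]

/-- A loop at another point is conjugated to the given base point by a connecting path, so one base
point suffices. -/
theorem simplyConnectedSpace_of_loops_nullhomotopic [PathConnectedSpace X] (x : X)
    (h : ∀ γ : Path x x, γ.Homotopic (Path.refl x)) : SimplyConnectedSpace X := by
  rw [simply_connected_iff_loops_nullhomotopic]
  refine ⟨inferInstance, fun y γ => ?_⟩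
  let p := PathConnectedSpace.somePath x y
  have h1 := Path.Homotopic.Quotient.eq.2 (h ((p.trans γ).trans p.symm))
  rw [← Path.Homotopic.Quotient.eq]
  simp only [Path.Homotopic.Quotient.mk_trans, Path.Homotopic.Quotient.mk_symm,
    Path.Homotopic.Quotient.mk_refl] at h1 ⊢
  have h2 := congrArg (fun q =>
    ((Path.Homotopic.Quotient.mk p).symm.trans q).trans (Path.Homotopic.Quotient.mk p)) h1
  simpa [Path.Homotopic.Quotient.trans_assoc,
    ← Path.Homotopic.Quotient.trans_assoc (Path.Homotopic.Quotient.mk p).symm] using h2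

end PathClasses

/-! ### The simply connected covering space of path classes -/

section UniversalCovering

open Filter
open scoped Topology unitInterval

set_option linter.unusedSectionVars false

variable {X : Type u} [TopologicalSpace X] [PathConnectedSpace X] (x₀ : X)

/-- The space of homotopy classes of paths that start at `x₀`, with the sheets over the sets of a
cover by simply connected sets. -/
noncomputable def pathClassAtlas {W : X → Set X} (hW : ∀ x, IsOpen (W x)) (hxW : ∀ x, x ∈ W x)
    (hsc : ∀ x, IsSimplyConnected (W x))
    (hX : ∀ x : X, ∀ U ∈ 𝓝 x, ∃ W ⊆ U, IsOpen W ∧ x ∈ W ∧ IsSimplyConnected W) :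
    SheetAtlas (Σ x : X, Path.Homotopic.Quotient x₀ x) X where
  proj := Sigma.fst
  Index := X
  Fiber i := Path.Homotopic.Quotient x₀ i
  dom := W
  coord i z := z.2.trans (pathClassIn (W i) i z.1).symm
  sec i x a := ⟨x, a.trans (pathClassIn (W i) i x)⟩
  isOpen_dom := hW
  exists_mem_dom x := ⟨x, hxW x⟩
  proj_sec _ _ _ _ := rfl
  coord_sec i x _ a := by simp [Path.Homotopic.Quotient.trans_assoc]
  sec_coord i z _ := by simp [Path.Homotopic.Quotient.trans_assoc]
  -- The transition map multiplies a by the class of a path in W i to x followed by a path back in W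
  -- j. Moving x to y along δ inside both sets inserts δ and its reverse, which cancel.
  eventually_coord_sec i j x hx a := by
    obtain ⟨V, hV, hVo, hxV, hVsc⟩ := hX x _ (((hW i).inter (hW j)).mem_nhds hx)
    filter_upwards [hVo.mem_nhds hxV] with y hy
    obtain ⟨δ, hδ⟩ := hVsc.isPathConnected.joinedIn x hxV y hy
    rw [← (hsc i).pathClassIn_trans (hxW i) δ fun t => (hV (hδ t)).1,
      ← (hsc j).trans_pathClassIn_symm (hxW j) δ fun t => (hV (hδ t)).2]
    simp only [Path.Homotopic.Quotient.trans_assoc]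

variable {x₀} in
/-- The classes of the initial segments of a path. -/
noncomputable def initialClass {x : X} (γ : Path x₀ x) (t : I) :
    Σ x : X, Path.Homotopic.Quotient x₀ x :=
  ⟨γ t, (Path.Homotopic.Quotient.mk (γ.subpath 0 t)).cast γ.source.symm rfl⟩

theorem sigma_cast_eq {x y y' : X} (h : y' = y) (q : Path.Homotopic.Quotient x y) :
    (⟨y', q.cast rfl h⟩ : Σ y : X, Path.Homotopic.Quotient x y) = ⟨y, q⟩ := by
  subst h
  rw [Path.Homotopic.Quotient.cast_rfl_rfl]

theorem initialClass_one {x : X} (γ : Path x₀ x) : initialClass γ 1 = ⟨x, .mk γ⟩ := by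
  rw [initialClass, Path.subpath_zero_one, Path.Homotopic.Quotient.mk_cast,
    Path.Homotopic.Quotient.cast_cast]
  exact sigma_cast_eq γ.target _

theorem initialClass_zero {x : X} (γ : Path x₀ x) : initialClass γ 0 = ⟨x₀, .refl x₀⟩ := by
  rw [initialClass, Path.subpath_self]
  have : ∀ y (h : x₀ = y), (⟨y, (Path.Homotopic.Quotient.mk (Path.refl y)).cast h rfl⟩ :
      Σ x : X, Path.Homotopic.Quotient x₀ x) =
      ⟨x₀, .refl x₀⟩ := by
    rintro _ rfl
    rw [Path.Homotopic.Quotient.cast_rfl_rfl, Path.Homotopic.Quotient.mk_refl]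
  exact this _ _

/-- The classes of the initial segments of γ form the lift of γ from the constant class, and this
lift ends at [γ]. Hence every point is joined to the constant class. A loop upstairs is such a lift,
so its projection has trivial class, and covering maps are injective on path classes. -/
theorem exists_simplyConnected_covering
    (hX : ∀ x : X, ∀ U ∈ 𝓝 x, ∃ W ⊆ U, IsOpen W ∧ x ∈ W ∧ IsSimplyConnected W) :
    ∃ 𝒜 : SheetAtlas.{u, u, u, u} (Σ x : X, Path.Homotopic.Quotient x₀ x) X,
      SimplyConnectedSpace 𝒜.Sheets ∧
      ∃ z : 𝒜.Sheets, 𝒜.sheetProj z = x₀ := by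
  choose W _ hW hxW hsc using fun x => hX x univ univ_mem
  let 𝒜 := pathClassAtlas x₀ hW hxW hsc hX
  let L : ∀ {x : X}, Path x₀ x → I → 𝒜.Sheets := fun γ t => initialClass γ t
  have hL : ∀ {x : X} (γ : Path x₀ x), Continuous (L γ) := by
    intro x γ
    rw [continuous_iff_continuousAt]
    intro t
    rw [← continuousWithinAt_univ]
    refine 𝒜.continuousWithinAt_of_eventually_eq (i := γ t) (mem_univ _) (hxW (γ t)) ?_ ?_
    · exact γ.continuous.continuousWithinAt
    rw [nhdsWithin_univ]
    -- For s near t the whole segment of γ between t and s stays in W(γ t). The extra factor in the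
    -- class at s is then absorbed by the path in W, and the sheet coordinate does not change.
    have h1 : Tendsto (fun s => uIcc t s) (𝓝 t) (𝓝 t).smallSets :=
      tendsto_const_nhds.uIcc tendsto_id
    have h2 : γ ⁻¹' W (γ t) ∈ 𝓝 t :=
      γ.continuous.continuousAt.preimage_mem_nhds ((hW _).mem_nhds (hxW _))
    filter_upwards [h1.eventually (eventually_smallSets_subset.2 h2)] with s hs
    have h3 : ∀ r, γ.subpath t s r ∈ W (γ t) := by
      intro r
      have : γ.subpath t s r ∈ range (γ.subpath t s) := mem_range_self r
      rw [Path.range_subpath] at this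
      obtain ⟨r', hr', h⟩ := this
      exact h ▸ hs hr'
    have h4 : Path.Homotopic.Quotient.mk (γ.subpath 0 s) =
        (Path.Homotopic.Quotient.mk (γ.subpath 0 t)).trans (.mk (γ.subpath t s)) := by
      rw [← Path.Homotopic.Quotient.mk_trans, Path.Homotopic.Quotient.eq]
      exact ⟨(Path.Homotopy.subpathTransSubpath γ 0 t s).symm⟩
    have h5 : ∀ (a : X) (ha : x₀ = a) (q : Path.Homotopic.Quotient a (γ t))
        (q' : Path.Homotopic.Quotient (γ t) (γ s)),
        (q.trans q').cast ha rfl = (q.cast ha rfl).trans q' := by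
      rintro _ rfl q q'
      simp
    change ((Path.Homotopic.Quotient.mk (γ.subpath 0 s)).cast _ _).trans
      (pathClassIn (W (γ t)) (γ t) (γ s)).symm =
      ((Path.Homotopic.Quotient.mk (γ.subpath 0 t)).cast _ _).trans
        (pathClassIn (W (γ t)) (γ t) (γ t)).symm
    rw [h4, h5, Path.Homotopic.Quotient.trans_assoc]
    exact congrArg _ ((hsc _).trans_pathClassIn_symm (hxW _) _ h3)
  let z₀ : 𝒜.Sheets := (⟨x₀, .refl x₀⟩ : Σ x : X, Path.Homotopic.Quotient x₀ x)
  have hpc : PathConnectedSpace 𝒜.Sheets := by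
    have hj : ∀ z : 𝒜.Sheets, Joined z₀ z := by
      rintro ⟨x, q⟩
      induction q using Path.Homotopic.Quotient.ind with | mk γ =>
      exact ⟨⟨⟨L γ, hL γ⟩, initialClass_zero x₀ γ, initialClass_one x₀ γ⟩⟩
    exact ⟨⟨z₀⟩, fun z z' => (hj z).symm.trans (hj z')⟩
  refine ⟨𝒜, simplyConnectedSpace_of_loops_nullhomotopic z₀ fun Γ => ?_, z₀, rfl⟩
  have hcov := 𝒜.isCoveringMap
  let γ : Path x₀ x₀ := Γ.map hcov.continuous
  -- Both Γ and the path of initial classes lift γ from z₀, so they have the same endpoint: [γ] is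
  -- the constant class.
  have e1 := (hcov.eq_liftPath_iff (γ := (γ : C(I, X))) (e := z₀) γ.source
    (Γ := L γ)).2 ⟨hL γ, rfl, initialClass_zero x₀ γ⟩
  have e2 := (hcov.eq_liftPath_iff (γ := (γ : C(I, X))) (e := z₀) γ.source
    (Γ := Γ)).2 ⟨Γ.continuous, rfl, Γ.source⟩
  have e3 : L γ 1 = Γ 1 := congrFun (e1.trans e2.symm) 1
  have e4 : Path.Homotopic.Quotient.mk γ = Path.Homotopic.Quotient.refl x₀ :=
    eq_of_heq (Sigma.ext_iff.1 ((initialClass_one x₀ γ).symm.trans (e3.trans Γ.target))).2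
  rw [← Path.Homotopic.Quotient.eq]
  refine hcov.injective_path_homotopic_map z₀ z₀ ?_
  refine Eq.trans ?_ (e4.trans ?_)
  · exact (Path.Homotopic.Quotient.mk_map Γ ⟨_, hcov.continuous⟩).symm
  · exact (Path.Homotopic.Quotient.mk_map (Path.refl z₀) ⟨_, hcov.continuous⟩)

end UniversalCovering

/-! ### Smooth structures on covering spaces -/

section CoveringManifold

open scoped Topology

variable {E : Type*} [NormedAddCommGroup E] [NormedSpace ℝ E]
  {B : Type*} [TopologicalSpace B] [ChartedSpace E B]

/-- A small ball in a chart is contractible. This is the local hypothesis that the path-class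
construction needs. -/
theorem ChartedSpace.exists_isSimplyConnected_subset (E : Type*) [NormedAddCommGroup E]
    [NormedSpace ℝ E] {B : Type*} [TopologicalSpace B] [ChartedSpace E B] (b : B)
    {U : Set B} (hU : U ∈ 𝓝 b) :
    ∃ W ⊆ U, IsOpen W ∧ b ∈ W ∧ IsSimplyConnected W := by
  let φ := chartAt E b
  have hb : b ∈ φ.source := mem_chart_source E b
  have h1 : φ.symm ⁻¹' U ∩ φ.target ∈ 𝓝 (φ b) :=
    Filter.inter_mem ((φ.continuousAt_symm (φ.map_source hb)).preimage_mem_nhds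
      (by rwa [φ.left_inv hb])) (φ.open_target.mem_nhds (φ.map_source hb))
  obtain ⟨r, hr, hball⟩ := Metric.mem_nhds_iff.1 h1
  have hs : Metric.ball (φ b) r ⊆ φ.symm.source := fun z hz => (hball hz).2
  refine ⟨φ.symm '' Metric.ball (φ b) r, ?_,
    φ.symm.isOpen_image_of_subset_source Metric.isOpen_ball hs,
    ⟨φ b, Metric.mem_ball_self hr, φ.left_inv hb⟩, ?_⟩
  · rintro _ ⟨z, hz, rfl⟩
    exact (hball hz).1
  · have hc : ContractibleSpace (Metric.ball (φ b) r) :=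
      (convex_ball (φ b) r).contractibleSpace ⟨_, Metric.mem_ball_self hr⟩
    have : SimplyConnectedSpace (Metric.ball (φ b) r) := inferInstance
    exact (φ.symm.homeomorphOfImageSubsetSource hs rfl).symm.toHomotopyEquiv.simplyConnectedSpace

variable {X : Type*} [TopologicalSpace X] {f : X → B}

/-- The charted space structure on the source of a local homeomorphism. -/
@[reducible] noncomputable def IsLocalHomeomorph.chartedSpaceSource (hf : IsLocalHomeomorph f) :
    ChartedSpace E X where
  atlas := {e | ∃ s : OpenPartialHomeomorph X B, f = s ∧ ∃ c ∈ atlas E B, e = s.trans c}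
  chartAt x := (hf x).choose.trans (chartAt E (f x))
  mem_chart_source x := by
    have h := (hf x).choose_spec
    refine ⟨h.1, ?_⟩
    change (hf x).choose x ∈ (chartAt E (f x)).source
    rw [← h.2]
    exact mem_chart_source E (f x)
  chart_mem_atlas x := ⟨_, (hf x).choose_spec.2, _, chart_mem_atlas E (f x), rfl⟩

/-- Charts upstairs are charts of B after local branches of f. In a transition map the branches
cancel, which leaves a restriction of a transition map of B. -/
theorem IsLocalHomeomorph.isManifold_source [IsManifold 𝓘(ℝ, E) ∞ B] (hf : IsLocalHomeomorph f) :
    letI := hf.chartedSpaceSource (E := E)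
    IsManifold 𝓘(ℝ, E) ∞ X := by
  let _ : ChartedSpace E X := hf.chartedSpaceSource (E := E)
  refine @IsManifold.mk _ _ _ _ _ _ _ _ _ _ _ _ ⟨?_⟩
  rintro _ _ ⟨s, hs, c, hc, rfl⟩ ⟨s', hs', c', hc', rfl⟩
  have h := HasGroupoid.compatible (G := contDiffGroupoid ∞ 𝓘(ℝ, E)) hc hc'
  refine (contDiffGroupoid ∞ 𝓘(ℝ, E)).mem_of_eqOnSource
    (closedUnderRestriction' h ((s.trans c).symm.trans (s'.trans c')).open_source) ?_
  have key : ∀ z ∈ ((s.trans c).symm.trans (s'.trans c')).source,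
      s' (s.symm (c.symm z)) = c.symm z := by
    intro z hz
    simp only [mfld_simps] at hz
    rw [← hs', hs, s.right_inv hz.1.2]
  refine ⟨?_, ?_⟩
  · rw [OpenPartialHomeomorph.restr_source' _ _ (OpenPartialHomeomorph.open_source _)]
    refine (inter_eq_right.2 fun z hz => ?_).symm
    have hk := key z hz
    simp only [mfld_simps] at hz hk ⊢
    refine ⟨hz.1.1, ?_⟩
    rw [← hk]
    exact hz.2.2
  · intro z hz
    have hk := key z hz
    simp only [mfld_simps] at hk ⊢
    rw [hk]

/-- Read in the lifted charts, f is the identity, and so are its local inverses. -/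
theorem IsLocalHomeomorph.isLocalDiffeomorph_source [IsManifold 𝓘(ℝ, E) ∞ B]
    (hf : IsLocalHomeomorph f) :
    letI := hf.chartedSpaceSource (E := E)
    IsLocalDiffeomorph 𝓘(ℝ, E) 𝓘(ℝ, E) ∞ f := by
  let _ : ChartedSpace E X := hf.chartedSpaceSource (E := E)
  have _ := hf.isManifold_source (E := E)
  have hchart : ∀ y z, chartAt E y z = chartAt E (f y) (f z) := by
    intro y z
    change chartAt E (f y) ((hf y).choose z) = _
    rw [← (hf y).choose_spec.2]
  have hsm : ContMDiff 𝓘(ℝ, E) 𝓘(ℝ, E) ∞ f := by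
    intro y
    have h1 : ContMDiffAt 𝓘(ℝ, E) 𝓘(ℝ, E) ∞ (chartAt E y) y :=
      contMDiffOn_chart.contMDiffAt ((chartAt E y).open_source.mem_nhds (mem_chart_source E y))
    have h2 : ContMDiffAt 𝓘(ℝ, E) 𝓘(ℝ, E) ∞ (chartAt E (f y)).symm (chartAt E y y) := by
      rw [hchart]
      exact contMDiffOn_chart_symm.contMDiffAt
        ((chartAt E (f y)).open_target.mem_nhds (mem_chart_target E (f y)))
    refine (h2.comp y h1).congr_of_eventuallyEq ?_
    filter_upwards [hf.continuous.continuousAt.preimage_mem_nhds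
      ((chartAt E (f y)).open_source.mem_nhds (mem_chart_source E (f y)))] with z hz
    rw [Function.comp_apply, hchart]
    exact ((chartAt E (f y)).left_inv hz).symm
  intro x
  obtain ⟨s, hxs, hs⟩ := hf x
  refine ⟨⟨s.toPartialEquiv, s.open_source, s.open_target, ?_, ?_⟩, hxs, fun z _ => congrFun hs z⟩
  · exact hsm.contMDiffOn.congr fun z _ => (congrFun hs z).symm
  · intro z hz
    change ContMDiffWithinAt 𝓘(ℝ, E) 𝓘(ℝ, E) ∞ s.symm s.target z
    apply ContMDiffAt.contMDiffWithinAt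
    set y := s.symm z with hy
    have hfy : f y = z := by rw [hs]; exact s.right_inv hz
    have h1 : ContMDiffAt 𝓘(ℝ, E) 𝓘(ℝ, E) ∞ (chartAt E (f y)) z := by
      rw [hfy]
      exact contMDiffOn_chart.contMDiffAt ((chartAt E z).open_source.mem_nhds (mem_chart_source E z))
    have h2 : ContMDiffAt 𝓘(ℝ, E) 𝓘(ℝ, E) ∞ (chartAt E y).symm (chartAt E (f y) z) := by
      rw [← hfy, ← hchart]
      exact contMDiffOn_chart_symm.contMDiffAt
        ((chartAt E y).open_target.mem_nhds (mem_chart_target E y))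
    refine (h2.comp z h1).congr_of_eventuallyEq ?_
    filter_upwards [(s.continuousAt_symm hz).preimage_mem_nhds
      ((chartAt E y).open_source.mem_nhds (mem_chart_source E y)), s.open_target.mem_nhds hz]
      with w hw hw'
    rw [Function.comp_apply, show chartAt E (f y) w = chartAt E y (s.symm w) by
      rw [hchart, hs, s.right_inv hw']]
    exact ((chartAt E y).left_inv hw).symm

end CoveringManifold

namespace FlatBundle

/-- Every connected smooth manifold has a universal covering. -/
theorem UniversalCover.nonempty {E : Type*} [NormedAddCommGroup E] [NormedSpace ℝ E]
    {B : Type u} [TopologicalSpace B] [ChartedSpace E B] [ConnectedSpace B]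
    [IsManifold 𝓘(ℝ, E) ∞ B] (x₀ : B) : Nonempty (UniversalCover.{u} E x₀) := by
  have : LocallyPathConnectedSpace B := ChartedSpace.locallyPathConnectedSpace E B
  have : PathConnectedSpace B := pathConnectedSpace_iff_connectedSpace.2 inferInstance
  obtain ⟨𝒜, h𝒜, z, hz⟩ := exists_simplyConnected_covering x₀
    fun b U hU => ChartedSpace.exists_isSimplyConnected_subset E b hU
  have hf := 𝒜.isCoveringMap.isLocalHomeomorph
  let _ : ChartedSpace E 𝒜.Sheets := hf.chartedSpaceSource (E := E)
  have _ : IsManifold 𝓘(ℝ, E) ∞ 𝒜.Sheets := hf.isManifold_source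
  exact ⟨{
    Total := 𝒜.Sheets
    proj := 𝒜.sheetProj
    isCoveringMap := 𝒜.isCoveringMap
    isLocalDiffeomorph := hf.isLocalDiffeomorph_source
    base := z
    proj_base := hz }⟩

end FlatBundle

/-! ### Smooth paths in connected manifolds -/

section SmoothPaths

open scoped Topology unitInterval

variable (E : Type*) [NormedAddCommGroup E] [NormedSpace ℝ E]
  {M : Type*} [TopologicalSpace M] [ChartedSpace E M]

/-- The points `x` and `y` are joined by a smooth path that is constant near its endpoints. -/
def SmoothJoined (x y : M) : Prop :=
  ∃ c : ℝ → M, ContMDiff 𝓘(ℝ, ℝ) 𝓘(ℝ, E) ∞ c ∧ (∀ t ≤ 0, c t = x) ∧ ∀ t, 1 ≤ t → c t = y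

variable {E} {x y z : M}

theorem SmoothJoined.symm (h : SmoothJoined E x y) : SmoothJoined E y x := by
  obtain ⟨c, hc, h0, h1⟩ := h
  refine ⟨fun t => c (1 - t), hc.comp ?_, fun t ht => h1 _ (by linarith),
    fun t ht => h0 _ (by linarith)⟩
  exact (contDiff_const.sub contDiff_id).contMDiff

theorem SmoothJoined.trans (h : SmoothJoined E x y) (h' : SmoothJoined E y z) :
    SmoothJoined E x z := by
  obtain ⟨c, hc, h0, h1⟩ := h
  obtain ⟨c', hc', h0', h1'⟩ := h'
  have e1 : ContMDiff 𝓘(ℝ, ℝ) 𝓘(ℝ, E) ∞ fun t : ℝ => c (3 * t) :=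
    hc.comp (contDiff_const.mul contDiff_id).contMDiff
  have e2 : ContMDiff 𝓘(ℝ, ℝ) 𝓘(ℝ, E) ∞ fun t : ℝ => c' (3 * t - 2) :=
    hc'.comp ((contDiff_const.mul contDiff_id).sub contDiff_const).contMDiff
  -- The factor 3 leaves the middle third, on which both pieces are constantly y. The two formulas
  -- agree around the switch at 1/2, so no smoothness is lost.
  refine ⟨fun t => if t ≤ 1 / 2 then c (3 * t) else c' (3 * t - 2), fun t => ?_, fun t ht => ?_,
    fun t ht => ?_⟩
  · rcases lt_or_ge t (2 / 3) with ht | ht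
    · refine (e1 t).congr_of_eventuallyEq ?_
      filter_upwards [Iio_mem_nhds ht] with s hs
      rw [mem_Iio] at hs
      split_ifs with h
      · rfl
      · rw [h1 _ (by linarith), h0' _ (by linarith)]
    · refine (e2 t).congr_of_eventuallyEq ?_
      filter_upwards [Ioi_mem_nhds (show (1 / 2 : ℝ) < t by linarith)] with s hs
      rw [mem_Ioi] at hs
      rw [if_neg (by linarith)]
  · dsimp only
    rw [if_pos (by linarith), h0 _ (by linarith)]
  · dsimp only
    rw [if_neg (by linarith), h1' _ (by linarith)]

/-- A segment in a chart ball, reparametrized by a smooth transition function so that it rests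
outside [0, 1]. -/
theorem SmoothJoined.eventually [IsManifold 𝓘(ℝ, E) ∞ M] (x : M) :
    ∀ᶠ y in 𝓝 x, SmoothJoined E x y := by
  let φ := chartAt E x
  have hx : x ∈ φ.source := mem_chart_source E x
  obtain ⟨r, hr, hball⟩ := Metric.mem_nhds_iff.1 (φ.open_target.mem_nhds (φ.map_source hx))
  filter_upwards [φ.open_source.mem_nhds hx, (φ.continuousAt hx).preimage_mem_nhds
    (Metric.ball_mem_nhds _ hr)] with y hy hyr
  have hline : ContDiff ℝ ∞ fun t : ℝ => φ x + Real.smoothTransition t • (φ y - φ x) :=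
    contDiff_const.add (Real.smoothTransition.contDiff.smul contDiff_const)
  refine ⟨fun t => φ.symm (φ x + Real.smoothTransition t • (φ y - φ x)), fun t => ?_, fun t ht => ?_,
    fun t ht => ?_⟩
  · have h1 : φ x + Real.smoothTransition t • (φ y - φ x) ∈ φ.target := by
      refine hball ((convex_ball (φ x) r).add_smul_sub_mem (Metric.mem_ball_self hr) hyr
        ⟨Real.smoothTransition.nonneg t, Real.smoothTransition.le_one t⟩)
    exact (contMDiffOn_chart_symm.contMDiffAt (φ.open_target.mem_nhds h1)).comp t
      hline.contMDiff.contMDiffAt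
  · simp [Real.smoothTransition.zero_of_nonpos ht, φ.left_inv hx]
  · simp [Real.smoothTransition.one_of_one_le ht, φ.left_inv hy]

/-- Any two points of a connected manifold are joined by a smooth path. -/
theorem smoothJoined [IsManifold 𝓘(ℝ, E) ∞ M] [PreconnectedSpace M] (x y : M) :
    SmoothJoined E x y := by
  have hcl : IsClopen {y | SmoothJoined E x y} := by
    refine ⟨⟨isOpen_iff_mem_nhds.2 fun y hy => ?_⟩, isOpen_iff_mem_nhds.2 fun y hy => ?_⟩
    · filter_upwards [SmoothJoined.eventually (E := E) y] with z hz hxz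
      exact hy (hxz.trans hz.symm)
    · filter_upwards [SmoothJoined.eventually (E := E) y] with z hz
      exact hy.trans hz
  have hne : {y | SmoothJoined E x y}.Nonempty :=
    ⟨x, (SmoothJoined.eventually (E := E) x).self_of_nhds⟩
  exact (hcl.eq_univ hne).symm.subset (mem_univ y)

end SmoothPaths

/-! ### Lifts of loops and smooth representatives -/

namespace FlatBundle.UniversalCover

open scoped Topology unitInterval

variable {E : Type*} [NormedAddCommGroup E] [NormedSpace ℝ E]
  {B : Type*} [TopologicalSpace B] [ChartedSpace E B] {x₀ : B} (C : UniversalCover E x₀)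

theorem monodromy_mk {y : C.Total} (Γ : Path C.base y) (γ : Path x₀ x₀)
    (h : ∀ t, C.proj (Γ t) = γ t) :
    (C.isCoveringMap.monodromy (.mk γ) C.basePt : C.Total) = y := by
  have := (C.isCoveringMap.eq_liftPath_iff' (γ := (γ : C(unitInterval, B))) (e := C.base)
      (γ.source.trans C.proj_base.symm) (Γ := (Γ : C(unitInterval, C.Total)))).2
      ⟨funext h, Γ.source⟩
  exact (congrArg (fun c : C(unitInterval, C.Total) => c 1) this).symm.trans Γ.target

/-- The lift of a loop to the universal covering, as a path to the image of the base point under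
the corresponding covering transformation. -/
theorem exists_lift (γ : Path x₀ x₀) :
    ∃ Γ : Path C.base (C.deck (FundamentalGroup.fromPath (.mk γ)) C.base),
      ∀ t, C.proj (Γ t) = γ t := by
  have h0 := γ.source.trans C.proj_base.symm
  let L := C.isCoveringMap.liftPath γ C.base h0
  refine ⟨⟨L, C.isCoveringMap.liftPath_zero _ _ h0, ?_⟩,
    fun t => congrFun (C.isCoveringMap.liftPath_lifts γ C.base h0) t⟩
  exact (C.deck_base (FundamentalGroup.fromPath (.mk γ))).symm

/-- Every class in the fundamental group of a manifold is represented by a smooth loop. -/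
theorem exists_smooth_loop (C : UniversalCover E x₀) (α : FundamentalGroup B x₀) :
    ∃ γ : Path x₀ x₀, ContMDiffOn 𝓘(ℝ, ℝ) 𝓘(ℝ, E) ∞ γ.extend (Icc 0 1) ∧
      FundamentalGroup.fromPath (.mk γ) = α := by
  -- A smooth path upstairs from the base point to its translate by α projects to a smooth loop,
  -- whose class is α because classes are determined by the endpoints of their lifts.
  obtain ⟨c, hc, h0, h1⟩ := smoothJoined (E := E) C.base (C.deck α C.base)
  let Γ : Path C.base (C.deck α C.base) :=
    ⟨⟨fun t => c t, hc.continuous.comp continuous_subtype_val⟩, h0 _ le_rfl, h1 _ le_rfl⟩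
  have hb : C.proj (C.deck α C.base) = x₀ := (C.proj_deck _ _).trans C.proj_base
  let γ : Path x₀ x₀ := (Γ.map C.isCoveringMap.continuous).cast C.proj_base.symm hb.symm
  refine ⟨γ, ?_, C.eq_of_monodromy_eq (Subtype.ext ?_)⟩
  · refine (C.isLocalDiffeomorph.contMDiff.comp hc).contMDiffOn.congr fun t ht => ?_
    rw [Path.extend_apply _ ht]
    rfl
  · rw [← C.deck_base α]
    exact C.monodromy_mk Γ γ fun t => rfl

end FlatBundle.UniversalCover

/-! ### Leaves, developing maps and holonomy -/

section Developing

set_option linter.unusedSectionVars false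
set_option linter.checkUnivs false

open Filter
open scoped Topology unitInterval

variable {E F : Type*} [NormedAddCommGroup E] [NormedSpace ℝ E]
  [NormedAddCommGroup F] [NormedSpace ℝ F]
  {B : Type*} [TopologicalSpace B] [ChartedSpace E B]
  {G : Type*} [TopologicalSpace G] [ChartedSpace F G] [Group G] [LieGroup 𝓘(ℝ, F) ∞ G]
  {P : PrincipalBundle E F B G} {A : Connection P} {x₀ : B}

namespace FlatBundle

namespace Connection

section Leaves

variable [FiniteDimensional ℝ E] [FiniteDimensional ℝ F] [IsManifold 𝓘(ℝ, E) ∞ B]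

/-- The sheets on the total space of a flat bundle that are the translates of horizontal
sections. -/
noncomputable def leafAtlas (hA : A.IsFlat) : SheetAtlas P.Total B where
  proj := P.proj
  Index := HorizontalSection A
  Fiber _ := G
  dom S := S.dom
  coord S := S.coord
  sec S b g := P.act (S.sec b) g
  isOpen_dom S := S.isOpen_dom
  exists_mem_dom b := by
    obtain ⟨p, rfl⟩ := P.proj_surjective b
    obtain ⟨S, hS, -⟩ := A.exists_horizontalSection hA p
    exact ⟨S, hS⟩
  proj_sec S b hb g := (P.proj_act _ _).trans (S.proj_sec b hb)
  coord_sec S b hb g := S.coord_act hb g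
  sec_coord S p hp := S.act_coord hp
  eventually_coord_sec S S' b hb g := by
    filter_upwards [S.eventually_coord_sec_eq S' hb.1 hb.2, S.isOpen_dom.mem_nhds hb.1,
      S'.isOpen_dom.mem_nhds hb.2] with x h1 h2 h3
    rw [S'.coord_act_right (by rw [S.proj_sec x h2]; exact h3), h1,
      S'.coord_act_right (by rw [S.proj_sec b hb.1]; exact hb.2)]

/-- The total space of a flat bundle with the leaf topology. -/
abbrev Leaves (hA : A.IsFlat) : Type _ := (leafAtlas hA).Sheets

/-- A point of the total space as a point of a leaf. -/
def toLeaves (hA : A.IsFlat) (p : P.Total) : Leaves hA := p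

/-- The projection of the leaves. -/
noncomputable def leafProj (hA : A.IsFlat) : Leaves hA → B := (leafAtlas hA).sheetProj

theorem isCoveringMap_leafProj (hA : A.IsFlat) : IsCoveringMap (leafProj hA) :=
  (leafAtlas hA).isCoveringMap

/-- Leaf continuity forces the coordinate relative to a horizontal section to be locally constant.
This converts topological lifts into smooth horizontal maps. -/
theorem exists_eventually_eq_act (hA : A.IsFlat) {M : Type*} [TopologicalSpace M]
    {f : M → P.Total} (hf : Continuous fun x => toLeaves hA (f x)) (x : M) :
    ∃ S : HorizontalSection A, P.proj (f x) ∈ S.dom ∧ ∃ g, ∀ᶠ y in 𝓝 x,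
      f y = P.act (S.sec (P.proj (f y))) g := by
  obtain ⟨S, hS⟩ := (leafAtlas hA).exists_mem_dom (P.proj (f x))
  refine ⟨S, hS, S.coord (f x), ?_⟩
  have h1 := hf.continuousAt.eventually
    ((leafAtlas hA).eventually_sheetCoord_eq (i := S) (x := toLeaves hA (f x)) hS)
  have h2 : ∀ᶠ y in 𝓝 x, P.proj (f y) ∈ S.dom :=
    ((isCoveringMap_leafProj hA).continuous.comp hf).continuousAt.eventually_mem
      (S.isOpen_dom.mem_nhds hS)
  filter_upwards [h1, h2] with y hy hy'
  have h3 : S.coord (f y) = S.coord (f x) := hy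
  rw [← h3]
  exact (S.act_coord hy').symm

/-- Right translation carries leaves to leaves: it multiplies the coordinate relative to a
horizontal section by g, so local constancy survives. -/
theorem continuous_toLeaves_act (hA : A.IsFlat) {M : Type*} [TopologicalSpace M]
    {f : M → P.Total} (hf : Continuous fun x => toLeaves hA (f x)) (g : G) :
    Continuous (fun x => toLeaves hA (P.act (f x) g)) := by
  rw [continuous_iff_continuousAt]
  intro x
  obtain ⟨S, hS⟩ := (leafAtlas hA).exists_mem_dom (P.proj (f x))
  have hc := (isCoveringMap_leafProj hA).continuous.comp hf
  have hproj : ∀ y, (leafAtlas hA).sheetProj (toLeaves hA (P.act (f y) g)) =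
      leafProj hA (toLeaves hA (f y)) := fun y => P.proj_act _ _
  rw [← continuousWithinAt_univ]
  refine (leafAtlas hA).continuousWithinAt_of_eventually_eq (i := S) (mem_univ _) ?_ ?_ ?_
  · rw [hproj]; exact hS
  · simp only [hproj]
    exact hc.continuousWithinAt
  · rw [nhdsWithin_univ]
    filter_upwards [hf.continuousAt.eventually
      ((leafAtlas hA).eventually_sheetCoord_eq (i := S) (x := toLeaves hA (f x)) hS),
      hc.continuousAt.eventually_mem (S.isOpen_dom.mem_nhds hS)] with y hy hy'
    have h3 : S.coord (f y) = S.coord (f x) := hy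
    exact (S.coord_act_right (p := f y) hy' g).trans
      ((congrArg (· * g) h3).trans (S.coord_act_right (p := f x) hS g).symm)

/-- Parallel transport is unique. -/
theorem IsParallelTransport.unique (hA : A.IsFlat) {x y : B} {γ : Path x y} {p q q' : P.Total}
    (h : A.IsParallelTransport γ p q) (h' : A.IsParallelTransport γ p q') : q = q' := by
  -- A smooth horizontal path has locally constant coordinates, hence is continuous for the leaf
  -- topology. Two parallel transports are then lifts of one path to a covering space.
  have key : ∀ {q : P.Total} (c : Path p q),
      ContMDiffOn 𝓘(ℝ, ℝ) (prodModel E F) ∞ c.extend (Icc 0 1) →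
      (∀ t ∈ Icc (0 : ℝ) 1, A.form (c.extend t)
        (mfderivWithin 𝓘(ℝ, ℝ) (prodModel E F) c.extend (Icc 0 1) t (1 : ℝ)) = 0) →
      Continuous (fun t : I => toLeaves hA (c t)) := by
    intro q c hc hc0
    rw [continuous_iff_continuousAt]
    intro t
    obtain ⟨S, hS⟩ := (leafAtlas hA).exists_mem_dom (P.proj (c t))
    rw [← continuousWithinAt_univ]
    refine (leafAtlas hA).continuousWithinAt_of_eventually_eq (i := S) (mem_univ _) hS ?_ ?_
    · exact (P.contMDiff_proj.continuous.comp c.continuous).continuousWithinAt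
    · rw [nhdsWithin_univ]
      have h1 := S.eventually_coord_eq hc hc0 t.2 (by rw [Path.extend_apply _ t.2]; exact hS)
      have h2 : Tendsto (Subtype.val : I → ℝ) (𝓝 t) (𝓝[Icc 0 1] (t : ℝ)) :=
        tendsto_nhdsWithin_iff.2 ⟨continuous_subtype_val.continuousAt,
          Eventually.of_forall fun s => s.2⟩
      filter_upwards [h2.eventually h1] with s hs
      rw [Path.extend_apply _ s.2, Path.extend_apply _ t.2] at hs
      exact hs
  obtain ⟨c, hc, hcs, hc0⟩ := h
  obtain ⟨c', hc', hcs', hc0'⟩ := h'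
  have hcov := isCoveringMap_leafProj hA
  have hp : (γ : C(I, B)) 0 = leafProj hA p :=
    (hc 0).symm.trans (congrArg P.proj c.source)
  have e1 := (hcov.eq_liftPath_iff (γ := (γ : C(I, B))) (e := p) hp).2
    ⟨key c hcs hc0, funext hc, c.source⟩
  have e2 := (hcov.eq_liftPath_iff (γ := (γ : C(I, B))) (e := p) hp).2
    ⟨key c' hcs' hc0', funext hc', c'.source⟩
  have e3 : c 1 = c' 1 := congrFun (e1.trans e2.symm) 1
  rwa [c.target, c'.target] at e3

end Leaves

/-- A developing map: a smooth horizontal map over `B` from a universal covering to the total space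
of a bundle, equivariant with respect to a representation of the fundamental group. -/
structure DevelopingMap (C : UniversalCover.{w} E x₀) (A : Connection P) (p₀ : P.Total)
    (ρ : FundamentalGroup B x₀ →* G) where
  /-- The map. -/
  map : C.Total → P.Total
  map_base : map C.base = p₀
  proj_map : ∀ x, P.proj (map x) = C.proj x
  contMDiff : ContMDiff 𝓘(ℝ, E) (prodModel E F) ∞ map
  horizontal : ∀ x v, A.modelForm (map x) (mfderiv 𝓘(ℝ, E) (prodModel E F) map x v) = 0
  map_deck : ∀ α x, map (C.deck α x) = P.act (map x) (ρ α)

/-- As B̃ is simply connected, its covering map lifts to the leaf covering through p₀. The element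
ρ(α) is read off at the base point; x ↦ f(x·α) and x ↦ f(x)·ρ(α) lift the same map and agree there,
hence everywhere. Freeness of the action makes ρ multiplicative. -/
theorem exists_developingMap [FiniteDimensional ℝ E] [FiniteDimensional ℝ F]
    [IsManifold 𝓘(ℝ, E) ∞ B] (hA : A.IsFlat) (C : UniversalCover.{w} E x₀) {p₀ : P.Total}
    (hp₀ : P.proj p₀ = x₀) : ∃ ρ, Nonempty (DevelopingMap C A p₀ ρ) := by
  have hcov := isCoveringMap_leafProj hA
  obtain ⟨f, hfc, hf0, hproj⟩ : ∃ f : C.Total → P.Total, Continuous (fun x => toLeaves hA (f x)) ∧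
      f C.base = p₀ ∧ ∀ x, P.proj (f x) = C.proj x := by
    obtain ⟨f, ⟨hf0, hf⟩, -⟩ := hcov.existsUnique_continuousMap_lifts
      ⟨C.proj, C.isCoveringMap.continuous⟩ C.base (toLeaves hA p₀)
      (hp₀.trans C.proj_base.symm)
    exact ⟨f, f.continuous, hf0, fun x => congrFun hf x⟩
  have hex : ∀ α, ∃ g, P.act (f C.base) g = f (C.deck α C.base) := fun α =>
    P.exists_act_eq (by rw [hproj, hproj, C.proj_deck])
  choose ρ hρ using hex
  have hdeck : ∀ α x, f (C.deck α x) = P.act (f x) (ρ α) := by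
    intro α x
    refine congrFun (hcov.eq_of_comp_eq (hfc.comp (C.deck α).continuous)
      (continuous_toLeaves_act hA hfc (ρ α)) (funext fun y => ?_) C.base (hρ α).symm) x
    change P.proj (f (C.deck α y)) = P.proj (P.act (f y) (ρ α))
    rw [P.proj_act, hproj, hproj, C.proj_deck]
  have hloc := exists_eventually_eq_act hA hfc
  refine ⟨MonoidHom.mk' ρ fun α β => P.act_injective (f C.base) ?_, ⟨⟨f, hf0, hproj, ?_, ?_, hdeck⟩⟩⟩
  · rw [← hdeck, P.act_mul, ← hdeck, C.deck_mul, ContinuousMap.comp_apply, hdeck]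
  · intro x
    obtain ⟨S, hS, g, hg⟩ := hloc x
    rw [← contMDiffWithinAt_univ]
    refine S.contMDiffWithinAt_of_eventuallyEq (f := f) (g := g) (mem_univ _) hS
      (by rw [nhdsWithin_univ]; exact hg) ?_
    simp only [hproj]
    exact C.isLocalDiffeomorph.contMDiff.contMDiffAt.contMDiffWithinAt
  · intro x v
    obtain ⟨S, hS, g, hg⟩ := hloc x
    rw [← mfderivWithin_univ]
    refine S.form_eq_zero_of_eventuallyEq (f := f) (g := g) (uniqueMDiffWithinAt_univ _)
      (mem_univ _) hS (by rw [nhdsWithin_univ]; exact hg) ?_ v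
    simp only [hproj]
    exact C.isLocalDiffeomorph.contMDiff.contMDiffAt.contMDiffWithinAt

namespace DevelopingMap

variable {C : UniversalCover.{w} E x₀} {p₀ : P.Total} {ρ : FundamentalGroup B x₀ →* G}

/-- The representation of a developing map is the holonomy. -/
theorem isHolonomy (D : DevelopingMap C A p₀ ρ) : A.IsHolonomy p₀ ρ := by
  intro γ hγ
  obtain ⟨Γ, hΓ⟩ := C.exists_lift γ
  have hend : P.act p₀ (ρ (FundamentalGroup.fromPath (.mk γ))) =
      D.map (C.deck (FundamentalGroup.fromPath (.mk γ)) C.base) := by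
    rw [D.map_deck, D.map_base]
  -- The lift is only known to be continuous; locally it is γ followed by a smooth local inverse of
  -- the covering map.
  have hΓs : ContMDiffOn 𝓘(ℝ, ℝ) 𝓘(ℝ, E) ∞ Γ.extend (Icc 0 1) := by
    intro t ht
    have hloc := C.isLocalDiffeomorph (Γ.extend t)
    have hpe : ∀ s ∈ Icc (0 : ℝ) 1, C.proj (Γ.extend s) = γ.extend s := by
      intro s hs
      rw [Path.extend_apply _ hs, Path.extend_apply _ hs, hΓ]
    have h2 : ContMDiffWithinAt 𝓘(ℝ, ℝ) 𝓘(ℝ, E) ∞ (hloc.localInverse ∘ γ.extend) (Icc 0 1) t := by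
      refine ContMDiffAt.comp_contMDiffWithinAt t ?_ (hγ t ht)
      rw [← hpe t ht]
      exact hloc.localInverse_contMDiffAt
    refine h2.congr_of_eventuallyEq_of_mem ?_ ht
    filter_upwards [Γ.continuous_extend.continuousWithinAt.eventually
      hloc.localInverse_eventuallyEq_left, self_mem_nhdsWithin] with s hs hs'
    rw [Function.comp_apply, ← hpe s hs']
    exact hs.symm
  -- The developing map carries the lift of γ to a horizontal path over γ. Its end is the image of
  -- the translated base point, which equivariance identifies as p₀·ρ([γ]).
  let c : Path p₀ (P.act p₀ (ρ (FundamentalGroup.fromPath (.mk γ)))) :=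
    (Γ.map D.contMDiff.continuous).cast D.map_base.symm hend
  have hc : c.extend = D.map ∘ Γ.extend := rfl
  refine ⟨c, fun t => (D.proj_map _).trans (hΓ t), ?_, fun t ht => ?_⟩
  · rw [hc]
    exact D.contMDiff.comp_contMDiffOn hΓs
  · have h1 := DFunLike.congr_fun (mfderivWithin_comp_of_eq (x := t) (s := Icc 0 1)
      (g := D.map) (f := Γ.extend) (u := univ)
      (D.contMDiff.mdifferentiable (by simp) _).mdifferentiableWithinAt
      ((hΓs t ht).mdifferentiableWithinAt (by simp)) (fun _ _ => mem_univ _)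
      ((uniqueDiffOn_Icc zero_lt_one).uniqueMDiffOn t ht) rfl) (1 : ℝ)
    refine (congrArg (fun u : E × F => A.modelForm (D.map (Γ.extend t)) u) h1).trans ?_
    rw [mfderivWithin_univ]
    exact D.horizontal _ _

/-- The translate of a developing map. -/
noncomputable def act (D : DevelopingMap C A p₀ ρ) (h : G) :
    DevelopingMap C A (P.act p₀ h) ((MulAut.conj h⁻¹).toMonoidHom.comp ρ) where
  map x := P.act (D.map x) h
  map_base := by rw [D.map_base]
  proj_map x := (P.proj_act _ _).trans (D.proj_map x)
  contMDiff := (P.contMDiff_act_right h).comp D.contMDiff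
  horizontal x v := by
    have h1 := A.form_act (D.contMDiff.mdifferentiable (by simp) x) (D.horizontal x)
      (mdifferentiableAt_const (c := h)) v
    rw [mfderiv_const] at h1
    exact h1.trans (map_zero _)
  map_deck α x := by
    rw [D.map_deck, ← P.act_mul, ← P.act_mul]
    congr 1
    simp [mul_assoc]

end DevelopingMap

section Holonomy

variable [FiniteDimensional ℝ E] [FiniteDimensional ℝ F] [IsManifold 𝓘(ℝ, E) ∞ B]
  {p₀ : P.Total} {ρ ρ' : FundamentalGroup B x₀ →* G}

/-- Each class contains a smooth loop, its parallel transport is unique, and the action is free. The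
covering only serves to produce the smooth loop. -/
theorem IsHolonomy.unique (hA : A.IsFlat) (C : UniversalCover.{w} E x₀)
    (h : A.IsHolonomy p₀ ρ) (h' : A.IsHolonomy p₀ ρ') : ρ = ρ' := by
  ext α
  obtain ⟨γ, hγ, rfl⟩ := C.exists_smooth_loop α
  exact P.act_injective p₀ ((h γ hγ).unique hA (h' γ hγ))

/-- Some developing map through p₀ exists; its representation is also the holonomy, hence equals the
given one. -/
theorem IsHolonomy.nonempty_developingMap (hA : A.IsFlat) (C : UniversalCover.{w} E x₀)
    (hp₀ : P.proj p₀ = x₀) (h : A.IsHolonomy p₀ ρ) : Nonempty (DevelopingMap C A p₀ ρ) := by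
  obtain ⟨ρ', ⟨D⟩⟩ := exists_developingMap hA C hp₀
  exact h.unique hA C D.isHolonomy ▸ ⟨D⟩

theorem existsUnique_isHolonomy (hA : A.IsFlat) (C : UniversalCover.{w} E x₀)
    (hp₀ : P.proj p₀ = x₀) : ∃! ρ : FundamentalGroup B x₀ →* G, A.IsHolonomy p₀ ρ := by
  obtain ⟨ρ, ⟨D⟩⟩ := exists_developingMap hA C hp₀
  exact ⟨ρ, D.isHolonomy, fun ρ' h' => h'.unique hA C D.isHolonomy⟩

theorem IsHolonomy.act (hA : A.IsFlat) (C : UniversalCover.{w} E x₀) (hp₀ : P.proj p₀ = x₀)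
    (h : A.IsHolonomy p₀ ρ) (g : G) :
    A.IsHolonomy (P.act p₀ g) ((MulAut.conj g⁻¹).toMonoidHom.comp ρ) :=
  ((h.nonempty_developingMap hA C hp₀).some.act g).isHolonomy

/-- The holonomies of a flat connection at two points over the base point are conjugate. -/
theorem IsHolonomy.isConjRep (hA : A.IsFlat) (C : UniversalCover.{w} E x₀) {p₁ : P.Total}
    (hp₀ : P.proj p₀ = x₀) (hp₁ : P.proj p₁ = x₀) (h : A.IsHolonomy p₀ ρ)
    (h' : A.IsHolonomy p₁ ρ') : IsConjRep ρ ρ' := by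
  obtain ⟨g, rfl⟩ := P.exists_act_eq (hp₀.trans hp₁.symm)
  refine ⟨g, fun α => ?_⟩
  rw [h'.unique hA C (h.act hA C hp₀ g)]
  simp

end Holonomy

end Connection

end FlatBundle

end Developing

/-! ### Developing maps and isomorphisms with the balanced product -/

section Isomorphisms

set_option linter.unusedSectionVars false
set_option linter.checkUnivs false

open Filter
open scoped Topology

namespace FlatBundle

section

variable {E F : Type*} [NormedAddCommGroup E] [NormedSpace ℝ E]
  [NormedAddCommGroup F] [NormedSpace ℝ F]
  {B : Type*} [TopologicalSpace B] [ChartedSpace E B]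
  {G : Type*} [TopologicalSpace G] [ChartedSpace F G] [Group G] [LieGroup 𝓘(ℝ, F) ∞ G]
  {P Q : PrincipalBundle E F B G}

/-- A smooth equivariant map over the base is an isomorphism of principal bundles. -/
theorem exists_bundleIso {f : P.Total → Q.Total}
    (hf : ContMDiff (prodModel E F) (prodModel E F) ∞ f) (hproj : ∀ p, Q.proj (f p) = P.proj p)
    (hact : ∀ p g, f (P.act p g) = Q.act (f p) g) :
    ∃ Φ : BundleIso P Q, ∀ p, Φ.toDiffeo p = f p := by
  have hinj : Function.Injective f := by
    intro p p' h
    obtain ⟨g, rfl⟩ := P.exists_act_eq ((hproj p).symm.trans ((congrArg Q.proj h).trans (hproj p')))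
    have : g = 1 := Q.act_injective (f p) (by rw [← hact, ← h, Q.act_one])
    rw [this, P.act_one]
  have hsurj : Function.Surjective f := by
    intro q
    obtain ⟨p, hp⟩ := P.proj_surjective (Q.proj q)
    obtain ⟨g, rfl⟩ := Q.exists_act_eq ((hproj p).trans hp)
    exact ⟨_, hact p g⟩
  let e := Equiv.ofBijective f ⟨hinj, hsurj⟩
  refine ⟨⟨⟨e, hf, fun q => ?_⟩, hproj, hact⟩, fun p => rfl⟩
  -- For the inverse, take a local section s of P. A point r equals f(s(π r)) translated by a group
  -- element that depends smoothly on r, and its preimage is s(π r) translated by the same element.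
  obtain ⟨T, hT⟩ := P.exists_localTriv (Q.proj q)
  obtain ⟨T', hT'⟩ := Q.exists_localTriv (Q.proj q)
  let s : B → P.Total := fun b => T.map.symm (b, 1)
  have hs : ContMDiffAt 𝓘(ℝ, E) (prodModel E F) ∞ s (Q.proj q) :=
    (T.contMDiffOn_symm.contMDiffAt (T.map.open_target.mem_nhds (T.mem_target.2 hT))).comp _
      (contMDiffAt_id.prodMk contMDiffAt_const)
  have hps : ∀ b ∈ T.dom, P.proj (s b) = b := fun b hb => T.proj_symm hb 1
  have h1 : ContMDiffAt (prodModel E F) (prodModel E F) ∞ (fun r => s (Q.proj r)) q :=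
    hs.comp q Q.contMDiff_proj.contMDiffAt
  have hT1 : ∀ r, Q.proj r ∈ T'.dom → ContMDiffAt (prodModel E F) (prodModel E F) ∞ T'.map r :=
    fun r hr => T'.contMDiffOn.contMDiffAt (T'.map.open_source.mem_nhds (T'.mem_source.2 hr))
  have h2 : ContMDiffAt (prodModel E F) 𝓘(ℝ, F) ∞ (fun r => T'.div (f (s (Q.proj r))) r) q := by
    have h3 : ContMDiffAt (prodModel E F) 𝓘(ℝ, F) ∞ (fun r => (T'.map (f (s (Q.proj r)))).2) q :=
      contMDiffAt_snd.comp q (ContMDiffAt.comp q (hT1 _ (by rwa [hproj, hps _ hT]))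
        (hf.contMDiffAt.comp q h1))
    exact h3.inv.mul (contMDiffAt_snd.comp q (hT1 q hT'))
  refine (P.contMDiff_act.contMDiffAt.comp q (h1.prodMk h2)).congr_of_eventuallyEq ?_
  have hc : ContinuousAt Q.proj q := Q.contMDiff_proj.continuous.continuousAt
  filter_upwards [hc.eventually_mem (T.isOpen_dom.mem_nhds hT),
    hc.eventually_mem (T'.isOpen_dom.mem_nhds hT')] with r hr hr'
  apply hinj
  refine (e.apply_symm_apply r).trans ?_
  refine Eq.symm ((hact _ _).trans (T'.act_div ?_ ?_))
  · rwa [hproj, hps _ hr]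
  · rw [hproj, hps _ hr]

namespace Connection.DevelopingMap

variable {x₀ : B} {C : UniversalCover.{w} E x₀} {A : Connection P} {p₀ : P.Total}
  {ρ : FundamentalGroup B x₀ →* G}

/-- The composition of a developing map with a bundle map that preserves connections. -/
noncomputable def comp (D : DevelopingMap C A p₀ ρ) {A' : Connection Q} (f : BundleIso P Q)
    (h : ∀ p v, A.modelForm p v =
      A'.modelForm (f.toDiffeo p) (mfderiv (prodModel E F) (prodModel E F) f.toDiffeo p v)) :
    DevelopingMap C A' (f.toDiffeo p₀) ρ where
  map x := f.toDiffeo (D.map x)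
  map_base := by rw [D.map_base]
  proj_map x := (f.proj_apply _).trans (D.proj_map x)
  contMDiff := f.toDiffeo.contMDiff.comp D.contMDiff
  horizontal x v := by
    have h1 := DFunLike.congr_fun (mfderiv_comp x
      (f.toDiffeo.mdifferentiable (by simp) (D.map x)) (D.contMDiff.mdifferentiable (by simp) x)) v
    exact (congrArg (fun u : E × F => A'.modelForm (f.toDiffeo (D.map x)) u) h1).trans
      ((h _ _).symm.trans (D.horizontal x v))
  map_deck α x := by rw [D.map_deck, f.map_act]

end Connection.DevelopingMap

end

section

variable {E F : Type*} [NormedAddCommGroup E] [NormedSpace ℝ E]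
  [NormedAddCommGroup F] [NormedSpace ℝ F]
  {B : Type u} [TopologicalSpace B] [ChartedSpace E B] [ConnectedSpace B]
  {G : Type v} [TopologicalSpace G] [ChartedSpace F G] [Group G] [LieGroup 𝓘(ℝ, F) ∞ G]
  {P Q : PrincipalBundle.{max u v} E F B G}
  {x₀ : B} {C : UniversalCover.{u} E x₀} {A : Connection P} {p₀ : P.Total}
  {ρ : FundamentalGroup B x₀ →* G}

/-- A developing map induces an isomorphism with the balanced product. -/
theorem Connection.DevelopingMap.exists_bundleIso (D : DevelopingMap C A p₀ ρ) :
    ∃ Φ : BundleIso (C.assocBundle ρ) P, C.PullsBackToTrivial ρ A Φ := by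
  let d : C.Total × G → P.Total := fun z => P.act (D.map z.1) z.2
  have hd : ContMDiff (prodModel E F) (prodModel E F) ∞ d :=
    P.contMDiff_act.comp ((D.contMDiff.comp contMDiff_fst).prodMk contMDiff_snd)
  let f : C.AssocSpace ρ → P.Total := Quotient.lift d (by
    rintro z _ ⟨α, rfl⟩
    change P.act _ _ = P.act (D.map (C.deck α z.1)) ((ρ α)⁻¹ * z.2)
    rw [D.map_deck, ← P.act_mul, mul_inv_cancel_left])
  have hf : ContMDiff (prodModel E F) (prodModel E F) ∞ f :=
    contMDiff_of_comp_localDiffeo (C.isLocalDiffeomorph_quotMap (F := F) ρ)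
      (C.quotMap_surjective ρ) hd
  obtain ⟨Φ, hΦ⟩ := FlatBundle.exists_bundleIso (P := C.assocBundle ρ) (Q := P) hf
    (fun y => by
      obtain ⟨z, rfl⟩ := C.quotMap_surjective ρ y
      exact (P.proj_act _ _).trans (D.proj_map _))
    (fun y g => by
      obtain ⟨z, rfl⟩ := C.quotMap_surjective ρ y
      exact P.act_mul _ _ _)
  refine ⟨Φ, fun z v => ?_⟩
  -- The map (x, g) ↦ D(x)·g is a horizontal map translated by the G-coordinate, so ω pulls back to
  -- the Maurer–Cartan form of that coordinate, which is Θ.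
  have key : ∀ d' : C.Total × G → P.Total, d' = d →
      A.modelForm (d' z) (mfderiv (prodModel E F) (prodModel E F) d' z v) =
        C.trivialForm F G z v := by
    rintro _ rfl
    refine A.form_act (s := fun z : C.Total × G => D.map z.1) (c := Prod.snd)
      ((D.contMDiff.mdifferentiable (by simp) z.1).comp z mdifferentiableAt_fst) (fun w => ?_)
      mdifferentiableAt_snd v
    have h1 := DFunLike.congr_fun (mfderiv_comp z (D.contMDiff.mdifferentiable (by simp) z.1)
      (mdifferentiableAt_fst (I := 𝓘(ℝ, E)) (I' := 𝓘(ℝ, F)))) w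
    exact (congrArg (fun u : E × F => A.modelForm (D.map z.1) u) h1).trans (D.horizontal _ _)
  exact key (fun z' => Φ.toDiffeo (C.quotMap ρ z')) (funext fun z' => hΦ (C.quotMap ρ z'))

/-- An isomorphism with the balanced product that takes the connection to the trivial connection
defines a developing map. -/
theorem UniversalCover.PullsBackToTrivial.nonempty_developingMap
    {Φ : BundleIso (C.assocBundle ρ) P} (h : C.PullsBackToTrivial ρ A Φ) :
    Nonempty (Connection.DevelopingMap C A (Φ.toDiffeo (C.quotMap ρ (C.base, 1))) ρ) := by
  have hq : ContMDiff (prodModel E F) (prodModel E F) ∞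
      (fun z : C.Total × G => Φ.toDiffeo (C.quotMap ρ z)) :=
    Φ.toDiffeo.contMDiff.comp (C.isLocalDiffeomorph_quotMap (F := F) ρ).contMDiff
  have hi : ContMDiff 𝓘(ℝ, E) (prodModel E F) ∞ (fun x : C.Total => (x, (1 : G))) :=
    contMDiff_id.prodMk contMDiff_const
  refine ⟨⟨fun x => Φ.toDiffeo (C.quotMap ρ (x, 1)), rfl, fun x => ?_, hq.comp hi, fun x v => ?_,
    fun α x => ?_⟩⟩
  · exact Φ.proj_apply _
  -- The slice x ↦ (x, 1) has constant G-component, so Θ vanishes along it.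
  · have h1 := DFunLike.congr_fun (mfderiv_comp x
      (hq.mdifferentiable (by simp) (x, 1)) (hi.mdifferentiable (by simp) x)) v
    refine (congrArg (fun u : E × F =>
      A.modelForm (Φ.toDiffeo (C.quotMap ρ (x, 1))) u) h1).trans ((h _ _).trans ?_)
    have h2 := DFunLike.congr_fun (mfderiv_comp x
      (mdifferentiableAt_snd (I := 𝓘(ℝ, E)) (I' := 𝓘(ℝ, F)) (x := (x, (1 : G))))
      (hi.mdifferentiable (by simp) x)) v
    have h3 : mfderiv 𝓘(ℝ, E) 𝓘(ℝ, F) (Prod.snd ∘ fun x : C.Total => (x, (1 : G))) x = 0 :=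
      mfderiv_const
    refine (congrArg (fun u : F => mcForm F (1 : G) u) h2.symm).trans ?_
    refine (congrArg (fun u : F => mcForm F (1 : G) u) (DFunLike.congr_fun h3 v)).trans ?_
    exact map_zero (mcForm F (1 : G))
  · refine Eq.trans ?_ (Φ.map_act (C.quotMap ρ (x, 1)) (ρ α))
    refine congrArg Φ.toDiffeo (Eq.symm ((C.quotMap_eq ρ).2 ⟨α, ?_⟩))
    simp

/-- Two flat bundles with the same holonomy are isomorphic. -/
theorem exists_bundleIso_of_pullsBackToTrivial {A' : Connection Q}
    {Φ : BundleIso (C.assocBundle ρ) P} {Φ' : BundleIso (C.assocBundle ρ) Q}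
    (h : C.PullsBackToTrivial ρ A Φ) (h' : C.PullsBackToTrivial ρ A' Φ') :
    ∃ f : BundleIso P Q, ∀ p v, A.modelForm p v =
      A'.modelForm (f.toDiffeo p) (mfderiv (prodModel E F) (prodModel E F) f.toDiffeo p v) := by
  refine ⟨Φ.symm.trans Φ', fun p v => ?_⟩
  set f := Φ.symm.trans Φ'
  let q : C.Total × G → P.Total := fun z => Φ.toDiffeo (C.quotMap ρ z)
  have hq : IsLocalDiffeomorph (prodModel E F) (prodModel E F) ∞ q := fun z =>
    (C.isLocalDiffeomorph_quotMap (F := F) ρ z).comp (hg := Φ.toDiffeo.isLocalDiffeomorph _)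
  have hsurj : Function.Surjective q := Φ.toDiffeo.surjective.comp (C.quotMap_surjective ρ)
  obtain ⟨z, rfl⟩ := hsurj p
  -- Every point and every tangent vector of P comes from B̃ × G, where both connections pull back
  -- to Θ.
  obtain ⟨w, rfl⟩ := ((hq z).mfderivToContinuousLinearEquiv (by simp)).surjective v
  refine (h z w).trans ((h' z w).symm.trans ?_)
  have h1 := DFunLike.congr_fun (mfderiv_comp z
    (f.toDiffeo.mdifferentiable (by simp) (q z)) ((hq z).mdifferentiableAt (by simp))) w
  have h2 : (fun z => Φ'.toDiffeo (C.quotMap ρ z)) = f.toDiffeo ∘ q := by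
    funext z'
    exact congrArg Φ'.toDiffeo (Φ.toDiffeo.symm_apply_apply _).symm
  have key : ∀ d d' : C.Total × G → Q.Total, d = d' →
      A'.modelForm (d z) (mfderiv (prodModel E F) (prodModel E F) d z w) =
        A'.modelForm (d' z) (mfderiv (prodModel E F) (prodModel E F) d' z w) := by
    rintro d _ rfl
    rfl
  exact (key _ _ h2).trans
    (congrArg (fun u : E × F => A'.modelForm (f.toDiffeo (q z)) u) h1)

end

end FlatBundle

end Isomorphisms

/-! ### The Maurer–Cartan form and its structure equation -/

section MaurerCartan

open Filter
open scoped Topology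

variable {F : Type*} [NormedAddCommGroup F] [NormedSpace ℝ F]
  {G : Type*} [TopologicalSpace G] [ChartedSpace F G] [Group G] [LieGroup 𝓘(ℝ, F) ∞ G]

namespace FlatBundle

theorem trivializationAt_self_snd {H V M : Type*} [NormedAddCommGroup V] [NormedSpace ℝ V]
    [TopologicalSpace H] {I : ModelWithCorners ℝ V H} [TopologicalSpace M] [ChartedSpace H M]
    [IsManifold I 1 M] {p : M} {z : TangentBundle I M} (h : z.1 = p) :
    (trivializationAt V (TangentSpace I) p z).2 = z.2 := by
  subst h
  rw [TangentBundle.trivializationAt_apply]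
  exact DFunLike.congr_fun (fderivWithin_extChartAt_comp_extChartAt_symm_range (I := I)) z.2

/-- The form at v ∈ T_gG is the tangent map of multiplication at (0, v) over (g⁻¹, g), which is
smooth. It lands in the fibre over 1, where the trivialization centred at 1 is the identity, so its
vector component is smooth too. -/
theorem contMDiff_mcForm : ContMDiff 𝓘(ℝ, F).tangent 𝓘(ℝ, F) ∞
    (fun v : TangentBundle 𝓘(ℝ, F) G => mcForm F v.1 v.2) := by
  let z : G → TangentBundle 𝓘(ℝ, F) G := fun g => ⟨g, 0⟩
  have hz : ContMDiff 𝓘(ℝ, F) 𝓘(ℝ, F).tangent ∞ z := Bundle.contMDiff_zeroSection ℝ _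
  let S : TangentBundle 𝓘(ℝ, F) G → TangentBundle 𝓘(ℝ, F) G := fun v =>
    tangentMap (𝓘(ℝ, F).prod 𝓘(ℝ, F)) 𝓘(ℝ, F) (fun p : G × G => p.1 * p.2)
      ((equivTangentBundleProd 𝓘(ℝ, F) G 𝓘(ℝ, F) G).symm (z v.1⁻¹, v))
  have hS : ContMDiff 𝓘(ℝ, F).tangent 𝓘(ℝ, F).tangent ∞ S := by
    refine ((contMDiff_mul 𝓘(ℝ, F) ∞).contMDiff_tangentMap (m := ∞) (by simp)).comp
      (contMDiff_equivTangentBundleProd_symm.comp ?_)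
    refine (hz.comp ((contMDiff_inv 𝓘(ℝ, F) ∞).comp ?_)).prodMk contMDiff_id
    exact Bundle.contMDiff_proj (TangentSpace 𝓘(ℝ, F))
  have hS1 : ∀ v, (S v).1 = 1 := fun v => inv_mul_cancel v.1
  have hS2 : ∀ v, (S v).2 = mcForm F v.1 v.2 := by
    intro v
    change mfderiv (𝓘(ℝ, F).prod 𝓘(ℝ, F)) 𝓘(ℝ, F) (fun p : G × G => p.1 * p.2) (v.1⁻¹, v.1)
      ((0 : F), (v.2 : F)) = _
    refine (mfderiv_prod_eq_add_apply
      ((contMDiff_mul 𝓘(ℝ, F) ∞).mdifferentiableAt (by simp))).trans ?_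
    have h0 := map_zero (mfderiv 𝓘(ℝ, F) 𝓘(ℝ, F) (fun h : G => h * v.1) v.1⁻¹)
    exact (congrArg (fun u : F => u + mcForm F v.1 v.2) h0).trans (zero_add _)
  intro v
  refine (Bundle.contMDiffAt_totalSpace.1 (hS v)).2.congr_of_eventuallyEq
    (Eventually.of_forall fun w => ?_)
  exact (hS2 w).symm.trans (trivializationAt_self_snd ((hS1 w).trans (hS1 v).symm)).symm

/-- From (c(x)g)⁻¹(c(y)g) = g⁻¹(c(x)⁻¹c(y))g and the chain rule. This supplies the equivariance
axiom of the descended connection. -/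
theorem mcForm_mul_right {V H M : Type*} [NormedAddCommGroup V] [NormedSpace ℝ V]
    [TopologicalSpace H] {I : ModelWithCorners ℝ V H} [TopologicalSpace M] [ChartedSpace H M]
    (g : G) {c : M → G} {x : M} (hc : MDifferentiableAt I 𝓘(ℝ, F) c x) (v : TangentSpace I x) :
    mcForm F (c x * g) (mfderiv I 𝓘(ℝ, F) (fun y => c y * g) x v) =
      Ad F G g⁻¹ (mcForm F (c x) (mfderiv I 𝓘(ℝ, F) c x v)) := by
  have hr : ∀ g h : G, MDifferentiableAt 𝓘(ℝ, F) 𝓘(ℝ, F) (fun h : G => h * g) h := fun g h =>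
    (contMDiff_mul_right (I := 𝓘(ℝ, F)) (n := ∞)).mdifferentiable (by simp) h
  have hl := mdifferentiable_mul_left (F := F) (G := G)
  have h1 : MDifferentiableAt I 𝓘(ℝ, F) (fun y => (c x)⁻¹ * c y) x := (hl _ _).comp x hc
  have h2 : MDifferentiableAt 𝓘(ℝ, F) 𝓘(ℝ, F) (fun h : G => g⁻¹ * h * g⁻¹⁻¹) 1 :=
    (hr _ _).comp 1 (hl _ _)
  have h3 := DFunLike.congr_fun (mfderiv_comp_of_eq (x := x)
    (g := fun h : G => g⁻¹ * h * g⁻¹⁻¹) h2 h1 (inv_mul_cancel (c x))) v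
  have h4 : ∀ f f' : M → G, f = f' →
      (mfderiv I 𝓘(ℝ, F) f x v : F) = mfderiv I 𝓘(ℝ, F) f' x v := by
    rintro f _ rfl
    rfl
  rw [mcForm_mfderiv (c := fun y => c y * g) ((hr _ _).comp x hc), mcForm_mfderiv hc]
  have h5 : ∀ h : G, h = 1 → ∀ u : F,
      (mfderiv 𝓘(ℝ, F) 𝓘(ℝ, F) (fun h : G => g⁻¹ * h * g⁻¹⁻¹) h u : F) =
      mfderiv 𝓘(ℝ, F) 𝓘(ℝ, F) (fun h : G => g⁻¹ * h * g⁻¹⁻¹) 1 u := by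
    rintro _ rfl u
    rfl
  refine (h4 (fun y => (c x * g)⁻¹ * (c y * g))
    ((fun h : G => g⁻¹ * h * g⁻¹⁻¹) ∘ fun y => (c x)⁻¹ * c y) (funext fun y => ?_)).trans
    (h3.trans (h5 _ (inv_mul_cancel (c x)) _))
  simp [mul_assoc]

theorem mcForm_mulInvariantVectorField (g : G) (ξ : GroupLieAlgebra 𝓘(ℝ, F) G) :
    mcForm F g (mulInvariantVectorField ξ g) = ξ := by
  have h1 := mcForm_mul_left g (c := (id : G → G)) (x := (1 : G))
    (mdifferentiableAt_id (I := 𝓘(ℝ, F))) ξ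
  have key : ∀ q q' : G, q = q' → ∀ u : F, mcForm F q u = mcForm F q' u := by
    rintro q _ rfl u
    rfl
  refine (key _ _ (mul_one g).symm _).trans (h1.trans ?_)
  rw [mfderiv_id]
  have h2 : (fun h : G => (id 1)⁻¹ * h) = id := by
    funext h
    simp
  have h3 : ∀ f : G → G, f = id → (mfderiv 𝓘(ℝ, F) 𝓘(ℝ, F) f (id 1) ξ : F) = ξ := by
    rintro _ rfl
    rw [mfderiv_id]
    rfl
  exact h3 _ h2

variable [FiniteDimensional ℝ F]

theorem isInvertible_mcForm (g : G) : (mcForm F g).IsInvertible := by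
  let m : F →L[ℝ] F := mcForm F g
  have hi : Function.Injective m.toLinearMap := by
    rw [injective_iff_map_eq_zero]
    exact fun η hη => mcForm_injective g η hη
  let e : F ≃L[ℝ] F := (LinearEquiv.ofInjectiveEndo _ hi).toContinuousLinearEquiv
  exact ⟨e, by ext; rfl⟩

variable (G) in
/-- The bracket of the Lie algebra of a Lie group as an operation on the model space. -/
noncomputable def modelBracket (ξ η : F) : F :=
  Bracket.bracket (L := GroupLieAlgebra 𝓘(ℝ, F) G) (M := GroupLieAlgebra 𝓘(ℝ, F) G) ξ η

/-- The Maurer-Cartan equation in a chart. -/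
theorem extd_mcForm_extChartAt (g : G) (v w : F) :
    extd (pullForm (mcForm F) (extChartAt 𝓘(ℝ, F) g).symm) (extChartAt 𝓘(ℝ, F) g g) v w =
      -modelBracket G (mcForm F g v) (mcForm F g w) := by
  have : LieGroup 𝓘(ℝ, F) (minSmoothness ℝ 3) G := by
    rw [minSmoothness_of_isRCLikeNormedField]
    exact LieGroup.of_le (n := ∞) (by norm_cast)
  have : CompleteSpace F := FiniteDimensional.complete ℝ F
  set χ := extChartAt 𝓘(ℝ, F) g with hχ
  set a := pullForm (mcForm F) χ.symm with ha
  set z₀ := χ g with hz₀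
  have hT : IsOpen χ.target := isOpen_extChartAt_target g
  have hz₀T : z₀ ∈ χ.target := mem_extChartAt_target g
  have hσ : ContMDiffOn 𝓘(ℝ, F) 𝓘(ℝ, F) ∞ χ.symm χ.target := contMDiffOn_extChartAt_symm g
  have hasm : ContDiffOn ℝ ∞ a χ.target := contDiffOn_pullForm contMDiff_mcForm hT hσ
  have hinv : ∀ z ∈ χ.target, (a z).IsInvertible := by
    intro z hz
    have h1 := isInvertible_mfderivWithin_extChartAt_symm (I := 𝓘(ℝ, F)) hz
    rw [ModelWithCorners.range_eq_univ, mfderivWithin_univ] at h1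
    exact (isInvertible_mcForm (χ.symm z)).comp h1
  have ha0 : a z₀ = mcForm F g := by
    have h1 := mfderivWithin_range_extChartAt_symm (I := 𝓘(ℝ, F)) (x := g)
    rw [ModelWithCorners.range_eq_univ, mfderivWithin_univ] at h1
    have key : ∀ q q' : G, q = q' → ∀ u : F, mcForm F q u = mcForm F q' u := by
      rintro q _ rfl u
      rfl
    ext u
    refine Eq.trans ?_ (key _ _ (extChartAt_to_inv (I := 𝓘(ℝ, F)) g) u)
    exact congrArg (fun u : F => mcForm F (χ.symm z₀) u) (DFunLike.congr_fun h1 u)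
  -- In the chart, X ξ is the left-invariant field of ξ, since the Maurer–Cartan form takes the
  -- constant value ξ on that field.
  let X : F → F → F := fun ξ z => (a z).inverse ξ
  have hX : ∀ ξ, ∀ z ∈ χ.target, a z (X ξ z) = ξ := by
    intro ξ z hz
    exact (hinv z hz).self_apply_inverse ξ
  have hXd : ∀ ξ, DifferentiableAt ℝ (X ξ) z₀ := by
    intro ξ
    obtain ⟨e, he⟩ := hinv z₀ hz₀T
    have h4 : ContDiffAt ℝ ∞ ContinuousLinearMap.inverse (a z₀) := by
      rw [← he]; exact contDiffAt_map_inverse e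
    have h5 := h4.comp z₀ (hasm.contDiffAt (hT.mem_nhds hz₀T))
    exact (h5.differentiableAt (by simp)).clm_apply (differentiableAt_const ξ)
  have hpull : ∀ ξ, ∀ z ∈ χ.target, VectorField.mpullbackWithin 𝓘(ℝ, F) 𝓘(ℝ, F) χ.symm
      (mulInvariantVectorField (I := 𝓘(ℝ, F)) (G := G) ξ) (range 𝓘(ℝ, F)) z = X ξ z := by
    intro ξ z hz
    have h1 := isInvertible_mfderivWithin_extChartAt_symm (I := 𝓘(ℝ, F)) hz
    refine (((hinv z hz).inverse_apply_eq).2 ?_).symm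
    refine (mcForm_mulInvariantVectorField (χ.symm z) ξ).symm.trans ?_
    have h2 := h1.self_apply_inverse (mulInvariantVectorField (I := 𝓘(ℝ, F)) (G := G) ξ (χ.symm z))
    refine congrArg (fun u : F => mcForm F (χ.symm z) u) (h2.symm.trans ?_)
    rw [VectorField.mpullbackWithin_apply, ModelWithCorners.range_eq_univ, mfderivWithin_univ]
    rfl
  have had : DifferentiableAt ℝ a z₀ :=
    (hasm.contDiffAt (hT.mem_nhds hz₀T)).differentiableAt (by simp)
  -- The derivative of the constant a(X ξ) = ξ: it trades derivatives of the form for derivatives of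
  -- the fields.
  have hd : ∀ ξ v, fderiv ℝ a z₀ v (X ξ z₀) + a z₀ (fderiv ℝ (X ξ) z₀ v) = 0 := by
    intro ξ v
    have h1 : HasFDerivAt (fun y => a y (X ξ y)) (0 : F →L[ℝ] F) z₀ := by
      refine (hasFDerivAt_const ξ z₀).congr_of_eventuallyEq ?_
      filter_upwards [hT.mem_nhds hz₀T] with y hy
      exact hX ξ y hy
    have h2 := had.hasFDerivAt.clm_apply (hXd ξ).hasFDerivAt
    have h3 := DFunLike.congr_fun (h2.unique h1) v
    simpa [add_comm] using h3
  -- The Lie algebra bracket is by definition the value at 1 of the bracket of left-invariant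
  -- fields, which is itself left invariant; so the form recovers it at every g.
  have hbr : ∀ ξ η : F, a z₀ (VectorField.lieBracket ℝ (X ξ) (X η) z₀) =
      modelBracket G ξ η := by
    intro ξ η
    have h1 := congrFun (mulInvariantVector_mlieBracket (I := 𝓘(ℝ, F)) (G := G) ξ η) g
    have h2 := mcForm_mulInvariantVectorField g
      (VectorField.mlieBracket 𝓘(ℝ, F) (mulInvariantVectorField (I := 𝓘(ℝ, F)) (G := G) ξ)
        (mulInvariantVectorField η) 1)
    rw [h1] at h2
    refine Eq.trans ?_ h2
    rw [ha0, ← VectorField.mlieBracketWithin_univ, VectorField.mlieBracketWithin_apply,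
      mfderiv_extChartAt_self, preimage_univ, univ_inter]
    have h3 : ∀ u : F, (ContinuousLinearMap.id ℝ F).inverse u = u := fun u => by
      rw [ContinuousLinearMap.inverse_id]
      rfl
    refine congrArg (fun u : F => mcForm F g u) (Eq.trans ?_ (h3 _).symm)
    rw [ModelWithCorners.range_eq_univ]
    refine Eq.trans ?_ (congrFun (VectorField.lieBracketWithin_univ (𝕜 := ℝ) (E := F)).symm z₀)
    refine Filter.EventuallyEq.lieBracket_vectorField_eq ?_ ?_
    · filter_upwards [hT.mem_nhds hz₀T] with z hz
      exact (hpull ξ z hz).symm.trans (by rw [ModelWithCorners.range_eq_univ])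
    · filter_upwards [hT.mem_nhds hz₀T] with z hz
      exact (hpull η z hz).symm.trans (by rw [ModelWithCorners.range_eq_univ])
  have hXa : ∀ u : F, X (mcForm F g u) z₀ = u := by
    intro u
    rw [← ha0]
    exact (hinv z₀ hz₀T).inverse_apply_self u
  -- With v and w extended to left-invariant fields, this is dθ(X, Y) = -θ([X, Y]): the terms
  -- X(θ(Y)) and Y(θ(X)) vanish.
  rw [← hbr (mcForm F g v) (mcForm F g w), VectorField.lieBracket_eq]
  have e1 := hd (mcForm F g w) v
  have e2 := hd (mcForm F g v) w
  rw [hXa] at e1 e2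
  unfold extd
  dsimp only
  rw [hXa, hXa, map_sub, eq_neg_of_add_eq_zero_left e1, eq_neg_of_add_eq_zero_left e2]
  abel

/-- The Maurer-Cartan equation. -/
theorem extd_pullForm_mcForm {V : Type*} [NormedAddCommGroup V] [NormedSpace ℝ V] {c : V → G}
    {z : V} (hc : ContMDiffAt 𝓘(ℝ, V) 𝓘(ℝ, F) ∞ c z) (v w : V) :
    extd (pullForm (mcForm F) c) z v w =
      -modelBracket G (pullForm (mcForm F) c z v) (pullForm (mcForm F) c z w) := by
  set χ := extChartAt 𝓘(ℝ, F) (c z) with hχ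
  have hτ : ContMDiffAt 𝓘(ℝ, V) 𝓘(ℝ, F) ∞ (χ ∘ c) z := contMDiffAt_extChartAt.comp z hc
  have hT : IsOpen χ.target := isOpen_extChartAt_target (c z)
  have hzT : (χ ∘ c) z ∈ χ.target := mem_extChartAt_target (c z)
  have hσ : ContMDiffOn 𝓘(ℝ, F) 𝓘(ℝ, F) ∞ χ.symm χ.target := contMDiffOn_extChartAt_symm (c z)
  have h1 := extd_pullForm_comp (mcForm F) (σ := c) (σ' := χ.symm) (τ := χ ∘ c) (z := z)
    (by
      filter_upwards [hc.continuousAt.eventually_mem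
        (extChartAt_source_mem_nhds (I := 𝓘(ℝ, F)) (c z))] with y hy
      exact (χ.left_inv hy).symm)
    (by
      filter_upwards [hT.mem_nhds hzT] with y hy
      exact (hσ.contMDiffAt (hT.mem_nhds hy)).mdifferentiableAt (by simp))
    ((contMDiffAt_iff_contDiffAt.1 hτ).of_le (by norm_cast))
    (((contDiffOn_pullForm contMDiff_mcForm hT hσ).contDiffAt
      (hT.mem_nhds hzT)).differentiableAt (by simp)) v w
  have h2 : ∀ u : V, fderiv ℝ (χ ∘ c) z u = (mfderiv 𝓘(ℝ, V) 𝓘(ℝ, F) c z u : F) := by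
    intro u
    rw [← mfderiv_eq_fderiv]
    refine (DFunLike.congr_fun (mfderiv_comp z
      (mdifferentiableAt_extChartAt (I := 𝓘(ℝ, F)) (mem_chart_source F (c z)))
      (hc.mdifferentiableAt (by simp))) u).trans ?_
    exact DFunLike.congr_fun (mfderiv_extChartAt_self (I := 𝓘(ℝ, F)) (x := c z)) _
  rw [h1, h2, h2]
  exact extd_mcForm_extChartAt (c z) _ _

end FlatBundle

end MaurerCartan

/-! ### Descent of invariant forms along local diffeomorphisms -/

section Descent

set_option linter.unusedSectionVars false

open Filter
open scoped Topology

variable {V W H : Type*} [NormedAddCommGroup V] [NormedSpace ℝ V] [TopologicalSpace H]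
  [NormedAddCommGroup W] [NormedSpace ℝ W]
  {I : ModelWithCorners ℝ V H} {M N : Type*} [TopologicalSpace M] [ChartedSpace H M]
  [TopologicalSpace N] [ChartedSpace H N]

/-- A smooth one-form that is invariant under a transitive family of deck transformations of a
surjective local diffeomorphism descends to the base. -/
theorem IsLocalDiffeomorph.exists_descended_form [IsManifold I ∞ M] [IsManifold I ∞ N] {π : M → N}
    (hπ : IsLocalDiffeomorph I I ∞ π) (hsurj : Function.Surjective π)
    {θ : ∀ z : M, TangentSpace I z →L[ℝ] W}
    (hθ : ContMDiff I.tangent 𝓘(ℝ, W) ∞ (fun v : TangentBundle I M => θ v.1 v.2))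
    (hdeck : ∀ z w, π z = π w → ∃ τ : M → M, MDifferentiableAt I I τ z ∧ τ z = w ∧ π ∘ τ = π ∧
      ∀ v, θ (τ z) (mfderiv I I τ z v) = θ z v) :
    ∃ η : ∀ y : N, TangentSpace I y →L[ℝ] W,
      ContMDiff I.tangent 𝓘(ℝ, W) ∞ (fun v : TangentBundle I N => η v.1 v.2) ∧
      ∀ z v, η (π z) (mfderiv I I π z v) = θ z v := by
  have hmd : ∀ z, MDifferentiableAt I I π z := fun z => (hπ z).mdifferentiableAt (by simp)
  choose s hs using hsurj
  -- The form is transported down from a chosen preimage; invariance under deck transformations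
  -- removes the dependence on the choice.
  let η : N → V →L[ℝ] W := fun y => (θ (s y)).comp
    ((hπ (s y)).mfderivToContinuousLinearEquiv (by simp)).symm.toContinuousLinearMap
  have key : ∀ z v, η (π z) (mfderiv I I π z v) = θ z v := by
    intro z v
    obtain ⟨τ, hτ, hz, hπτ, hinv⟩ := hdeck z (s (π z)) (hs _).symm
    have h1 : ∀ f : M → N, f = π → (mfderiv I I f z v : V) = mfderiv I I π z v := by
      rintro _ rfl
      rfl
    have h2 := DFunLike.congr_fun (mfderiv_comp z (hmd (τ z)) hτ) v
    have h4 : ∀ w, τ z = w → ((hπ w).mfderivToContinuousLinearEquiv (by simp)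
        (mfderiv I I τ z v : V) : V) = mfderiv I I π z v ∧
        θ w (mfderiv I I τ z v : V) = θ z v := by
      rintro _ rfl
      exact ⟨h2.symm.trans (h1 _ hπτ), hinv v⟩
    obtain ⟨h5, h6⟩ := h4 _ hz
    refine Eq.trans (congrArg (fun u : V => θ (s (π z)) u) ?_) h6
    refine (congrArg ((hπ (s (π z))).mfderivToContinuousLinearEquiv (by simp)).symm h5.symm).trans ?_
    exact ContinuousLinearEquiv.symm_apply_apply _ _
  refine ⟨η, fun v₀ => ?_, key⟩
  have hz₀ := hs v₀.1
  set z₀ := s v₀.1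
  -- The choice of preimages need not be continuous. Smoothness comes from a local inverse ψ of π,
  -- since near the point η is the pullback of θ by ψ.
  set ψ := (hπ z₀).localInverse with hψ
  have hU : IsOpen ψ.source := ψ.open_source
  have hmem : v₀.1 ∈ ψ.source := by
    rw [← hz₀]
    exact (hπ z₀).localInverse_mem_source
  have hψs : ContMDiffOn I I ∞ ψ ψ.source := ψ.contMDiffOn
  have h2 := hψs.contMDiffOn_tangentMapWithin (m := ∞) (by simp) hU.uniqueMDiffOn
  have h3 := hθ.comp_contMDiffOn h2
  have hpre : (Bundle.TotalSpace.proj ⁻¹' ψ.source : Set (TangentBundle I N)) ∈ 𝓝 v₀ :=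
    (Bundle.contMDiff_proj (n := ∞) (TangentSpace I)
      (IB := I) (F := V)).continuous.continuousAt.preimage_mem_nhds (hU.mem_nhds hmem)
  refine (h3.contMDiffAt hpre).congr_of_eventuallyEq ?_
  filter_upwards [hpre] with v hv
  have hv' : v.1 ∈ ψ.source := hv
  have hψd : MDifferentiableAt I I ψ v.1 :=
    (hψs.contMDiffAt (hU.mem_nhds hv')).mdifferentiableAt (by simp)
  have h4 : π ∘ ψ =ᶠ[𝓝 v.1] id := by
    filter_upwards [hU.mem_nhds hv'] with y hy
    exact (hπ z₀).localInverse_right_inv hy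
  have h5 := DFunLike.congr_fun (mfderiv_comp v.1 (hmd (ψ v.1)) hψd) v.2
  have h6 := DFunLike.congr_fun (h4.mfderiv_eq (I := I) (I' := I)) v.2
  rw [mfderiv_id] at h6
  have h7 : ∀ y y', y = y' → ∀ u : V, η y u = η y' u := by
    rintro y _ rfl u
    rfl
  change η v.1 v.2 = θ (ψ v.1) (mfderivWithin I I ψ ψ.source v.1 v.2)
  rw [mfderivWithin_of_isOpen hU hv', ← key (ψ v.1)]
  refine (congrArg (η v.1) (h6.symm.trans h5)).trans (h7 _ _ h4.eq_of_nhds.symm _)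

theorem form_mfderiv_eq_of_eq_comp {V' H' M' : Type*} [NormedAddCommGroup V'] [NormedSpace ℝ V']
    [TopologicalSpace H'] {I' : ModelWithCorners ℝ V' H'} [TopologicalSpace M'] [ChartedSpace H' M']
    {π : M → N} {θ : ∀ z : M, TangentSpace I z →L[ℝ] W} {η : ∀ y : N, TangentSpace I y →L[ℝ] W}
    (h : ∀ z v, η (π z) (mfderiv I I π z v) = θ z v) (hπ : MDifferentiable I I π)
    {c : M' → M} {d : M' → N} (hd : d = π ∘ c) {x : M'} (hc : MDifferentiableAt I' I c x)
    (v : TangentSpace I' x) :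
    η (d x) (mfderiv I' I d x v) = θ (c x) (mfderiv I' I c x v) := by
  subst hd
  have h1 := DFunLike.congr_fun (mfderiv_comp x (hπ (c x)) hc) v
  exact (congrArg (fun u : V => η (π (c x)) u) h1).trans (h _ _)

end Descent

/-! ### The flat connection on the balanced product -/

section TrivialConnection

set_option linter.unusedSectionVars false
set_option linter.checkUnivs false

open Filter
open scoped Topology

namespace FlatBundle.UniversalCover

variable {E F : Type*} [NormedAddCommGroup E] [NormedSpace ℝ E] [FiniteDimensional ℝ E]
  [NormedAddCommGroup F] [NormedSpace ℝ F] [FiniteDimensional ℝ F]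
  {B : Type u} [TopologicalSpace B] [ChartedSpace E B] [IsManifold 𝓘(ℝ, E) ∞ B]
  [ConnectedSpace B]
  {G : Type v} [TopologicalSpace G] [ChartedSpace F G] [Group G] [LieGroup 𝓘(ℝ, F) ∞ G]
  {Q : PrincipalBundle.{max u v} E F B G}
  {x₀ : B} (C : UniversalCover.{u} E x₀) {ρ : FundamentalGroup B x₀ →* G}

variable (F G) in
/-- The trivial connection form with values in the model space of the group. -/
noncomputable def trivialModelForm (z : C.Total × G) : TangentSpace (prodModel E F) z →L[ℝ] F :=
  (mcForm F z.2).comp (mfderiv (prodModel E F) 𝓘(ℝ, F) Prod.snd z)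

theorem contMDiff_trivialModelForm : ContMDiff (prodModel E F).tangent 𝓘(ℝ, F) ∞
    (fun v : TangentBundle (prodModel E F) (C.Total × G) => C.trivialModelForm F G v.1 v.2) :=
  contMDiff_mcForm.comp ((contMDiff_snd (I := 𝓘(ℝ, E)) (J := 𝓘(ℝ, F)) (M := C.Total) (N := G)
    (n := ∞)).contMDiff_tangentMap (m := ∞) (by simp))

theorem trivialModelForm_mfderiv {V' H' M : Type*} [NormedAddCommGroup V'] [NormedSpace ℝ V']
    [TopologicalSpace H'] {I' : ModelWithCorners ℝ V' H'} [TopologicalSpace M] [ChartedSpace H' M]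
    {c : M → C.Total × G} {x : M} (hc : MDifferentiableAt I' (prodModel E F) c x)
    (v : TangentSpace I' x) :
    C.trivialModelForm F G (c x) (mfderiv I' (prodModel E F) c x v) =
      mcForm F (c x).2 (mfderiv I' 𝓘(ℝ, F) (fun y => (c y).2) x v) := by
  have h := DFunLike.congr_fun (mfderiv_comp x
    (mdifferentiableAt_snd (I := 𝓘(ℝ, E)) (I' := 𝓘(ℝ, F)) (x := c x)) hc) v
  exact congrArg (fun u : F => mcForm F (c x).2 u) h.symm

/-- The trivial connection descends along the quotient map of the balanced product. -/
theorem exists_flat_pullsBackToTrivial (Φ : BundleIso (C.assocBundle ρ) Q) :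
    ∃ A : Connection Q, A.IsFlat ∧ C.PullsBackToTrivial ρ A Φ := by
  let π : C.Total × G → Q.Total := fun z => Φ.toDiffeo (C.quotMap ρ z)
  have hπ : IsLocalDiffeomorph (prodModel E F) (prodModel E F) ∞ π := fun z =>
    (C.isLocalDiffeomorph_quotMap (F := F) ρ z).comp (hg := Φ.toDiffeo.isLocalDiffeomorph _)
  have hsurj : Function.Surjective π := Φ.toDiffeo.surjective.comp (C.quotMap_surjective ρ)
  have hmd : MDifferentiable (prodModel E F) (prodModel E F) π := fun z =>
    (hπ z).mdifferentiableAt (by simp)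
  have hact : ∀ z g, Q.act (π z) g = π (z.1, z.2 * g) := fun z g =>
    (Φ.map_act (C.quotMap ρ z) g).symm
  -- The twist of α multiplies the G-coordinate by ρ(α)⁻¹ on the left, and the Maurer–Cartan form is
  -- left invariant.
  obtain ⟨η, hη, hηπ⟩ := hπ.exists_descended_form hsurj (C.contMDiff_trivialModelForm (F := F))
    (by
      intro z w h
      obtain ⟨α, rfl⟩ := (C.quotMap_eq ρ).1 (Φ.toDiffeo.injective h)
      have hs : MDifferentiable (prodModel E F) (prodModel E F) (C.twist ρ α) :=
        (C.contMDiff_twist ρ α).mdifferentiable (by simp)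
      refine ⟨C.twist ρ α, hs z, rfl, funext fun y => congrArg Φ.toDiffeo
        ((C.quotMap_eq ρ).2 ⟨α, rfl⟩).symm, fun v => ?_⟩
      exact (C.trivialModelForm_mfderiv (hs z) v).trans
        (mcForm_mul_left (ρ α)⁻¹ (c := Prod.snd) mdifferentiableAt_snd v))
  have hsmul : ∀ (g : G), MDifferentiable (prodModel E F) (prodModel E F)
      (fun z : C.Total × G => (z.1, z.2 * g)) := fun g =>
    (contMDiff_fst.prodMk (contMDiff_snd.mul contMDiff_const)).mdifferentiable (n := ∞) (by simp)
  have key : ∀ q q' : G, q = q' → ∀ u : F, mcForm F q u = mcForm F q' u := by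
    rintro q _ rfl u
    rfl
  let A : Connection Q :=
    { form := η
      smooth := hη
      vertical := by
        intro p ξ
        obtain ⟨z, rfl⟩ := hsurj p
        have hc : MDifferentiable 𝓘(ℝ, F) (prodModel E F) (fun g : G => (z.1, z.2 * g)) :=
          (contMDiff_const.prodMk (contMDiff_const.mul contMDiff_id)).mdifferentiable (n := ∞)
            (by simp)
        refine (form_mfderiv_eq_of_eq_comp hηπ hmd (c := fun g : G => (z.1, z.2 * g))
          (d := fun g => Q.act (π z) g) (funext (hact z)) (hc 1) ξ).trans ?_
        refine (C.trivialModelForm_mfderiv (hc 1) ξ).trans ?_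
        exact (key _ _ (mul_one z.2) _).trans (mcForm_mulInvariantVectorField z.2 ξ)
      equivariant := by
        intro p g v
        obtain ⟨z, rfl⟩ := hsurj p
        obtain ⟨u, rfl⟩ := ((hπ z).mfderivToContinuousLinearEquiv (by simp)).surjective v
        have hR : MDifferentiable (prodModel E F) (prodModel E F) (fun q => Q.act q g) :=
          (Q.contMDiff_act.comp (contMDiff_id.prodMk contMDiff_const)).mdifferentiable (by simp)
        have h1 := DFunLike.congr_fun (mfderiv_comp z (hR (π z)) (hmd z)) u
        refine (congrArg (fun u : E × F => η (Q.act (π z) g) u) h1.symm).trans ?_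
        refine (form_mfderiv_eq_of_eq_comp hηπ hmd (c := fun z : C.Total × G => (z.1, z.2 * g))
          (funext fun z => hact z g) (hsmul g z) u).trans ?_
        refine (C.trivialModelForm_mfderiv (hsmul g z) u).trans ?_
        refine (mcForm_mul_right g (c := Prod.snd) mdifferentiableAt_snd u).trans ?_
        exact congrArg (Ad F G g⁻¹) (hηπ z u).symm }
  refine ⟨A, fun y => ?_, hηπ⟩
  obtain ⟨z, hz⟩ := hsurj y
  set χ := extChartAt (prodModel E F) z with hχ
  set e₀ := χ z with he₀
  let σ : E × F → Q.Total := π ∘ χ.symm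
  have hT : IsOpen χ.target := isOpen_extChartAt_target z
  have he₀T : e₀ ∈ χ.target := mem_extChartAt_target z
  have hχs : ContMDiffOn 𝓘(ℝ, E × F) (prodModel E F) ∞ χ.symm χ.target :=
    contMDiffOn_extChartAt_symm z
  have hσ : ContMDiffAt 𝓘(ℝ, E × F) (prodModel E F) ∞ σ e₀ :=
    hπ.contMDiff.contMDiffAt.comp e₀ (hχs.contMDiffAt (hT.mem_nhds he₀T))
  have hy : σ e₀ = y := (congrArg π (extChartAt_to_inv z)).trans hz
  subst hy
  have hχd : ∀ e ∈ χ.target, MDifferentiableAt 𝓘(ℝ, E × F) (prodModel E F) χ.symm e := fun e he =>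
    (hχs.contMDiffAt (hT.mem_nhds he)).mdifferentiableAt (by simp)
  -- Upstairs the form is the Maurer–Cartan form of the G-coordinate, so its structure equation
  -- gives dω = -[ω, ω] along σ. This is flatness, because the derivative of σ at e₀ is onto.
  have hpull : pullForm A.modelForm σ =ᶠ[𝓝 e₀] pullForm (mcForm F) (fun e => (χ.symm e).2) := by
    filter_upwards [hT.mem_nhds he₀T] with e he
    refine ContinuousLinearMap.ext fun u => ?_
    exact (form_mfderiv_eq_of_eq_comp hηπ hmd (d := σ) rfl (hχd e he) u).trans
      (C.trivialModelForm_mfderiv (hχd e he) u)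
  have hσsurj : ∀ v : TangentSpace (prodModel E F) (σ e₀),
      ∃ u : E × F, mfderiv 𝓘(ℝ, E × F) (prodModel E F) σ e₀ u = v := by
    intro v
    obtain ⟨u, rfl⟩ := ((hπ (χ.symm e₀)).mfderivToContinuousLinearEquiv (by simp)).surjective v
    have h1 := isInvertible_mfderivWithin_extChartAt_symm (I := prodModel E F) he₀T
    rw [ModelWithCorners.range_eq_univ, mfderivWithin_univ] at h1
    obtain ⟨u', rfl⟩ := h1.bijective.surjective u
    exact ⟨u', DFunLike.congr_fun (mfderiv_comp e₀ (hmd (χ.symm e₀)) (hχd e₀ he₀T)) u'⟩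
  intro v w
  obtain ⟨v, rfl⟩ := hσsurj v
  obtain ⟨w, rfl⟩ := hσsurj w
  have h1 := A.extd_pullForm hσ v w
  have h2 : ContMDiffAt 𝓘(ℝ, E × F) 𝓘(ℝ, F) ∞ (fun e => (χ.symm e).2) e₀ :=
    contMDiffAt_snd.comp e₀ (hχs.contMDiffAt (hT.mem_nhds he₀T))
  rw [hpull.extd_eq, extd_pullForm_mcForm h2, ← hpull.eq_of_nhds] at h1
  exact (congrArg (fun u : F => u + modelBracket G (pullForm A.modelForm σ e₀ v)
    (pullForm A.modelForm σ e₀ w)) h1.symm).trans (neg_add_cancel _)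

end FlatBundle.UniversalCover

end TrivialConnection

/-! ### Classification of flat bundles by holonomy -/

section Classification

set_option linter.unusedSectionVars false
set_option linter.checkUnivs false

namespace FlatBundle

variable {E F : Type*} [NormedAddCommGroup E] [NormedSpace ℝ E] [FiniteDimensional ℝ E]
  [NormedAddCommGroup F] [NormedSpace ℝ F] [FiniteDimensional ℝ F]
  {B : Type u} [TopologicalSpace B] [T2Space B] [ConnectedSpace B]
  [ChartedSpace E B] [IsManifold 𝓘(ℝ, E) ∞ B]
  {G : Type v} [TopologicalSpace G] [ChartedSpace F G] [Group G] [LieGroup 𝓘(ℝ, F) ∞ G]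
  {P Q : PrincipalBundle.{max u v} E F B G} {x₀ : B}

/-- Isomorphisms of flat bundles preserve the holonomy. -/
theorem Connection.IsHolonomy.map {A : Connection P} {A' : Connection Q} (hA : A.IsFlat)
    {p₀ : P.Total} (hp₀ : P.proj p₀ = x₀) {ρ : FundamentalGroup B x₀ →* G}
    (h : A.IsHolonomy p₀ ρ) (f : BundleIso P Q) (hf : ∀ p v, A.modelForm p v =
      A'.modelForm (f.toDiffeo p) (mfderiv (prodModel E F) (prodModel E F) f.toDiffeo p v)) :
    A'.IsHolonomy (f.toDiffeo p₀) ρ := by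
  obtain ⟨C⟩ := UniversalCover.nonempty (E := E) x₀
  obtain ⟨D⟩ := h.nonempty_developingMap hA C hp₀
  exact (D.comp f hf).isHolonomy

/-- Flat bundles with conjugate holonomy are isomorphic. -/
theorem exists_bundleIso_of_isConjRep {A : Connection P} {A' : Connection Q} (hA : A.IsFlat)
    (hA' : A'.IsFlat) {p₀ : P.Total} (hp₀ : P.proj p₀ = x₀) {q₀ : Q.Total} (hq₀ : Q.proj q₀ = x₀)
    {ρ ρ' : FundamentalGroup B x₀ →* G} (h : A.IsHolonomy p₀ ρ) (h' : A'.IsHolonomy q₀ ρ')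
    (hρ : IsConjRep ρ ρ') :
    ∃ f : BundleIso P Q, ∀ p v, A.modelForm p v =
      A'.modelForm (f.toDiffeo p) (mfderiv (prodModel E F) (prodModel E F) f.toDiffeo p v) := by
  obtain ⟨C⟩ := UniversalCover.nonempty (E := E) x₀
  obtain ⟨g, hg⟩ := hρ
  have h1 := h.act hA C hp₀ g
  have h2 : (MulAut.conj g⁻¹).toMonoidHom.comp ρ = ρ' := by
    ext α
    simp [hg]
  rw [h2] at h1
  obtain ⟨D⟩ := h1.nonempty_developingMap hA C ((P.proj_act _ _).trans hp₀)
  obtain ⟨D'⟩ := h'.nonempty_developingMap hA' C hq₀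
  obtain ⟨Φ, hΦ⟩ := D.exists_bundleIso
  obtain ⟨Φ', hΦ'⟩ := D'.exists_bundleIso
  exact exists_bundleIso_of_pullsBackToTrivial hΦ hΦ'

theorem UniversalCover.PullsBackToTrivial.exists_isHolonomy {A : Connection P}
    {ρ : FundamentalGroup B x₀ →* G} {C : UniversalCover.{u} E x₀}
    {Φ : BundleIso (C.assocBundle ρ) P} (h : C.PullsBackToTrivial ρ A Φ) :
    ∃ p₀ : P.Total, P.proj p₀ = x₀ ∧ A.IsHolonomy p₀ ρ := by
  obtain ⟨D⟩ := h.nonempty_developingMap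
  exact ⟨_, (Φ.proj_apply (C.quotMap ρ (C.base, 1))).trans C.proj_base, D.isHolonomy⟩

theorem FlatConnection.exists_isHolonomy (A : FlatConnection P) (x₀ : B) :
    ∃ (ρ : FundamentalGroup B x₀ →* G) (p₀ : P.Total), P.proj p₀ = x₀ ∧ A.1.IsHolonomy p₀ ρ := by
  obtain ⟨C⟩ := UniversalCover.nonempty (E := E) x₀
  obtain ⟨p₀, hp₀⟩ := P.proj_surjective x₀
  obtain ⟨ρ, hρ, -⟩ := Connection.existsUnique_isHolonomy A.2 C hp₀
  exact ⟨ρ, p₀, hp₀, hρ⟩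

/-- A gauge transformation with f^*A = A' carries the holonomy of A' at p' to that of A at f(p');
moving within the fibre conjugates. Taking A' = A shows that the class does not depend on the point.
-/
theorem FlatConnection.isConjRep {A A' : FlatConnection P} (h : (gaugeSetoid P).r A A')
    {ρ ρ' : FundamentalGroup B x₀ →* G}
    (hρ : ∃ p₀ : P.Total, P.proj p₀ = x₀ ∧ A.1.IsHolonomy p₀ ρ)
    (hρ' : ∃ p₀ : P.Total, P.proj p₀ = x₀ ∧ A'.1.IsHolonomy p₀ ρ') : IsConjRep ρ ρ' := by
  obtain ⟨C⟩ := UniversalCover.nonempty (E := E) x₀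
  obtain ⟨f, hf⟩ := h
  obtain ⟨p, hp, hρ⟩ := hρ
  obtain ⟨p', hp', hρ'⟩ := hρ'
  exact Connection.IsHolonomy.isConjRep A.2 C hp ((f.proj_apply _).trans hp') hρ
    (hρ'.map A'.2 hp' f hf)

/-- The conjugacy class of the holonomy of a gauge equivalence class of flat connections. -/
noncomputable def FlatModuli.hol (x₀ : B) (P : PrincipalBundle.{max u v} E F B G) :
    FlatModuli P → RepClass (FundamentalGroup B x₀) G :=
  Quotient.lift (fun A => Quotient.mk _ (A.exists_isHolonomy x₀).choose) fun A A' h =>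
    Quotient.sound (FlatConnection.isConjRep h (A.exists_isHolonomy x₀).choose_spec
      (A'.exists_isHolonomy x₀).choose_spec)

theorem FlatModuli.hol_mk (A : FlatConnection P) {p₀ : P.Total} {ρ : FundamentalGroup B x₀ →* G}
    (hp₀ : P.proj p₀ = x₀) (hρ : A.1.IsHolonomy p₀ ρ) :
    FlatModuli.hol x₀ P (Quotient.mk _ A) = Quotient.mk _ ρ :=
  Quotient.sound (FlatConnection.isConjRep ((gaugeSetoid P).iseqv.refl A)
    (A.exists_isHolonomy x₀).choose_spec ⟨p₀, hp₀, hρ⟩)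

/-- Allowing two different bundles serves both halves of injectivity: equal classes force the
bundles to be isomorphic and, on one bundle, the connections to be gauge equivalent. -/
theorem exists_bundleIso_of_hol_eq {A : FlatConnection P} {A' : FlatConnection Q}
    (h : FlatModuli.hol x₀ P (Quotient.mk _ A) = FlatModuli.hol x₀ Q (Quotient.mk _ A')) :
    ∃ f : BundleIso P Q, ∀ p v, A.1.modelForm p v =
      A'.1.modelForm (f.toDiffeo p) (mfderiv (prodModel E F) (prodModel E F) f.toDiffeo p v) := by
  obtain ⟨ρ, p, hp, hρ⟩ := A.exists_isHolonomy x₀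
  obtain ⟨ρ', p', hp', hρ'⟩ := A'.exists_isHolonomy x₀
  rw [FlatModuli.hol_mk A hp hρ, FlatModuli.hol_mk A' hp' hρ'] at h
  exact exists_bundleIso_of_isConjRep A.2 A'.2 hp hp' hρ hρ' (Quotient.exact h)

theorem FlatModuli.hol_injective (x₀ : B) (P : PrincipalBundle.{max u v} E F B G) :
    Function.Injective (FlatModuli.hol x₀ P) := by
  rintro ⟨A⟩ ⟨A'⟩ h
  -- The reversed equality gives f with A' = f^*A, the direction in which gauge equivalence is
  -- oriented.
  obtain ⟨f, hf⟩ := exists_bundleIso_of_hol_eq h.symm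
  exact Quotient.sound ⟨f, hf⟩

theorem FlatModuli.bijective_hol (x₀ : B) : Function.Bijective
    (fun s : Σ c : Quotient (isoSetoid.{max u v} E F B G), FlatModuli c.out =>
      FlatModuli.hol x₀ s.1.out s.2) := by
  constructor
  · rintro ⟨c, m⟩ ⟨c', m'⟩ h
    have hc : c = c' := by
      obtain ⟨A, rfl⟩ := Quotient.exists_rep m
      obtain ⟨A', rfl⟩ := Quotient.exists_rep m'
      obtain ⟨f, -⟩ := exists_bundleIso_of_hol_eq h
      rw [← c.out_eq, ← c'.out_eq]
      exact Quotient.sound ⟨f⟩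
    subst hc
    exact congrArg (Sigma.mk c) (FlatModuli.hol_injective x₀ c.out h)
  · rintro ⟨ρ⟩
    obtain ⟨C⟩ := UniversalCover.nonempty.{u} (E := E) x₀
    let c : Quotient (isoSetoid.{max u v} E F B G) := Quotient.mk _ (C.assocBundle ρ)
    -- The chosen representative of the class need not be the balanced product itself, so Θ is
    -- descended through an isomorphism onto the representative.
    obtain ⟨Φ⟩ : Nonempty (BundleIso (C.assocBundle ρ) c.out) := Quotient.exact c.out_eq.symm
    obtain ⟨A, hA, hΦ⟩ := C.exists_flat_pullsBackToTrivial Φ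
    obtain ⟨p₀, hp₀, hρ⟩ := hΦ.exists_isHolonomy
    exact ⟨⟨c, Quotient.mk _ ⟨A, hA⟩⟩, FlatModuli.hol_mk ⟨A, hA⟩ hp₀ hρ⟩

end FlatBundle

end Classification

theorem mainTheorem9
    {E F : Type*} [NormedAddCommGroup E] [NormedSpace ℝ E] [FiniteDimensional ℝ E]
    [NormedAddCommGroup F] [NormedSpace ℝ F] [FiniteDimensional ℝ F]
    {B : Type u} [TopologicalSpace B] [T2Space B] [ConnectedSpace B]
    [ChartedSpace E B] [IsManifold 𝓘(ℝ, E) ∞ B]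
    {G : Type v} [TopologicalSpace G] [ChartedSpace F G] [Group G] [LieGroup 𝓘(ℝ, F) ∞ G]
    (x₀ : B) :
    (∀ (P : PrincipalBundle.{max u v} E F B G) (A : FlatConnection P),
      (∀ p₀ : P.Total, P.proj p₀ = x₀ →
        ∃! ρ : FundamentalGroup B x₀ →* G, A.1.IsHolonomy p₀ ρ) ∧
      ∃ ρ : FundamentalGroup B x₀ →* G,
        (∃ p₀ : P.Total, P.proj p₀ = x₀ ∧ A.1.IsHolonomy p₀ ρ) ∧
        (∀ C : UniversalCover.{u} E x₀,
          Nonempty (BundleIso (C.assocBundle ρ) P) ∧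
          ∃ Φ : BundleIso (C.assocBundle ρ) P, C.PullsBackToTrivial ρ A.1 Φ) ∧
        ∀ ρ' : FundamentalGroup B x₀ →* G,
          ((∃ p₀ : P.Total, P.proj p₀ = x₀ ∧ A.1.IsHolonomy p₀ ρ') ∨
            ∃ (C : UniversalCover.{u} E x₀) (Φ : BundleIso (C.assocBundle ρ') P),
              C.PullsBackToTrivial ρ' A.1 Φ) →
          IsConjRep ρ ρ') ∧
    ∃ hol : ∀ P : PrincipalBundle.{max u v} E F B G,
        FlatModuli P → RepClass (FundamentalGroup B x₀) G,
      (∀ (P : PrincipalBundle.{max u v} E F B G) (A : FlatConnection P) (p₀ : P.Total)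
        (ρ : FundamentalGroup B x₀ →* G), P.proj p₀ = x₀ → A.1.IsHolonomy p₀ ρ →
          hol P (Quotient.mk _ A) = Quotient.mk _ ρ) ∧
      (∀ P, Function.Injective (hol P)) ∧
      Function.Bijective
        (fun s : Σ c : Quotient (isoSetoid.{max u v} E F B G), FlatModuli c.out =>
          hol s.1.out s.2) := by
  refine ⟨fun P A => ⟨fun p₀ hp₀ => ?_, ?_⟩, FlatModuli.hol x₀,
    fun P A p₀ ρ => FlatModuli.hol_mk A, FlatModuli.hol_injective x₀, FlatModuli.bijective_hol x₀⟩
  · obtain ⟨C⟩ := UniversalCover.nonempty (E := E) x₀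
    exact Connection.existsUnique_isHolonomy A.2 C hp₀
  · obtain ⟨ρ, hρ⟩ := A.exists_isHolonomy x₀
    refine ⟨ρ, hρ, fun C => ?_, fun ρ' h => ?_⟩
    · obtain ⟨p₀, hp₀, hρ⟩ := hρ
      obtain ⟨D⟩ := hρ.nonempty_developingMap A.2 C hp₀
      obtain ⟨Φ, hΦ⟩ := D.exists_bundleIso
      exact ⟨⟨Φ⟩, Φ, hΦ⟩
    -- A is gauge equivalent to itself, so two of its holonomies are conjugate; the second
    -- alternative also yields one, at the image of the class of (x̃₀, 1).
    · refine FlatConnection.isConjRep ((gaugeSetoid P).iseqv.refl A) hρ ?_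
      rcases h with h | ⟨C, Φ, hΦ⟩
      · exact h
      · exact hΦ.exists_isHolonomy
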